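/- **Setting.** Consider the two-user complex Gaussian interference channel $$Y_1=X_1+h_{12}X_2+Z_1,\qquad Y_2=h_{21}X_1+X_2+Z_2,$$ with $h_{12},h_{21}\in\mathbb C$, noises $Z_1,Z_2\sim\mathcal{CN}(0,1)$ that are i.i.d. in time and independent of the inputs, and powers $P_1,P_2>0$. The messages are independent and uniform on $\{1,\dots,\lfloor 2^{nR_i}\rfloor\}$, and every codeword satisfies $\|x_i^n\|^2\le nP_i$. A pair $(R_1,R_2)$ with $R_i\ge 0$ is achievable if some sequence of codes has average error probability tending to $0$ for both users. The capacity region is the closure of the set of achievable pairs. Assume weak interference, $|h_{12}|\le 1$ and $|h_{21}|\le 1$. All logarithms and differential entropies $h(\cdot)$ are to base 2. Let $\boldsymbol\kappa=(\sigma_{N_1},\sigma_{N_2},\sigma_{W_1},\sigma_{W_2},\rho_{N_1},\rho_{N_2},\rho_{W_1},\rho_{W_2})$ with $\sigma_{N_i},\sigma_{W_i}\in[0,1]$ and $\rho_{N_i},\rho_{W_i}\in\mathbb C$ of modulus at most $1$. Let $X_{iG}\sim\mathcal{CN}(0,P_i)$, let $(Z_1,N_1)$ and $(Z_2,W_2)$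 be jointly circularly symmetric Gaussian with $Z_i\sim\mathcal{CN}(0,1)$, $N_1\sim\mathcal{CN}(0,\sigma_{N_1}^2)$, $W_2\sim\mathcal{CN}(0,\sigma_{W_2}^2)$, $\mathbb E[Z_1N_1^*]=\rho_{N_1}\sigma_{N_1}$, $\mathbb E[Z_2W_2^*]=\rho_{W_2}\sigma_{W_2}$, where $X_{1G}$, $X_{2G}$, $(Z_1,N_1)$, $(Z_2,W_2)$ are independent. Put $$Y_{1G}=X_{1G}+h_{12}X_{2G}+Z_1,\quad Y_{2G}=h_{21}X_{1G}+X_{2G}+Z_2,\quad S_{1G}=h_{21}X_{1G}+N_1,\quad U_{2G}=h_{21}X_{1G}+W_2.$$ Write $\sigma_A^2$ for the variance of $A$ and $\sigma^2_{A|B}$ for the conditional variance of $A$ given $B$, and set $\sigma^2_{V_{N_1}}=\sigma^2_{Z_1|N_1}$, $\sigma^2_{V_{W_2}}=\sigma^2_{W_2|Z_2-W_2}$. Let $V_{N_1}\sim\mathcal{CN}(0,\sigma^2_{V_{N_1}})$, $V_{W_2}\sim\mathcal{CN}(0,\sigma^2_{V_{W_2}})$ and $Z_1^\circ\sim\mathcal{CN}(0,1)$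 be independent of each other and of all the variables above. **Theorem.** Suppose that $$\sigma_{V_{W_2}}^2\ge\min(\sigma_{N_1}^2,\sigma_{W_2}^2),\qquad \sigma_{V_{N_1}}^2\ge|h_{12}|^2\sigma_{Z_2-W_2}^2,\qquad \sigma^2_{Z_1-h_{21}^{-1}N_1}\le 1,$$ and that the inverses and entropies below exist, i.e. $h_{21}\ne0$, $\sigma_{V_{N_1}}>0$, $\sigma_{N_1}>0$, $\sigma^2_{Z_2-W_2}>0$. Then every $(R_1,R_2)$ in the capacity region satisfies $$R_1+R_2\le\tfrac12\Big\{h(Y_{1G}|S_{1G})-h(Y_{1G}+\tilde Z_1'|S_{1G})+h(Y_{2G}|U_{2G})-h(h_{12}Y_{2G}+\tilde V'_{N_1}|U_{2G})+\mathsf R_0\Big\},$$ where $\tilde Z_1'=\sqrt{1-\sigma^2_{Z_1-h_{21}^{-1}N_1}}\,Z_1^\circ$, $\tilde V'_{N_1}=\sqrt{1-\sigma_{V_{N_1}}^{-2}|h_{12}|^2\sigma^2_{Z_2-W_2}}\,V_{N_1}$ and $$\mathsf R_0=h(S_{1G})-h(h_{21}X_{1G}+V_{W_2})+h(U_{2G})-h(Y_{2G}|X_{2G})+h(Y_{1G})-h(N_1)+h(Y_{2G})-h(Z_2-W_2).$$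 Moreover, the right-hand side of the bound equals $$\frac12\left\{\log\frac{P_1+|h_{12}|^2P_2+1-\frac{|h_{21}^*P_1+\rho_{N_1}\sigma_{N_1}|^2}{|h_{21}|^2P_1+\sigma_{N_1}^2}}{|h_{12}|^2P_2+1-\frac{|\rho_{N_1}\sigma_{N_1}-h_{21}^{-1}\sigma_{N_1}^2|^2}{|h_{21}|^2P_1+\sigma_{N_1}^2}}+\log\frac{P_2+|h_{21}|^2P_1+1-\frac{\left||h_{21}|^2P_1+\rho_{W_2}\sigma_{W_2}\right|^2}{|h_{21}|^2P_1+\sigma_{W_2}^2}}{|h_{12}|^2P_2+\sigma_{V_{N_1}}^2-\frac{|h_{12}\rho_{W_2}\sigma_{W_2}-h_{12}\sigma_{W_2}^2|^2}{|h_{21}|^2P_1+\sigma_{W_2}^2}}+\mathsf R_0\right\},$$ and $$\mathsf R_0=\log\frac{|h_{21}|^2P_1+\sigma_{N_1}^2}{|h_{21}|^2P_1+\sigma_{V_{W_2}}^2}+\log\frac{|h_{21}|^2P_1+\sigma_{W_2}^2}{|h_{21}|^2P_1+1}+\log\frac{P_1+|h_{12}|^2P_2+1}{\sigma_{N_1}^2}+\log\frac{P_2+|h_{21}|^2P_1+1}{1+\sigma_{W_2}^2-2\,\mathrm{Re}(\rho_{W_2}\sigma_{W_2})}.$$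 The same holds with the user indices $1$ and $2$ interchanged throughout (conditions and bound). -/

import Mathlib

open MeasureTheory ProbabilityTheory Filter Topology
open scoped ComplexConjugate

noncomputable section

/-! ### Circularly symmetric Gaussians, variances and differential entropies -/

/-- The law `CN(0,1)` on `ℂ`: independent real and imaginary parts, each `N(0,1/2)`. -/
def stdCN : Measure ℂ :=
  ((gaussianReal 0 (1 / 2)).prod (gaussianReal 0 (1 / 2))).map
    Complex.measurableEquivRealProd.symm

instance : IsProbabilityMeasure stdCN :=
  Measure.isProbabilityMeasure_map Complex.measurableEquivRealProd.symm.measurable.aemeasurable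

/-- The law of a sequence of `k` i.i.d. `CN(0,1)` random variables. -/
def iidCN (k : ℕ) : Measure (Fin k → ℂ) := Measure.pi fun _ => stdCN

instance (k : ℕ) : IsProbabilityMeasure (iidCN k) := by
  unfold iidCN; infer_instance

/-- Variance `E|X - E X|²` of a complex random variable. -/
def cVar {Ω : Type*} [MeasurableSpace Ω] (μ : Measure Ω) (X : Ω → ℂ) : ℝ :=
  ∫ ω, ‖X ω - ∫ ω', X ω' ∂μ‖ ^ 2 ∂μ

/-- Conditional variance `E|X - E[X|Y]|²` of complex random variables (for jointly Gaussian
variables the conditional variance is the same for almost every value of `Y`). -/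
def cCondVar {Ω : Type*} [MeasurableSpace Ω] (μ : Measure Ω) (X Y : Ω → ℂ) : ℝ :=
  ∫ ω, ‖X ω - (condExp (MeasurableSpace.comap Y inferInstance) μ X) ω‖ ^ 2 ∂μ

/-- Differential entropy in bits of a law `ν` on `ℂ` that has a density with respect to
Lebesgue measure: `-∫ f log₂ f`. -/
def diffEntropy (ν : Measure ℂ) : ℝ :=
  -∫ z, (ν.rnDeriv volume z).toReal * Real.logb 2 (ν.rnDeriv volume z).toReal

/-- `h(X)`. -/
def entropyOf {Ω : Type*} [MeasurableSpace Ω] (μ : Measure Ω) (X : Ω → ℂ) : ℝ :=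
  diffEntropy (μ.map X)

/-- `h(X|Y) = ∫ h(X|Y=y) dP_Y(y)`. -/
def condEntropyOf {Ω : Type*} [MeasurableSpace Ω] (μ : Measure Ω) [IsFiniteMeasure μ]
    (X Y : Ω → ℂ) : ℝ :=
  ∫ y, diffEntropy (condDistrib X Y μ y) ∂(μ.map Y)

/-! ### The channel, codes and the capacity region -/

/-- The two-user complex Gaussian interference channel
`Y₁ = X₁ + h₁₂ X₂ + Z₁`, `Y₂ = h₂₁ X₁ + X₂ + Z₂` with power constraints `P₁`, `P₂`. -/
structure GIC where
  h₁₂ : ℂ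
  h₂₁ : ℂ
  P₁ : ℝ
  P₂ : ℝ

/-- A block code of length `n` with `M₁`, `M₂` messages and power constraints `P₁`, `P₂`. -/
structure Code (n M₁ M₂ : ℕ) (P₁ P₂ : ℝ) where
  enc₁ : Fin M₁ → Fin n → ℂ
  enc₂ : Fin M₂ → Fin n → ℂ
  power₁ : ∀ m, ∑ j, ‖enc₁ m j‖ ^ 2 ≤ n * P₁
  power₂ : ∀ m, ∑ j, ‖enc₂ m j‖ ^ 2 ≤ n * P₂
  dec₁ : (Fin n → ℂ) → Fin M₁
  dec₂ : (Fin n → ℂ) → Fin M₂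
  measurable_dec₁ : Measurable dec₁
  measurable_dec₂ : Measurable dec₂

namespace GIC

/-- Average error probability of user 1, for independent uniform messages. -/
def errorProb₁ (G : GIC) {n M₁ M₂ : ℕ} (c : Code n M₁ M₂ G.P₁ G.P₂) : ℝ :=
  (∑ m₁, ∑ m₂, (iidCN n).real
    {z | c.dec₁ (fun j => c.enc₁ m₁ j + G.h₁₂ * c.enc₂ m₂ j + z j) ≠ m₁}) / (M₁ * M₂)

/-- Average error probability of user 2, for independent uniform messages. -/
def errorProb₂ (G : GIC) {n M₁ M₂ : ℕ} (c : Code n M₁ M₂ G.P₁ G.P₂) : ℝ :=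
  (∑ m₁, ∑ m₂, (iidCN n).real
    {z | c.dec₂ (fun j => G.h₂₁ * c.enc₁ m₁ j + c.enc₂ m₂ j + z j) ≠ m₂}) / (M₁ * M₂)

/-- `(R₁, R₂)` is achievable: some sequence of codes with message sets
`{1, …, ⌊2^{nRᵢ}⌋}` has vanishing average error probability for both users. -/
def Achievable (G : GIC) (R : ℝ × ℝ) : Prop :=
  0 ≤ R.1 ∧ 0 ≤ R.2 ∧
    ∃ c : ∀ n : ℕ, Code n ⌊(2 : ℝ) ^ (n * R.1)⌋₊ ⌊(2 : ℝ) ^ (n * R.2)⌋₊ G.P₁ G.P₂,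
      Tendsto (fun n => G.errorProb₁ (c n)) atTop (𝓝 0) ∧
      Tendsto (fun n => G.errorProb₂ (c n)) atTop (𝓝 0)

/-- The capacity region: closure of the set of achievable rate pairs. -/
def capacityRegion (G : GIC) : Set (ℝ × ℝ) := closure {R | G.Achievable R}

/-- The weak interference regime. -/
def WeakInterference (G : GIC) : Prop := ‖G.h₁₂‖ ≤ 1 ∧ ‖G.h₂₁‖ ≤ 1

/-- The channel with the user indices interchanged. -/
def swap (G : GIC) : GIC := ⟨G.h₂₁, G.h₁₂, G.P₂, G.P₁⟩

end GIC

/-! ### The genie parameters -/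

/-- The parameter vector `κ` of the noises `Nᵢ` and `Wᵢ`: standard deviations and (complex)
correlation coefficients with `Zᵢ`. -/
structure GenieParams where
  σN₁ : ℝ
  σN₂ : ℝ
  σW₁ : ℝ
  σW₂ : ℝ
  ρN₁ : ℂ
  ρN₂ : ℂ
  ρW₁ : ℂ
  ρW₂ : ℂ

namespace GenieParams

def InRange (κ : GenieParams) : Prop :=
  κ.σN₁ ∈ Set.Icc (0 : ℝ) 1 ∧ κ.σN₂ ∈ Set.Icc (0 : ℝ) 1 ∧
  κ.σW₁ ∈ Set.Icc (0 : ℝ) 1 ∧ κ.σW₂ ∈ Set.Icc (0 : ℝ) 1 ∧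
  ‖κ.ρN₁‖ ≤ 1 ∧ ‖κ.ρN₂‖ ≤ 1 ∧ ‖κ.ρW₁‖ ≤ 1 ∧ ‖κ.ρW₂‖ ≤ 1

/-- The parameters with the user indices interchanged. -/
def swap (κ : GenieParams) : GenieParams :=
  ⟨κ.σN₂, κ.σN₁, κ.σW₂, κ.σW₁, κ.ρN₂, κ.ρN₁, κ.ρW₂, κ.ρW₁⟩

end GenieParams

namespace GIC

/-! ### The Gaussian single-letter variables

All are linear forms in nine i.i.d. `CN(0,1)` variables `ω 0, …, ω 8`. -/

variable (G : GIC) (κ : GenieParams)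

/-- `X₁G ~ CN(0,P₁)`. -/
def X₁G (ω : Fin 9 → ℂ) : ℂ := (√G.P₁ : ℝ) * ω 0

/-- `X₂G ~ CN(0,P₂)`. -/
def X₂G (ω : Fin 9 → ℂ) : ℂ := (√G.P₂ : ℝ) * ω 1

/-- `Z₁ ~ CN(0,1)`. -/
def Z₁ (ω : Fin 9 → ℂ) : ℂ := ω 2

/-- `Z₂ ~ CN(0,1)`. -/
def Z₂ (ω : Fin 9 → ℂ) : ℂ := ω 4

/-- `N₁ ~ CN(0,σ²_{N₁})`, jointly Gaussian with `Z₁`, `E[Z₁ N₁*] = ρ_{N₁} σ_{N₁}`. -/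
def N₁ (ω : Fin 9 → ℂ) : ℂ :=
  (κ.σN₁ : ℂ) * (conj κ.ρN₁ * ω 2 + (√(1 - ‖κ.ρN₁‖ ^ 2) : ℝ) * ω 3)

/-- `W₂ ~ CN(0,σ²_{W₂})`, jointly Gaussian with `Z₂`, `E[Z₂ W₂*] = ρ_{W₂} σ_{W₂}`. -/
def W₂ (ω : Fin 9 → ℂ) : ℂ :=
  (κ.σW₂ : ℂ) * (conj κ.ρW₂ * ω 4 + (√(1 - ‖κ.ρW₂‖ ^ 2) : ℝ) * ω 5)

def Y₁G (ω : Fin 9 → ℂ) : ℂ := G.X₁G ω + G.h₁₂ * G.X₂G ω + Z₁ ω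

def Y₂G (ω : Fin 9 → ℂ) : ℂ := G.h₂₁ * G.X₁G ω + G.X₂G ω + Z₂ ω

/-- The Etkin-type genie signal `S₁G = h₂₁ X₁G + N₁`. -/
def S₁G (ω : Fin 9 → ℂ) : ℂ := G.h₂₁ * G.X₁G ω + N₁ κ ω

/-- The change-of-interference genie signal `U₂G = h₂₁ X₁G + W₂`. -/
def U₂G (ω : Fin 9 → ℂ) : ℂ := G.h₂₁ * G.X₁G ω + W₂ κ ω

/-- `σ²_{V_{N₁}} = σ²_{Z₁|N₁}`. -/
def varVN₁ : ℝ := cCondVar (iidCN 9) Z₁ (N₁ κ)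

/-- `σ²_{Z₂-W₂}`. -/
def varZ₂subW₂ : ℝ := cVar (iidCN 9) fun ω => Z₂ ω - W₂ κ ω

/-- `σ²_{V_{W₂}} = σ²_{W₂|Z₂-W₂}`. -/
def varVW₂ : ℝ := cCondVar (iidCN 9) (W₂ κ) fun ω => Z₂ ω - W₂ κ ω

/-- `σ²_{Z₁ - h₂₁⁻¹ N₁}`. -/
def varZ₁subN₁ : ℝ := cVar (iidCN 9) fun ω => Z₁ ω - G.h₂₁⁻¹ * N₁ κ ω

/-- `V_{W₂} ~ CN(0,σ²_{V_{W₂}})`, independent of all the variables above. -/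
def VW₂ (ω : Fin 9 → ℂ) : ℂ := (√(varVW₂ κ) : ℝ) * ω 6

/-- `V_{N₁} ~ CN(0,σ²_{V_{N₁}})`, independent of all the variables above. -/
def VN₁ (ω : Fin 9 → ℂ) : ℂ := (√(varVN₁ κ) : ℝ) * ω 7

/-- `√(1 - σ²_{Z₁-h₂₁⁻¹N₁})` times a copy `ω 8` of `Z₁` that is independent of all the variables
above. -/
def tildeZ₁ (ω : Fin 9 → ℂ) : ℂ := (√(1 - G.varZ₁subN₁ κ) : ℝ) * ω 8

/-- `√(1 - σ_{V_{N₁}}⁻² |h₁₂|² σ²_{Z₂-W₂}) V_{N₁}`. -/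
def tildeVN₁ (ω : Fin 9 → ℂ) : ℂ :=
  (√(1 - (varVN₁ κ)⁻¹ * ‖G.h₁₂‖ ^ 2 * varZ₂subW₂ κ) : ℝ) * VN₁ κ ω

/-! ### The bound -/

/-- The conditions on `κ`. The last four conjuncts say that the inverses `h₂₁⁻¹`, `σ_{V_{N₁}}⁻²`
and the entropies `h(N₁)`, `h(Z₂-W₂)` occurring in the bound exist. -/
def Admissible : Prop :=
  min (κ.σN₁ ^ 2) (κ.σW₂ ^ 2) ≤ varVW₂ κ ∧
  ‖G.h₁₂‖ ^ 2 * varZ₂subW₂ κ ≤ varVN₁ κ ∧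
  G.varZ₁subN₁ κ ≤ 1 ∧
  G.h₂₁ ≠ 0 ∧ 0 < varVN₁ κ ∧ 0 < κ.σN₁ ∧ 0 < varZ₂subW₂ κ

/-- `R₀` as a combination of differential entropies. -/
def R₀ : ℝ :=
  entropyOf (iidCN 9) (G.S₁G κ)
    - entropyOf (iidCN 9) (fun ω => G.h₂₁ * G.X₁G ω + VW₂ κ ω)
    + entropyOf (iidCN 9) (G.U₂G κ)
    - condEntropyOf (iidCN 9) G.Y₂G G.X₂G
    + entropyOf (iidCN 9) G.Y₁G
    - entropyOf (iidCN 9) (N₁ κ)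
    + entropyOf (iidCN 9) G.Y₂G
    - entropyOf (iidCN 9) (fun ω => Z₂ ω - W₂ κ ω)

/-- The sum-rate bound as a combination of differential entropies. -/
def entropyBound : ℝ :=
  1 / 2 * (condEntropyOf (iidCN 9) G.Y₁G (G.S₁G κ)
    - condEntropyOf (iidCN 9) (fun ω => G.Y₁G ω + G.tildeZ₁ κ ω) (G.S₁G κ)
    + condEntropyOf (iidCN 9) G.Y₂G (G.U₂G κ)
    - condEntropyOf (iidCN 9) (fun ω => G.h₁₂ * G.Y₂G ω + G.tildeVN₁ κ ω) (G.U₂G κ)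
    + G.R₀ κ)

/-- The closed form of `R₀`. -/
def R₀Log : ℝ :=
  Real.logb 2 ((‖G.h₂₁‖ ^ 2 * G.P₁ + κ.σN₁ ^ 2) / (‖G.h₂₁‖ ^ 2 * G.P₁ + varVW₂ κ))
    + Real.logb 2 ((‖G.h₂₁‖ ^ 2 * G.P₁ + κ.σW₂ ^ 2) / (‖G.h₂₁‖ ^ 2 * G.P₁ + 1))
    + Real.logb 2 ((G.P₁ + ‖G.h₁₂‖ ^ 2 * G.P₂ + 1) / κ.σN₁ ^ 2)
    + Real.logb 2 ((G.P₂ + ‖G.h₂₁‖ ^ 2 * G.P₁ + 1) /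
        (1 + κ.σW₂ ^ 2 - 2 * (κ.ρW₂ * κ.σW₂).re))

/-- The closed form of the sum-rate bound. -/
def logBound : ℝ :=
  1 / 2 * (Real.logb 2
      ((G.P₁ + ‖G.h₁₂‖ ^ 2 * G.P₂ + 1
          - ‖conj G.h₂₁ * G.P₁ + κ.ρN₁ * κ.σN₁‖ ^ 2 / (‖G.h₂₁‖ ^ 2 * G.P₁ + κ.σN₁ ^ 2)) /
        (‖G.h₁₂‖ ^ 2 * G.P₂ + 1
          - ‖κ.ρN₁ * κ.σN₁ - G.h₂₁⁻¹ * (κ.σN₁ : ℂ) ^ 2‖ ^ 2 /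
              (‖G.h₂₁‖ ^ 2 * G.P₁ + κ.σN₁ ^ 2)))
    + Real.logb 2
      ((G.P₂ + ‖G.h₂₁‖ ^ 2 * G.P₁ + 1
          - ‖((‖G.h₂₁‖ ^ 2 * G.P₁ : ℝ) : ℂ) + κ.ρW₂ * κ.σW₂‖ ^ 2 /
              (‖G.h₂₁‖ ^ 2 * G.P₁ + κ.σW₂ ^ 2)) /
        (‖G.h₁₂‖ ^ 2 * G.P₂ + varVN₁ κ
          - ‖G.h₁₂ * κ.ρW₂ * κ.σW₂ - G.h₁₂ * (κ.σW₂ : ℂ) ^ 2‖ ^ 2 /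
              (‖G.h₂₁‖ ^ 2 * G.P₁ + κ.σW₂ ^ 2)))
    + G.R₀Log κ)

end GIC

end

noncomputable section

/-! ### Standard complex Gaussian vectors -/

/-! Twice the sum rate is bounded by adding four converse inequalities, two per user: one without
help and one with a genie signal. For block length n, with entropies of n-letter variables and up to
Fano terms: n R₁ ≤ h(Y₁) - h(h₁₂X₂ + Z₁), n R₂ ≤ h(Y₂) - h(h₂₁X₁ + Z₂), n R₁ ≤ h(S₁) + h(Y₁|S₁) -
h(N₁) - h(h₁₂X₂ + V_{N₁}), n R₂ ≤ h(U₂) + h(Y₂|U₂) - h(Z₂ - W₂) - h(h₂₁X₁ + V_{W₂}).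

The entropies h(Y₁), h(Y₂) are at most those of Gaussians of the same power. The conditional
entropies are handled by the worst-additive-noise principle: independent Gaussian noise raises
entropy at least as much as it would for a Gaussian input of the same power. So h(Y₁|S₁) is at most
h(Y₁ + Z̃₁|S₁) plus a Gaussian difference. Subtracting h₂₁⁻¹S₁ removes X₁ and leaves h₁₂X₂ plus
noise, and the variance of Z̃₁ makes this noise have variance exactly 1. Dropping the conditioning
gives h(h₁₂X₂ + Z₁), which cancels. Similarly h(Y₂|U₂) is compared with h(h₁₂Y₂ + Ṽ|U₂); since
h₁₂(Y₂ - U₂) + Ṽ is h₁₂X₂ with noise of variance σ²_{V_{N₁}}, the entropy h(h₁₂X₂ + V_{N₁}) cancels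
too. What remains are four entropies of h₂₁X₁ with Gaussian noise: variances σ²_{N₁}, σ²_{W₂} with a
plus sign, σ²_{V_{W₂}} and 1 with a minus sign. The hypothesis on the minimum allows each plus to be
paired with a minus of larger noise, and the worst-noise principle applies again.

Both information inequalities come from Gibbs' inequality `integral_log_nonpos`, applied to a
suitable quotient of densities of mean at most 1: `fano` and `worst_noise`. The densities are
mixtures of Gaussians over finite codebooks, so their logarithms grow at most quadratically
(`GaussBounds`) and are integrable. The channel versions are `fano_single`, `fano_pair`,
`worst_noise_pair` and `negEnt_sub_le`; the genie inequalities are `etkin_genie_bound` and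
`interference_genie_bound`; `sum_log_le` adds everything up. Codebooks are centred beforehand so
that powers of independent signals add.

If σ²_{V_{W₂}} = 0 the pair (Y₂, U₂) has no conditional density given X₂; `exists_tendsto_logBound`
approximates such parameters by nondegenerate ones. The closed forms are linear algebra: every
single-letter variable is a linear form `lin a` in nine standard Gaussians, orthogonal forms are
independent, and (conditional) entropies depend only on `lsq a` or on the norm of the regression
residual `resid a b`. -/

/-- The squared dual norm of a real-linear functional on `ℂ`. -/
def dualSq (l : ℂ →L[ℝ] ℝ) : ℝ := l 1 ^ 2 + l Complex.I ^ 2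

lemma dual_apply_eq (l : ℂ →L[ℝ] ℝ) (z : ℂ) : l z = z.re * l 1 + z.im * l Complex.I := by
  have h : z = z.re • (1 : ℂ) + z.im • Complex.I := by
    apply Complex.ext <;> simp
  conv_lhs => rw [h, map_add, map_smul, map_smul]
  rfl

/-- The real and imaginary parts have variance 1/2 each, hence the factor 1/4 instead of the usual
1/2. -/
lemma charFunDual_stdCN (l : ℂ →L[ℝ] ℝ) :
    charFunDual stdCN l = Complex.exp (-(dualSq l : ℂ) / 4) := by
  rw [charFunDual_apply, stdCN, integral_map_equiv]
  have h1 : ∀ p : ℝ × ℝ, Complex.exp (l (Complex.measurableEquivRealProd.symm p) * Complex.I)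
      = Complex.exp ((l 1 : ℂ) * p.1 * Complex.I) *
        Complex.exp ((l Complex.I : ℂ) * p.2 * Complex.I) := by
    intro p
    rw [dual_apply_eq, ← Complex.exp_add]
    simp only [Complex.measurableEquivRealProd_symm_apply]
    push_cast
    ring_nf
  have h2 := charFun_gaussianReal (μ := 0) (v := 1 / 2) (l 1)
  have h3 := charFun_gaussianReal (μ := 0) (v := 1 / 2) (l Complex.I)
  rw [charFun_apply_real] at h2 h3
  simp_rw [h1]
  rw [integral_prod_mul (fun x : ℝ => Complex.exp ((l 1 : ℂ) * x * Complex.I))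
    (fun x : ℝ => Complex.exp ((l Complex.I : ℂ) * x * Complex.I)), h2, h3, ← Complex.exp_add]
  congr 1
  simp [dualSq]
  ring

/-- Precomposition with multiplication by `a` scales the squared dual norm by `‖a‖ ^ 2`. -/
lemma dualSq_comp_mul (l : ℂ →L[ℝ] ℝ) (f : ℂ →L[ℝ] ℂ) (a : ℂ) (hf : ∀ z, f z = a * z) :
    dualSq (l.comp f) = ‖a‖ ^ 2 * dualSq l := by
  rw [← Complex.normSq_eq_norm_sq, Complex.normSq_apply]
  simp only [dualSq, ContinuousLinearMap.comp_apply, hf]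
  rw [dual_apply_eq l (a * 1), dual_apply_eq l (a * Complex.I)]
  simp
  ring

lemma stdCN_eq_withDensity :
    stdCN = volume.withDensity fun z => ENNReal.ofReal (Real.pi⁻¹ * Real.exp (-‖z‖ ^ 2)) := by
  have hm : Measurable fun z : ℂ => ENNReal.ofReal (Real.pi⁻¹ * Real.exp (-‖z‖ ^ 2)) := by fun_prop
  refine Measure.ext_of_lintegral _ fun f hf => ?_
  rw [stdCN, lintegral_map_equiv, lintegral_withDensity_eq_lintegral_mul _ hm hf,
    gaussianReal_of_var_ne_zero _ (by norm_num),
    prod_withDensity (by fun_prop) (by fun_prop),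
    lintegral_withDensity_eq_lintegral_mul _ (by fun_prop) (by fun_prop),
    ← Complex.volume_preserving_equiv_real_prod.symm.lintegral_comp_emb
      Complex.measurableEquivRealProd.symm.measurableEmbedding]
  refine lintegral_congr fun p => ?_
  simp only [Pi.mul_apply]
  congr 1
  rw [gaussianPDF, gaussianPDF, ← ENNReal.ofReal_mul (gaussianPDFReal_nonneg _ _ _)]
  congr 1
  have h0 : ‖Complex.measurableEquivRealProd.symm p‖ ^ 2 = p.1 ^ 2 + p.2 ^ 2 := by
    rw [← Complex.normSq_eq_norm_sq, Complex.normSq_apply]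
    simp [Complex.measurableEquivRealProd_symm_apply]; ring
  rw [h0]
  simp only [gaussianPDFReal]
  have h2 : (2 * Real.pi * ((1 / 2 : NNReal) : ℝ)) = Real.pi := by push_cast; ring
  rw [h2]
  have h3 : (√Real.pi)⁻¹ * (√Real.pi)⁻¹ = Real.pi⁻¹ := by
    rw [← mul_inv, Real.mul_self_sqrt Real.pi_pos.le]
  calc _ = (√Real.pi)⁻¹ * (√Real.pi)⁻¹ * (Real.exp (-(p.1 - 0) ^ 2 / (2 * ((1 / 2 : NNReal) : ℝ)))
        * Real.exp (-(p.2 - 0) ^ 2 / (2 * ((1 / 2 : NNReal) : ℝ)))) := by ring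
    _ = _ := by
      rw [h3, ← Real.exp_add]
      congr 2
      push_cast
      ring

/-- The squared Euclidean norm on `ℂⁿ`. -/
def nsq {n : ℕ} (y : Fin n → ℂ) : ℝ := ∑ j, ‖y j‖ ^ 2

/-- The density of `CN(0, v)^n`. -/
def gDens {n : ℕ} (v : ℝ) (y : Fin n → ℂ) : ℝ := ((Real.pi * v) ^ n)⁻¹ * Real.exp (-nsq y / v)

lemma nsq_nonneg {n : ℕ} (y : Fin n → ℂ) : 0 ≤ nsq y := Finset.sum_nonneg fun _ _ => by positivity

@[fun_prop]
lemma measurable_nsq {n : ℕ} : Measurable (nsq (n := n)) := by unfold nsq; fun_prop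

@[fun_prop]
lemma measurable_gDens {n : ℕ} (v : ℝ) : Measurable (gDens (n := n) v) := by
  unfold gDens; fun_prop

lemma gDens_pos {n : ℕ} {v : ℝ} (hv : 0 < v) (y : Fin n → ℂ) : 0 < gDens v y := by
  unfold gDens; positivity

lemma log_gDens {n : ℕ} {v : ℝ} (hv : 0 < v) (y : Fin n → ℂ) :
    Real.log (gDens v y) = -(n * Real.log (Real.pi * v)) - nsq y / v := by
  unfold gDens
  rw [Real.log_mul (by positivity) (by positivity), Real.log_inv, Real.log_pow, Real.log_exp]
  ring

lemma gDens_le {n : ℕ} {v : ℝ} (hv : 0 < v) (y : Fin n → ℂ) :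
    gDens v y ≤ ((Real.pi * v) ^ n)⁻¹ := by
  unfold gDens
  have : Real.exp (-nsq y / v) ≤ 1 :=
    Real.exp_le_one_iff.2 (div_nonpos_of_nonpos_of_nonneg (by linarith [nsq_nonneg y]) hv.le)
  have h2 : 0 ≤ ((Real.pi * v) ^ n)⁻¹ := by positivity
  nlinarith

lemma nsq_smul {n : ℕ} (r : ℝ) (y : Fin n → ℂ) : nsq (r • y) = r ^ 2 * nsq y := by
  simp [nsq, Finset.mul_sum, mul_pow]

lemma nsq_smul_complex {n : ℕ} (r : ℂ) (y : Fin n → ℂ) : nsq (r • y) = ‖r‖ ^ 2 * nsq y := by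
  simp [nsq, Finset.mul_sum, mul_pow]

lemma nsq_neg {n : ℕ} (y : Fin n → ℂ) : nsq (-y) = nsq y := by simp [nsq]

lemma nsq_add_le {n : ℕ} (y z : Fin n → ℂ) : nsq (y + z) ≤ 2 * nsq y + 2 * nsq z := by
  simp only [nsq, Finset.mul_sum, ← Finset.sum_add_distrib]
  refine Finset.sum_le_sum fun j _ => ?_
  have h := norm_add_le (y j) (z j)
  have h0 := norm_nonneg (y j + z j)
  simp only [Pi.add_apply]
  nlinarith [sq_nonneg (‖y j‖ - ‖z j‖)]

lemma iidCN_eq_withDensity (n : ℕ) :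
    iidCN n = volume.withDensity fun y => ENNReal.ofReal (gDens 1 y) := by
  unfold iidCN
  symm
  refine (Measure.pi_eq fun s hs => ?_).symm
  rw [withDensity_apply _ (MeasurableSet.univ_pi hs)]
  let f : ℂ → ℝ := fun z => Real.pi⁻¹ * Real.exp (-‖z‖ ^ 2)
  have hf0 : ∀ z, 0 ≤ f z := fun z => by positivity
  have hfm : Measurable f := by fun_prop
  have hfi : Integrable f := by
    refine ⟨hfm.aestronglyMeasurable, ?_⟩
    rw [hasFiniteIntegral_iff_ofReal (ae_of_all _ hf0)]
    have := measure_univ (μ := stdCN)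
    rw [stdCN_eq_withDensity, withDensity_apply _ MeasurableSet.univ, Measure.restrict_univ] at this
    rw [this]; exact ENNReal.one_lt_top
  have h1 : ∀ y : Fin n → ℂ, gDens 1 y = ∏ j, f (y j) := by
    intro y
    simp only [f]
    rw [Finset.prod_mul_distrib, ← Real.exp_sum]
    simp [gDens, nsq]
  simp_rw [h1]
  rw [volume_pi, Measure.restrict_pi_pi,
    ← ofReal_integral_eq_lintegral_ofReal (Integrable.fintype_prod fun j => hfi.restrict)
      (ae_of_all _ fun y => Finset.prod_nonneg fun j _ => hf0 _),
    integral_fintype_prod_eq_prod (f := fun _ => f),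
    ENNReal.ofReal_prod_of_nonneg fun j _ => integral_nonneg hf0]
  refine Finset.prod_congr rfl fun j _ => ?_
  rw [stdCN_eq_withDensity, withDensity_apply _ (hs j),
    ofReal_integral_eq_lintegral_ofReal hfi.restrict (ae_of_all _ hf0)]

/-- Change of variables in real dimension 2n: scaling by √v has Jacobian v ^ n, which is the ratio
of the normalising constants of `gDens v` and `gDens 1`. -/
lemma lintegral_iidCN_affine {n : ℕ} {v : ℝ} (hv : 0 < v) (x : Fin n → ℂ)
    {F : (Fin n → ℂ) → ENNReal} (hF : Measurable F) :
    ∫⁻ w, F (x + (√v : ℝ) • w) ∂iidCN n = ∫⁻ y, F y * ENNReal.ofReal (gDens v (y - x)) := by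
  have hs : √v ≠ 0 := (Real.sqrt_pos.2 hv).ne'
  have h1 : ∫⁻ y, F y * ENNReal.ofReal (gDens v (y - x))
      = ∫⁻ y, F (x + y) * ENNReal.ofReal (gDens v y) := by
    rw [← lintegral_add_left_eq_self _ x]
    simp
  have h2 := Measure.map_addHaar_smul (volume : Measure (Fin n → ℂ)) hs
  have hfr : Module.finrank ℝ (Fin n → ℂ) = 2 * n := by
    rw [Module.finrank_pi_fintype]; simp [mul_comm]
  have h3 : ENNReal.ofReal |(√v ^ Module.finrank ℝ (Fin n → ℂ))⁻¹| = ENNReal.ofReal ((v ^ n)⁻¹) := by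
    rw [hfr, pow_mul, Real.sq_sqrt hv.le, abs_of_pos (by positivity)]
  have h4 : ENNReal.ofReal ((v ^ n)⁻¹) ≠ 0 := by
    simp [hv]
  have h5 : ENNReal.ofReal ((v ^ n)⁻¹) * ∫⁻ y, F (x + y) * ENNReal.ofReal (gDens v y)
      = ∫⁻ w, F (x + (√v : ℝ) • w) * ENNReal.ofReal (gDens v ((√v : ℝ) • w)) := by
    rw [← h3, ← smul_eq_mul, ← lintegral_smul_measure, ← h2,
      lintegral_map (by fun_prop) (by fun_prop)]
  rw [h1, iidCN_eq_withDensity, lintegral_withDensity_eq_lintegral_mul _ (by fun_prop) (by fun_prop)]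
  have h6 : ∀ w : Fin n → ℂ, ENNReal.ofReal (gDens v ((√v : ℝ) • w))
      = ENNReal.ofReal ((v ^ n)⁻¹) * ENNReal.ofReal (gDens 1 w) := by
    intro w
    rw [← ENNReal.ofReal_mul (by positivity)]
    congr 1
    simp only [gDens, nsq_smul, Real.sq_sqrt hv.le]
    rw [mul_pow, mul_inv]
    have : -(v * nsq w) / v = -nsq w / 1 := by field_simp
    rw [this]; simp; ring
  have h7 : ∫⁻ w, F (x + (√v : ℝ) • w) * ENNReal.ofReal (gDens v ((√v : ℝ) • w))
     = ENNReal.ofReal ((v ^ n)⁻¹) *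
        ∫⁻ w, ENNReal.ofReal (gDens 1 w) * F (x + (√v : ℝ) • w) := by
    rw [← lintegral_const_mul _ (by fun_prop)]
    refine lintegral_congr fun w => ?_
    rw [h6]; ring
  have h8 := h5.trans h7
  have := (ENNReal.mul_right_inj h4 ENNReal.ofReal_ne_top).1 h8
  rw [this]
  rfl

lemma lintegral_gDens {n : ℕ} {v : ℝ} (hv : 0 < v) (x : Fin n → ℂ) :
    ∫⁻ y, ENNReal.ofReal (gDens v (y - x)) = 1 := by
  have := lintegral_iidCN_affine hv x (F := fun _ => 1) measurable_const
  simpa using this.symm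

/-! ### Laws and moments of linear forms -/

lemma map_re_stdCN : stdCN.map Complex.re = gaussianReal 0 (1 / 2) := by
  have h : Complex.re ∘ Complex.measurableEquivRealProd.symm = Prod.fst := by
    ext p; simp [Complex.measurableEquivRealProd_symm_apply]
  rw [stdCN, Measure.map_map (by fun_prop) (by fun_prop), h, measurePreserving_fst.map_eq]

lemma map_im_stdCN : stdCN.map Complex.im = gaussianReal 0 (1 / 2) := by
  have h : Complex.im ∘ Complex.measurableEquivRealProd.symm = Prod.snd := by
    ext p; simp [Complex.measurableEquivRealProd_symm_apply]
  rw [stdCN, Measure.map_map (by fun_prop) (by fun_prop), h, measurePreserving_snd.map_eq]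

lemma memLp_re_stdCN : MemLp (fun z : ℂ => z.re) 2 stdCN := by
  have h := memLp_id_gaussianReal' (μ := 0) (v := 1 / 2) 2 (by simp)
  rw [← map_re_stdCN] at h
  exact (memLp_map_measure_iff (g := id) (by fun_prop) (by fun_prop)).1 h

lemma memLp_im_stdCN : MemLp (fun z : ℂ => z.im) 2 stdCN := by
  have h := memLp_id_gaussianReal' (μ := 0) (v := 1 / 2) 2 (by simp)
  rw [← map_im_stdCN] at h
  exact (memLp_map_measure_iff (g := id) (by fun_prop) (by fun_prop)).1 h

lemma integral_re_stdCN : ∫ z, z.re ∂stdCN = 0 := by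
  have h := integral_id_gaussianReal (μ := 0) (v := 1 / 2)
  rw [← map_re_stdCN, integral_map (by fun_prop) (by fun_prop)] at h
  exact h

lemma integral_im_stdCN : ∫ z, z.im ∂stdCN = 0 := by
  have h := integral_id_gaussianReal (μ := 0) (v := 1 / 2)
  rw [← map_im_stdCN, integral_map (by fun_prop) (by fun_prop)] at h
  exact h

lemma integral_sq_gaussianReal_half : ∫ x, x ^ 2 ∂gaussianReal 0 (1 / 2) = 1 / 2 := by
  have h := variance_fun_id_gaussianReal (μ := 0) (v := 1 / 2)
  rw [variance_eq_integral measurable_id'.aemeasurable] at h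
  simp only [integral_id_gaussianReal, sub_zero] at h
  rw [h]; simp

lemma integral_re_sq_stdCN : ∫ z, z.re ^ 2 ∂stdCN = 1 / 2 := by
  have h := integral_sq_gaussianReal_half
  rw [← map_re_stdCN, integral_map (by fun_prop) (by fun_prop)] at h
  exact h

lemma integral_im_sq_stdCN : ∫ z, z.im ^ 2 ∂stdCN = 1 / 2 := by
  have h := integral_sq_gaussianReal_half
  rw [← map_im_stdCN, integral_map (by fun_prop) (by fun_prop)] at h
  exact h

lemma memLp_id_stdCN : MemLp (fun z : ℂ => z) 2 stdCN := by
  have h := memLp_re_stdCN.ofReal (K := ℂ) |>.add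
    ((memLp_im_stdCN.ofReal (K := ℂ)).const_mul Complex.I)
  refine h.congr_norm (by fun_prop) (ae_of_all _ fun z => ?_)
  simp only [Pi.add_apply]
  congr 1
  apply Complex.ext <;> simp

lemma integrable_id_stdCN : Integrable (fun z : ℂ => z) stdCN :=
  memLp_id_stdCN.integrable (by norm_num)

lemma integral_id_stdCN : ∫ z, z ∂stdCN = 0 := by
  apply Complex.ext
  · have := Complex.reCLM.integral_comp_comm integrable_id_stdCN
    simp only [Complex.reCLM_apply] at this
    rw [← this, integral_re_stdCN]; rfl
  · have := Complex.imCLM.integral_comp_comm integrable_id_stdCN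
    simp only [Complex.imCLM_apply] at this
    rw [← this, integral_im_stdCN]; rfl

lemma integrable_normSq_stdCN : Integrable (fun z : ℂ => ‖z‖ ^ 2) stdCN :=
  memLp_id_stdCN.integrable_norm_pow (by norm_num)

lemma integral_normSq_stdCN : ∫ z, ‖z‖ ^ 2 ∂stdCN = 1 := by
  have h : ∀ z : ℂ, ‖z‖ ^ 2 = z.re ^ 2 + z.im ^ 2 := fun z => by
    rw [← Complex.normSq_eq_norm_sq, Complex.normSq_apply]; ring
  simp_rw [h]
  rw [integral_add memLp_re_stdCN.integrable_sq memLp_im_stdCN.integrable_sq,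
    integral_re_sq_stdCN, integral_im_sq_stdCN]
  norm_num

/-- Second moment of `p + u w` for `w` standard. -/
lemma integrable_norm_affine_stdCN (p u : ℂ) :
    Integrable (fun z : ℂ => ‖p + u * z‖ ^ 2) stdCN :=
  ((memLp_const p).add (memLp_id_stdCN.const_mul u)).integrable_norm_pow (by norm_num)

lemma integral_norm_affine_stdCN (p u : ℂ) :
    ∫ z, ‖p + u * z‖ ^ 2 ∂stdCN = ‖p‖ ^ 2 + ‖u‖ ^ 2 := by
  have h : ∀ z : ℂ, ‖p + u * z‖ ^ 2
      = ‖p‖ ^ 2 + (2 * (conj p * u * z).re + ‖u‖ ^ 2 * ‖z‖ ^ 2) := by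
    intro z
    simp only [← Complex.normSq_eq_norm_sq, Complex.normSq_apply]
    simp; ring
  simp_rw [h]
  have i1 : Integrable (fun z : ℂ => (conj p * u * z).re) stdCN :=
    (integrable_id_stdCN.const_mul (conj p * u)).re
  have i2 := integrable_normSq_stdCN.const_mul (‖u‖ ^ 2)
  have i3 : Integrable (fun z : ℂ => 2 * (conj p * u * z).re + ‖u‖ ^ 2 * ‖z‖ ^ 2) stdCN :=
    (i1.const_mul 2).add i2
  rw [integral_add (integrable_const _) i3, integral_add (i1.const_mul 2) i2, integral_const_mul, integral_const_mul,
    integral_normSq_stdCN]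
  have h3 : ∫ z, (conj p * u * z).re ∂stdCN = 0 := by
    have := Complex.reCLM.integral_comp_comm (integrable_id_stdCN.const_mul (conj p * u))
    simp only [Complex.reCLM_apply] at this
    rw [this, integral_const_mul, integral_id_stdCN]; simp
  rw [h3]; simp

lemma measurePreserving_eval_iidCN {n : ℕ} (j : Fin n) :
    MeasurePreserving (fun w : Fin n → ℂ => w j) (iidCN n) stdCN :=
  measurePreserving_eval _ j

lemma integrable_nsq_affine {n : ℕ} (p : Fin n → ℂ) (u : ℂ) :
    Integrable (fun w => nsq (p + u • w)) (iidCN n) := by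
  unfold nsq
  refine integrable_finsetSum _ fun j _ => ?_
  exact (measurePreserving_eval_iidCN j).integrable_comp_of_integrable
    (integrable_norm_affine_stdCN (p j) u)

lemma integral_nsq_affine {n : ℕ} (p : Fin n → ℂ) (u : ℂ) :
    ∫ w, nsq (p + u • w) ∂iidCN n = nsq p + n * ‖u‖ ^ 2 := by
  have hj : ∀ j, Integrable (fun w : Fin n → ℂ => ‖(p + u • w) j‖ ^ 2) (iidCN n) := fun j =>
    (measurePreserving_eval_iidCN j).integrable_comp_of_integrable
      (integrable_norm_affine_stdCN (p j) u)
  simp only [nsq]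
  rw [integral_finsetSum _ fun j _ => hj j]
  have h : ∀ j, ∫ w : Fin n → ℂ, ‖(p + u • w) j‖ ^ 2 ∂iidCN n = ‖p j‖ ^ 2 + ‖u‖ ^ 2 := by
    intro j
    rw [← integral_norm_affine_stdCN, ← (measurePreserving_eval_iidCN j).map_eq,
      integral_map (measurable_pi_apply j).aemeasurable (by fun_prop)]
    rfl
  simp_rw [h]
  rw [Finset.sum_add_distrib]; simp

lemma integrable_nsq {n : ℕ} : Integrable (fun w => nsq w) (iidCN n) := by
  simpa using integrable_nsq_affine (0 : Fin n → ℂ) 1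

/-! ### Characteristic functions of Gaussian vectors and sums of independent noises. -/

lemma charFunDual_iidCN {n : ℕ} (L : (Fin n → ℂ) →L[ℝ] ℝ) :
    charFunDual (iidCN n) L =
      Complex.exp (-((∑ j, dualSq (L.comp (.single ℝ (fun _ => ℂ) j)) : ℝ) : ℂ) / 4) := by
  rw [iidCN, charFunDual_pi]
  simp_rw [charFunDual_stdCN]
  rw [← Complex.exp_sum]
  congr 1
  push_cast
  rw [← Finset.sum_div, Finset.sum_neg_distrib]

lemma dualSq_comp_smul_single {n : ℕ} (L : (Fin n → ℂ) →L[ℝ] ℝ)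
    (f : (Fin n → ℂ) →L[ℝ] (Fin n → ℂ)) (u : ℂ) (hf : ∀ w, f w = u • w) (j : Fin n) :
    dualSq ((L.comp f).comp (.single ℝ (fun _ => ℂ) j)) =
      ‖u‖ ^ 2 * dualSq (L.comp (.single ℝ (fun _ => ℂ) j)) := by
  rw [← dualSq_comp_mul _ (u • ContinuousLinearMap.id ℝ ℂ) u (fun z => by simp)]
  congr 1
  ext z
  simp only [ContinuousLinearMap.comp_apply, hf]
  congr 1
  ext i
  by_cases h : i = j
  · subst h; simp
  · simp [h]

lemma charFunDual_map_smul_iidCN {n : ℕ} (f : (Fin n → ℂ) →L[ℝ] (Fin n → ℂ)) (u : ℂ)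
    (hf : ∀ w, f w = u • w) (L : (Fin n → ℂ) →L[ℝ] ℝ) :
    charFunDual (iidCN n) (L.comp f) = Complex.exp
      (-((‖u‖ ^ 2 * ∑ j, dualSq (L.comp (.single ℝ (fun _ => ℂ) j)) : ℝ) : ℂ) / 4) := by
  rw [charFunDual_iidCN]
  simp_rw [dualSq_comp_smul_single L f u hf]
  rw [Finset.mul_sum]

/-- The space `ℂⁿ`. -/
abbrev CVec (n : ℕ) : Type := Fin n → ℂ

instance instSFiniteIidCN (n : ℕ) : SFinite (iidCN n) :=
  @instSFiniteOfSigmaFinite _ _ _ (IsFiniteMeasure.toSigmaFinite _)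

instance instIsProbabilityMeasureIidCNProd (n : ℕ) :
    IsProbabilityMeasure ((iidCN n).prod (iidCN n)) :=
  Measure.prod.instIsProbabilityMeasure _ _

instance instSFiniteIidCNProd (n : ℕ) : SFinite ((iidCN n).prod (iidCN n)) :=
  @instSFiniteOfSigmaFinite _ _ _ (IsFiniteMeasure.toSigmaFinite _)

instance instBorelSpaceCVec (n : ℕ) : BorelSpace (CVec n) := Pi.borelSpace

instance instBorelSpaceCVecProd (n : ℕ) : BorelSpace (CVec n × CVec n) := Prod.borelSpace

instance instBorelSpaceCVecProdProd (n : ℕ) : BorelSpace (CVec n × CVec n × CVec n) :=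
  Prod.borelSpace

instance instOpensMeasurableSpaceCVec3 (n : ℕ) :
    OpensMeasurableSpace (CVec n × CVec n × CVec n) := BorelSpace.opensMeasurable

/-- Circular symmetry: the characteristic function sees a coefficient only through its squared norm.
All linear combinations of the three noise vectors are thereby reduced to a single scaled noise. -/
lemma map_sum_smul_iidCN {n : ℕ} (u₁ u₂ u₃ : ℂ) :
    ((iidCN n).prod ((iidCN n).prod (iidCN n))).map
        (fun w => u₁ • w.1 + u₂ • w.2.1 + u₃ • w.2.2) =
      (iidCN n).map (fun w => (√(‖u₁‖ ^ 2 + ‖u₂‖ ^ 2 + ‖u₃‖ ^ 2) : ℝ) • w) := by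
  let S : ℂ → (CVec n) →L[ℝ] (CVec n) := fun u => u • ContinuousLinearMap.id ℝ (CVec n)
  have hS : ∀ u w, S u w = u • w := fun u w => by simp [S]
  let f : ((CVec n) × (CVec n) × (CVec n)) →L[ℝ] (CVec n) :=
    (S u₁).comp (.fst ℝ (CVec n) ((CVec n) × (CVec n))) + (S u₂).comp ((ContinuousLinearMap.fst ℝ (CVec n) (CVec n)).comp
      (.snd ℝ (CVec n) ((CVec n) × (CVec n)))) + (S u₃).comp ((ContinuousLinearMap.snd ℝ (CVec n) (CVec n)).comp (.snd ℝ (CVec n) ((CVec n) × (CVec n))))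
  have hf : (fun w : (CVec n) × (CVec n) × (CVec n) => u₁ • w.1 + u₂ • w.2.1 + u₃ • w.2.2) = f := by
    ext w; simp [f, S]
  set r : ℝ := √(‖u₁‖ ^ 2 + ‖u₂‖ ^ 2 + ‖u₃‖ ^ 2)
  have hr : ‖(r : ℂ)‖ ^ 2 = ‖u₁‖ ^ 2 + ‖u₂‖ ^ 2 + ‖u₃‖ ^ 2 := by
    rw [Complex.norm_real, Real.norm_eq_abs, sq_abs, Real.sq_sqrt (by positivity)]
  have hg : (fun w : (CVec n) => r • w) = S r := by
    ext w; simp [S]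
  rw [hf, hg]
  refine Measure.ext_of_charFunDual (funext fun L => ?_)
  rw [charFunDual_map f L, charFunDual_map (S r) L, charFunDual_prod, charFunDual_prod,
    charFunDual_map_smul_iidCN (S r) r (hS r)]
  have e1 : (L.comp f).comp (.inl ℝ (CVec n) ((CVec n) × (CVec n))) = L.comp (S u₁) := by
    ext w; simp [f]
  have e2 : ((L.comp f).comp (.inr ℝ (CVec n) ((CVec n) × (CVec n)))).comp (.inl ℝ (CVec n) (CVec n)) = L.comp (S u₂) := by
    ext w; simp [f]
  have e3 : ((L.comp f).comp (.inr ℝ (CVec n) ((CVec n) × (CVec n)))).comp (.inr ℝ (CVec n) (CVec n)) = L.comp (S u₃) := by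
    ext w; simp [f]
  rw [e1, e2, e3, charFunDual_map_smul_iidCN _ u₁ (hS _), charFunDual_map_smul_iidCN _ u₂ (hS _),
    charFunDual_map_smul_iidCN _ u₃ (hS _), ← Complex.exp_add, ← Complex.exp_add, hr]
  congr 1
  push_cast
  ring

/-! ### Scalar linear forms -/

/-- The linear form `∑ aᵢ ωᵢ`. -/
def lin {k : ℕ} (a : Fin k → ℂ) (ω : Fin k → ℂ) : ℂ := ∑ i, a i * ω i

@[fun_prop]
lemma measurable_lin {k : ℕ} (a : Fin k → ℂ) : Measurable (lin a) := by unfold lin; fun_prop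

/-- `lin a` as a continuous real-linear map. -/
def linCLM {k : ℕ} (a : Fin k → ℂ) : (Fin k → ℂ) →L[ℝ] ℂ :=
  ∑ i, (a i • ContinuousLinearMap.id ℝ ℂ).comp (.proj i)

lemma linCLM_apply {k : ℕ} (a ω : Fin k → ℂ) : linCLM a ω = lin a ω := by
  simp [linCLM, lin]

lemma dualSq_linCLM_single {k : ℕ} (a : Fin k → ℂ) (l : ℂ →L[ℝ] ℝ) (j : Fin k) :
    dualSq ((l.comp (linCLM a)).comp (.single ℝ (fun _ => ℂ) j)) = ‖a j‖ ^ 2 * dualSq l := by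
  rw [← dualSq_comp_mul l ((linCLM a).comp (.single ℝ (fun _ => ℂ) j)) (a j)]
  · rfl
  · intro z
    simp [linCLM_apply, lin, Pi.single_apply]

lemma map_lin {k : ℕ} (a : Fin k → ℂ) :
    (iidCN k).map (lin a) = stdCN.map (fun z => (√(∑ i, ‖a i‖ ^ 2) : ℝ) • z) := by
  set r : ℝ := √(∑ i, ‖a i‖ ^ 2)
  have hr : r ^ 2 = ∑ i, ‖a i‖ ^ 2 := Real.sq_sqrt (Finset.sum_nonneg fun _ _ => by positivity)
  have h1 : lin a = linCLM a := by ext; rw [linCLM_apply]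
  have h2 : (fun z : ℂ => r • z) = (r • ContinuousLinearMap.id ℝ ℂ : ℂ →L[ℝ] ℂ) := by ext; simp
  rw [h1, h2]
  refine Measure.ext_of_charFunDual (funext fun l => ?_)
  rw [charFunDual_map, charFunDual_map, charFunDual_iidCN, charFunDual_stdCN,
    dualSq_comp_mul _ _ (r : ℂ) (fun z => by simp)]
  simp_rw [dualSq_linCLM_single]
  rw [← Finset.sum_mul, ← hr, Complex.norm_real, Real.norm_eq_abs, sq_abs]

/-- The cross term in the exponent of the joint characteristic function is a real combination of the
real and imaginary parts of ∑ aᵢ conj bᵢ. Circular symmetry is what makes this one complex condition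
enough for independence. -/
lemma indepFun_lin {k : ℕ} (a b : Fin k → ℂ) (h : ∑ i, a i * conj (b i) = 0) :
    IndepFun (lin a) (lin b) (iidCN k) := by
  rw [indepFun_iff_charFunDual_prod (by fun_prop) (by fun_prop)]
  intro L
  have h1 : ∀ c : Fin k → ℂ, lin c = linCLM c := fun c => by ext; rw [linCLM_apply]
  have h2 : (fun ω => (lin a ω, lin b ω)) = (linCLM a).prod (linCLM b) := by
    ext ω <;> simp [linCLM_apply]
  rw [h2, h1 a, h1 b, charFunDual_map, charFunDual_map, charFunDual_map, charFunDual_iidCN,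
    charFunDual_iidCN, charFunDual_iidCN, ← Complex.exp_add]
  congr 1
  rw [← add_div]
  congr 1
  norm_cast
  rw [← neg_add]
  congr 1
  set l := L.comp (.inl ℝ ℂ ℂ)
  set m := L.comp (.inr ℝ ℂ ℂ)
  simp_rw [dualSq_linCLM_single]
  have h3 : ∀ x : ℂ × ℂ, L x = l x.1 + m x.2 := by
    intro x; simp [l, m, ← map_add]
  have h4 : ∀ j, dualSq ((L.comp ((linCLM a).prod (linCLM b))).comp (.single ℝ (fun _ => ℂ) j))
      = ‖a j‖ ^ 2 * dualSq l + ‖b j‖ ^ 2 * dualSq m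
        + 2 * ((l 1 * m 1 + l Complex.I * m Complex.I) * (a j * conj (b j)).re
          + (l 1 * m Complex.I - l Complex.I * m 1) * -(a j * conj (b j)).im) := by
    intro j
    have e : ∀ c : Fin k → ℂ, ∀ z, lin c (Pi.single j z) = c j * z := by
      intro c z; simp [lin, Pi.single_apply]
    simp only [dualSq, ContinuousLinearMap.comp_apply, ContinuousLinearMap.single_apply,
      ContinuousLinearMap.prod_apply, h3, linCLM_apply, e]
    rw [dual_apply_eq l (a j * 1), dual_apply_eq l (a j * Complex.I),
      dual_apply_eq m (b j * 1), dual_apply_eq m (b j * Complex.I),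
      ← Complex.normSq_eq_norm_sq, ← Complex.normSq_eq_norm_sq, Complex.normSq_apply,
      Complex.normSq_apply]
    simp
    ring
  simp_rw [h4]
  have h5 : ∑ i, (a i * conj (b i)).re = 0 := by rw [← Complex.re_sum, h]; rfl
  have h6 : ∑ i, (a i * conj (b i)).im = 0 := by rw [← Complex.im_sum, h]; rfl
  rw [Finset.sum_add_distrib, Finset.sum_add_distrib, ← Finset.mul_sum, Finset.sum_add_distrib,
    ← Finset.mul_sum, ← Finset.mul_sum, Finset.sum_neg_distrib, h5, h6]
  simp

/-! ### Entropies of complex Gaussians -/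

/-- The density of `CN(0, v)` on `ℂ`. -/
def cDens (v : ℝ) (z : ℂ) : ℝ := (Real.pi * v)⁻¹ * Real.exp (-‖z‖ ^ 2 / v)

@[fun_prop]
lemma measurable_cDens (v : ℝ) : Measurable (cDens v) := by unfold cDens; fun_prop

lemma cDens_pos {v : ℝ} (hv : 0 < v) (z : ℂ) : 0 < cDens v z := by unfold cDens; positivity

lemma map_affine_stdCN {v : ℝ} (hv : 0 < v) (c : ℂ) :
    stdCN.map (fun w => c + (√v : ℝ) • w) =
      volume.withDensity fun z => ENNReal.ofReal (cDens v (z - c)) := by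
  have hs : √v ≠ 0 := (Real.sqrt_pos.2 hv).ne'
  refine Measure.ext_of_lintegral _ fun F hF => ?_
  rw [lintegral_map hF (by fun_prop), lintegral_withDensity_eq_lintegral_mul _ (by fun_prop) hF]
  have h1 : ∫⁻ z, ((fun z => ENNReal.ofReal (cDens v (z - c))) * F) z
      = ∫⁻ z, ENNReal.ofReal (cDens v z) * F (c + z) := by
    rw [← lintegral_add_left_eq_self _ c]
    simp
  have h2 := Measure.map_addHaar_smul (volume : Measure ℂ) hs
  have h3 : ENNReal.ofReal |(√v ^ Module.finrank ℝ ℂ)⁻¹| = ENNReal.ofReal v⁻¹ := by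
    rw [Complex.finrank_real_complex, Real.sq_sqrt hv.le, abs_of_pos (by positivity)]
  have h4 : ENNReal.ofReal v⁻¹ ≠ 0 := by simp [hv]
  have h5 : ENNReal.ofReal v⁻¹ * ∫⁻ z, ENNReal.ofReal (cDens v z) * F (c + z)
      = ∫⁻ w, ENNReal.ofReal (cDens v ((√v : ℝ) • w)) * F (c + (√v : ℝ) • w) := by
    rw [← h3, ← smul_eq_mul, ← lintegral_smul_measure, ← h2,
      lintegral_map (by fun_prop) (by fun_prop)]
  have h6 : ∀ w : ℂ, ENNReal.ofReal (cDens v ((√v : ℝ) • w)) * F (c + (√v : ℝ) • w)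
      = ENNReal.ofReal v⁻¹ *
        (ENNReal.ofReal (Real.pi⁻¹ * Real.exp (-‖w‖ ^ 2)) * F (c + (√v : ℝ) • w)) := by
    intro w
    rw [← mul_assoc, ← ENNReal.ofReal_mul (by positivity)]
    congr 2
    have : -(v * ‖w‖ ^ 2) / v = -‖w‖ ^ 2 := by field_simp
    simp only [cDens, norm_smul, Real.norm_eq_abs, mul_pow, sq_abs, Real.sq_sqrt hv.le, this]
    rw [mul_inv]; ring
  simp_rw [h6] at h5
  rw [lintegral_const_mul _ (by fun_prop)] at h5
  rw [h1, (ENNReal.mul_right_inj h4 ENNReal.ofReal_ne_top).1 h5, stdCN_eq_withDensity,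
    lintegral_withDensity_eq_lintegral_mul _ (by fun_prop) (by fun_prop)]
  rfl

/-- Minus the logarithm of the density at c + √v w is log(πv) + ‖w‖², and ‖w‖² has mean 1; this is
the factor e. -/
lemma diffEntropy_affine_stdCN {v : ℝ} (hv : 0 < v) (c : ℂ) :
    diffEntropy (stdCN.map (fun w => c + (√v : ℝ) • w)) =
      Real.logb 2 (Real.pi * Real.exp 1 * v) := by
  have hae : ∀ᵐ z, ((stdCN.map (fun w => c + (√v : ℝ) • w)).rnDeriv volume z).toReal
      = cDens v (z - c) := by
    rw [map_affine_stdCN hv c]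
    filter_upwards [Measure.rnDeriv_withDensity volume
      (f := fun z => ENNReal.ofReal (cDens v (z - c))) (by fun_prop)] with z hz
    rw [hz, ENNReal.toReal_ofReal (cDens_pos hv _).le]
  unfold diffEntropy
  have h1 : ∫ z, ((stdCN.map (fun w => c + (√v : ℝ) • w)).rnDeriv volume z).toReal *
        Real.logb 2 ((stdCN.map (fun w => c + (√v : ℝ) • w)).rnDeriv volume z).toReal
      = ∫ z, cDens v (z - c) * Real.logb 2 (cDens v (z - c)) := by
    refine integral_congr_ae ?_
    filter_upwards [hae] with z hz
    rw [hz]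
  have h2 : ∫ z, cDens v (z - c) * Real.logb 2 (cDens v (z - c))
      = ∫ z, Real.logb 2 (cDens v (z - c)) ∂(stdCN.map (fun w => c + (√v : ℝ) • w)) := by
    rw [map_affine_stdCN hv c, integral_withDensity_eq_integral_toReal_smul (by fun_prop)
      (ae_of_all _ fun _ => ENNReal.ofReal_lt_top)]
    refine integral_congr_ae (ae_of_all _ fun z => ?_)
    simp only [smul_eq_mul]
    rw [ENNReal.toReal_ofReal (cDens_pos hv _).le]
  have h3 : ∀ w : ℂ, Real.logb 2 (cDens v (c + (√v : ℝ) • w - c))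
      = -(Real.log (Real.pi * v) / Real.log 2) - (Real.log 2)⁻¹ * ‖w‖ ^ 2 := by
    intro w
    have : -(v * ‖w‖ ^ 2) / v = -‖w‖ ^ 2 := by field_simp
    simp only [add_sub_cancel_left, cDens, norm_smul, Real.norm_eq_abs, mul_pow, sq_abs,
      Real.sq_sqrt hv.le, this, Real.logb]
    rw [Real.log_mul (by positivity) (by positivity), Real.log_inv, Real.log_exp]
    ring
  have hm : Measurable fun z => Real.logb 2 (cDens v (z - c)) := by
    unfold Real.logb; fun_prop
  rw [h1, h2, integral_map (by fun_prop) hm.aestronglyMeasurable]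
  simp_rw [h3]
  rw [integral_sub (integrable_const _) (integrable_normSq_stdCN.const_mul _), integral_const_mul,
    integral_normSq_stdCN, integral_const]
  simp only [probReal_univ, Real.logb]
  rw [show Real.pi * Real.exp 1 * v = (Real.pi * v) * Real.exp 1 by ring,
    Real.log_mul (x := Real.pi * v) (by positivity) (by positivity), Real.log_exp]
  have : Real.log 2 ≠ 0 := (Real.log_pos (by norm_num)).ne'
  rw [one_smul]
  field_simp
  ring

/-- `∑ |aᵢ|²`. -/
def lsq {k : ℕ} (a : Fin k → ℂ) : ℝ := ∑ i, ‖a i‖ ^ 2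

lemma entropyOf_lin {k : ℕ} (a : Fin k → ℂ) (ha : 0 < lsq a) :
    entropyOf (iidCN k) (lin a) = Real.logb 2 (Real.pi * Real.exp 1 * lsq a) := by
  rw [entropyOf, map_lin, ← diffEntropy_affine_stdCN ha 0]
  simp [lsq]

lemma integrable_lin {k : ℕ} (a : Fin k → ℂ) : Integrable (lin a) (iidCN k) := by
  unfold lin
  refine integrable_finsetSum _ fun i _ => ?_
  exact ((measurePreserving_eval_iidCN i).integrable_comp_of_integrable
      integrable_id_stdCN).const_mul (a i)

lemma integral_lin {k : ℕ} (a : Fin k → ℂ) : ∫ ω, lin a ω ∂iidCN k = 0 := by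
  have h : ∫ z, z ∂((iidCN k).map (lin a)) = ∫ ω, lin a ω ∂iidCN k :=
    integral_map (measurable_lin a).aemeasurable (by fun_prop)
  rw [← h, map_lin, integral_map (by fun_prop) (by fun_prop), integral_smul, integral_id_stdCN,
    smul_zero]

lemma integral_norm_sq_lin {k : ℕ} (a : Fin k → ℂ) : ∫ ω, ‖lin a ω‖ ^ 2 ∂iidCN k = lsq a := by
  have h : ∫ z, ‖z‖ ^ 2 ∂((iidCN k).map (lin a)) = ∫ ω, ‖lin a ω‖ ^ 2 ∂iidCN k :=
    integral_map (measurable_lin a).aemeasurable (by fun_prop)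
  rw [← h, map_lin, integral_map (by fun_prop) (by fun_prop)]
  simp only [norm_smul, mul_pow, Real.norm_eq_abs, sq_abs]
  rw [integral_const_mul, integral_normSq_stdCN, Real.sq_sqrt, lsq, mul_one]
  exact Finset.sum_nonneg fun _ _ => by positivity

/-! ### Variance, linear regression and conditional entropy of linear forms. -/

lemma cVar_lin {k : ℕ} (a : Fin k → ℂ) : cVar (iidCN k) (lin a) = lsq a := by
  unfold cVar
  rw [integral_lin]
  simp [integral_norm_sq_lin]

/-- `∑ aᵢ conj bᵢ`. -/
def cdot {k : ℕ} (a b : Fin k → ℂ) : ℂ := ∑ i, a i * conj (b i)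

/-- The residual of the linear regression of `lin a` on `lin b`. -/
def resid {k : ℕ} (a b : Fin k → ℂ) : Fin k → ℂ := fun i => a i - cdot a b / lsq b * b i

lemma cdot_self {k : ℕ} (a : Fin k → ℂ) : cdot a a = lsq a := by
  simp [cdot, lsq, Complex.mul_conj, Complex.normSq_eq_norm_sq]

lemma cdot_resid {k : ℕ} (a b : Fin k → ℂ) (hb : 0 < lsq b) : cdot (resid a b) b = 0 := by
  have hb' : (lsq b : ℂ) ≠ 0 := by exact_mod_cast hb.ne'
  have h : cdot (resid a b) b = cdot a b - cdot a b / lsq b * cdot b b := by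
    simp only [cdot, resid, sub_mul, Finset.sum_sub_distrib, Finset.mul_sum]
    simp only [mul_assoc]
  rw [h, cdot_self, div_mul_cancel₀ _ hb', sub_self]

/-- Pythagoras: the residual is orthogonal to b. -/
lemma lsq_resid {k : ℕ} (a b : Fin k → ℂ) (hb : 0 < lsq b) :
    lsq (resid a b) = lsq a - ‖cdot a b‖ ^ 2 / lsq b := by
  have hb' : (lsq b : ℂ) ≠ 0 := by exact_mod_cast hb.ne'
  have h0 := cdot_resid a b hb
  have h1 : cdot (resid a b) (resid a b) = cdot (resid a b) a
      - conj (cdot a b / lsq b) * cdot (resid a b) b := by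
    simp only [cdot, Finset.mul_sum, ← Finset.sum_sub_distrib]
    refine Finset.sum_congr rfl fun i _ => ?_
    have : conj (resid a b i) = conj (a i) - conj (cdot a b / lsq b) * conj (b i) := by
      simp [resid]
    rw [this]; simp only [cdot]; ring
  have h2 : cdot (resid a b) a = lsq a - cdot a b / lsq b * cdot b a := by
    rw [← cdot_self a]
    simp only [cdot, resid, sub_mul, Finset.sum_sub_distrib, Finset.mul_sum]
    simp only [mul_assoc]
  have h3 : cdot b a = conj (cdot a b) := by
    simp [cdot, mul_comm]
  rw [h0, mul_zero, sub_zero, h2, h3, cdot_self] at h1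
  have h4 : ((lsq (resid a b) : ℝ) : ℂ) = ((lsq a - ‖cdot a b‖ ^ 2 / lsq b : ℝ) : ℂ) := by
    rw [h1, div_mul_eq_mul_div, Complex.mul_conj, Complex.normSq_eq_norm_sq]
    push_cast; ring
  exact_mod_cast h4

lemma lin_eq_resid {k : ℕ} (a b ω : Fin k → ℂ) :
    lin a ω = cdot a b / lsq b * lin b ω + lin (resid a b) ω := by
  simp only [lin, resid, Finset.mul_sum, ← Finset.sum_add_distrib]
  exact Finset.sum_congr rfl fun i _ => by ring

/-- The residual is independent of `lin b`, so the conditional law given y is a Gaussian of variance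
`lsq (resid a b)` translated by a multiple of y. Entropy is translation invariant, so the integrand
is constant. -/
lemma condEntropyOf_lin {k : ℕ} (a b : Fin k → ℂ) (hb : 0 < lsq b) (hr : 0 < lsq (resid a b)) :
    condEntropyOf (iidCN k) (lin a) (lin b) =
      Real.logb 2 (Real.pi * Real.exp 1 * lsq (resid a b)) := by
  set c := cdot a b / lsq b
  set r := resid a b
  have hprob : IsProbabilityMeasure ((iidCN k).map (lin r)) :=
    Measure.isProbabilityMeasure_map (measurable_lin r).aemeasurable
  let κ : Kernel ℂ ℂ :=
    (Kernel.id ×ₖ Kernel.const ℂ ((iidCN k).map (lin r))).map (fun p => c * p.1 + p.2)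
  have hκ : ∀ y, κ y = ((iidCN k).map (lin r)).map (fun z => c * y + z) := by
    intro y
    simp only [κ]
    rw [Kernel.map_apply _ (by fun_prop), Kernel.prod_apply, Kernel.id_apply, Kernel.const_apply,
      Measure.dirac_prod, Measure.map_map (by fun_prop) (by fun_prop)]
    rfl
  have hκe : ∀ y, diffEntropy (κ y) = Real.logb 2 (Real.pi * Real.exp 1 * lsq r) := by
    intro y
    rw [hκ, map_lin, Measure.map_map (by fun_prop) (by fun_prop),
      ← diffEntropy_affine_stdCN hr (c * y)]
    rfl
  have hind := (indepFun_iff_map_prod_eq_prod_map_map (measurable_lin b).aemeasurable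
    (measurable_lin r).aemeasurable).1 (indepFun_lin r b (cdot_resid a b hb)).symm
  have heq : (iidCN k).map (fun ω => (lin b ω, lin a ω)) = (iidCN k).map (lin b) ⊗ₘ κ := by
    refine Measure.ext_of_lintegral _ fun f hf => ?_
    rw [Measure.lintegral_compProd hf, lintegral_map hf (by fun_prop)]
    have h1 : ∫⁻ ω, f (lin b ω, lin a ω) ∂iidCN k = ∫⁻ p, f (p.1, c * p.1 + p.2)
        ∂((iidCN k).map (fun ω => (lin b ω, lin r ω))) := by
      rw [lintegral_map (by fun_prop) (by fun_prop)]
      exact lintegral_congr fun ω => by rw [lin_eq_resid a b]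
    rw [h1, hind, lintegral_prod _ (by fun_prop)]
    refine lintegral_congr fun y => ?_
    rw [hκ, lintegral_map (f := fun x => f (y, x)) (by fun_prop) (by fun_prop)]
  have hae := condDistrib_ae_eq_of_measure_eq_compProd (lin b) (measurable_lin a).aemeasurable heq
  have hprob' : IsProbabilityMeasure ((iidCN k).map (lin b)) :=
    Measure.isProbabilityMeasure_map (measurable_lin b).aemeasurable
  unfold condEntropyOf
  rw [integral_congr_ae (g := fun _ => Real.logb 2 (Real.pi * Real.exp 1 * lsq r))]
  · simp
  · filter_upwards [hae] with y hy
    rw [hy, hκe]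

/-- Independence of residual and `lin b` makes the conditional expectation equal to the linear
regression. -/
lemma cCondVar_lin {k : ℕ} (a b : Fin k → ℂ) (hb : 0 < lsq b) :
    cCondVar (iidCN k) (lin a) (lin b) = lsq (resid a b) := by
  set c := cdot a b / lsq b
  set r := resid a b with hr
  have hle : MeasurableSpace.comap (lin b) inferInstance ≤ (MeasurableSpace.pi : MeasurableSpace (Fin k → ℂ)) :=
    (measurable_lin b).comap_le
  have hind : Indep (MeasurableSpace.comap (lin r) inferInstance)
      (MeasurableSpace.comap (lin b) inferInstance) (iidCN k) :=
    (indepFun_lin r b (cdot_resid a b hb))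
  have h1 : (iidCN k)[lin r | MeasurableSpace.comap (lin b) inferInstance] =ᵐ[iidCN k]
      fun _ => ∫ ω, lin r ω ∂iidCN k :=
    condExp_indep_eq (measurable_lin r).comap_le hle
      (comap_measurable (lin r)).stronglyMeasurable hind
  have h2 : (iidCN k)[fun ω => c * lin b ω | MeasurableSpace.comap (lin b) inferInstance]
      = fun ω => c * lin b ω := by
    refine condExp_of_stronglyMeasurable hle ?_ ((integrable_lin b).const_mul c)
    exact ((comap_measurable (lin b)).const_mul c).stronglyMeasurable
  have h3 : lin a = (fun ω => c * lin b ω) + lin r := by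
    ext ω; exact lin_eq_resid a b ω
  have h4 := condExp_add ((integrable_lin b).const_mul c) (integrable_lin r)
    (MeasurableSpace.comap (lin b) inferInstance)
  rw [← h3, h2] at h4
  unfold cCondVar
  rw [← integral_norm_sq_lin]
  refine integral_congr_ae ?_
  filter_upwards [h4, h1] with ω e4 e1
  rw [e4, Pi.add_apply, e1, integral_lin, h3]
  simp

/-! ### Closed forms of the Gaussian quantities -/

lemma lsq_pos {k : ℕ} (a : Fin k → ℂ) (i : Fin k) (h : a i ≠ 0) : 0 < lsq a :=
  lt_of_lt_of_le (by positivity : 0 < ‖a i‖ ^ 2)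
    (Finset.single_le_sum (f := fun i => ‖a i‖ ^ 2) (fun _ _ => by positivity) (Finset.mem_univ i))

lemma lsq_resid_pos {k : ℕ} (a b : Fin k → ℂ) (h : ∀ c : ℂ, ¬ ∀ i, a i = c * b i) :
    0 < lsq (resid a b) := by
  have h1 := h (cdot a b / lsq b)
  push Not at h1
  obtain ⟨i, hi⟩ := h1
  exact lsq_pos _ i (sub_ne_zero.2 hi)

lemma normSq_sqrt_cast {x : ℝ} (hx : 0 ≤ x) : ‖((√x : ℝ) : ℂ)‖ ^ 2 = x := by
  rw [Complex.norm_real, Real.norm_eq_abs, sq_abs, Real.sq_sqrt hx]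

lemma sqrt_cast_mul_self {x : ℝ} (hx : 0 ≤ x) : ((√x : ℝ) : ℂ) * ((√x : ℝ) : ℂ) = x := by
  rw [← Complex.ofReal_mul, Real.mul_self_sqrt hx]

lemma sqrt_cast_ne_zero {x : ℝ} (hx : 0 < x) : ((√x : ℝ) : ℂ) ≠ 0 :=
  Complex.ofReal_ne_zero.2 (Real.sqrt_pos.2 hx).ne'

namespace GIC

variable (G : GIC) (κ : GenieParams)

/-- Coefficients of `N₁`. -/
def cN₁ : Fin 9 → ℂ :=
  ![0, 0, κ.σN₁ * conj κ.ρN₁, κ.σN₁ * (√(1 - ‖κ.ρN₁‖ ^ 2) : ℝ), 0, 0, 0, 0, 0]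

/-- Coefficients of `W₂`. -/
def cW₂ : Fin 9 → ℂ :=
  ![0, 0, 0, 0, κ.σW₂ * conj κ.ρW₂, κ.σW₂ * (√(1 - ‖κ.ρW₂‖ ^ 2) : ℝ), 0, 0, 0]

/-- Coefficients of `Z₁`. -/
def cZ₁ : Fin 9 → ℂ := ![0, 0, 1, 0, 0, 0, 0, 0, 0]

/-- Coefficients of `Z₂ - W₂`. -/
def cD₂ : Fin 9 → ℂ :=
  ![0, 0, 0, 0, 1 - κ.σW₂ * conj κ.ρW₂, -(κ.σW₂ * (√(1 - ‖κ.ρW₂‖ ^ 2) : ℝ)), 0, 0, 0]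

/-- Coefficients of `X₂G`. -/
def cX₂ : Fin 9 → ℂ := ![0, (√G.P₂ : ℝ), 0, 0, 0, 0, 0, 0, 0]

/-- Coefficients of `Y₁G` plus `t` times the last variable. -/
def cY₁ (t : ℝ) : Fin 9 → ℂ :=
  ![(√G.P₁ : ℝ), G.h₁₂ * (√G.P₂ : ℝ), 1, 0, 0, 0, 0, 0, (√t : ℝ)]

/-- Coefficients of `Y₂G`. -/
def cY₂ : Fin 9 → ℂ := ![G.h₂₁ * (√G.P₁ : ℝ), (√G.P₂ : ℝ), 0, 0, 1, 0, 0, 0, 0]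

/-- Coefficients of `h₁₂ Y₂G` plus scaled `V_{N₁}`. -/
def cY₂' (t v : ℝ) : Fin 9 → ℂ :=
  ![G.h₁₂ * (G.h₂₁ * (√G.P₁ : ℝ)), G.h₁₂ * (√G.P₂ : ℝ), 0, 0, G.h₁₂, 0, 0, (√t : ℝ) * (√v : ℝ), 0]

/-- Coefficients of `S₁G`. -/
def cS₁ : Fin 9 → ℂ :=
  ![G.h₂₁ * (√G.P₁ : ℝ), 0, κ.σN₁ * conj κ.ρN₁, κ.σN₁ * (√(1 - ‖κ.ρN₁‖ ^ 2) : ℝ), 0, 0, 0, 0, 0]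

/-- Coefficients of `U₂G`. -/
def cU₂ : Fin 9 → ℂ :=
  ![G.h₂₁ * (√G.P₁ : ℝ), 0, 0, 0, κ.σW₂ * conj κ.ρW₂, κ.σW₂ * (√(1 - ‖κ.ρW₂‖ ^ 2) : ℝ), 0, 0, 0]

/-- Coefficients of `h₂₁ X₁G` plus scaled `V_{W₂}`. -/
def cX₁V (v : ℝ) : Fin 9 → ℂ := ![G.h₂₁ * (√G.P₁ : ℝ), 0, 0, 0, 0, 0, (√v : ℝ), 0, 0]

lemma N₁_eq : N₁ κ = lin (cN₁ κ) := by
  ext ω; simp [N₁, lin, cN₁, Fin.sum_univ_succ]; ring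

lemma W₂_eq : W₂ κ = lin (cW₂ κ) := by
  ext ω; simp [W₂, lin, cW₂, Fin.sum_univ_succ]; ring

lemma Z₁_eq : Z₁ = lin cZ₁ := by
  ext ω; simp [Z₁, lin, cZ₁, Fin.sum_univ_succ]

lemma D₂_eq : (fun ω => Z₂ ω - W₂ κ ω) = lin (cD₂ κ) := by
  ext ω; simp [Z₂, W₂, lin, cD₂, Fin.sum_univ_succ]; ring

lemma X₂G_eq : G.X₂G = lin G.cX₂ := by
  ext ω; simp [X₂G, lin, cX₂, Fin.sum_univ_succ]

lemma Y₁G_eq : G.Y₁G = lin (G.cY₁ 0) := by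
  ext ω; simp [Y₁G, X₁G, X₂G, Z₁, lin, cY₁, Fin.sum_univ_succ]; ring

lemma Y₁G_add_eq : (fun ω => G.Y₁G ω + G.tildeZ₁ κ ω) = lin (G.cY₁ (1 - G.varZ₁subN₁ κ)) := by
  ext ω; simp [Y₁G, X₁G, X₂G, Z₁, tildeZ₁, lin, cY₁, Fin.sum_univ_succ]; ring

lemma Y₂G_eq : G.Y₂G = lin G.cY₂ := by
  ext ω; simp [Y₂G, X₁G, X₂G, Z₂, lin, cY₂, Fin.sum_univ_succ]; ring

lemma Y₂G_add_eq : (fun ω => G.h₁₂ * G.Y₂G ω + G.tildeVN₁ κ ω) =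
    lin (G.cY₂' (1 - (varVN₁ κ)⁻¹ * ‖G.h₁₂‖ ^ 2 * varZ₂subW₂ κ) (varVN₁ κ)) := by
  ext ω; simp [Y₂G, X₁G, X₂G, Z₂, tildeVN₁, VN₁, lin, cY₂', Fin.sum_univ_succ]; ring

lemma S₁G_eq : G.S₁G κ = lin (G.cS₁ κ) := by
  ext ω; simp [S₁G, X₁G, N₁, lin, cS₁, Fin.sum_univ_succ]; ring

lemma U₂G_eq : G.U₂G κ = lin (G.cU₂ κ) := by
  ext ω; simp [U₂G, X₁G, W₂, lin, cU₂, Fin.sum_univ_succ]; ring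

lemma X₁V_eq : (fun ω => G.h₂₁ * G.X₁G ω + VW₂ κ ω) = lin (G.cX₁V (varVW₂ κ)) := by
  ext ω; simp [X₁G, VW₂, lin, cX₁V, Fin.sum_univ_succ]; ring

/-! ### Norms and inner products of the coefficient vectors. -/

variable {κ}

lemma one_sub_norm_sq_nonneg {ρ : ℂ} (h : ‖ρ‖ ≤ 1) : 0 ≤ 1 - ‖ρ‖ ^ 2 := by
  nlinarith [norm_nonneg ρ]

lemma lsq_cN₁ (h : ‖κ.ρN₁‖ ≤ 1) : lsq (cN₁ κ) = κ.σN₁ ^ 2 := by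
  have := normSq_sqrt_cast (one_sub_norm_sq_nonneg h)
  simp only [lsq, cN₁, Fin.sum_univ_succ]
  simp [mul_pow] at this ⊢
  rw [this]; ring

lemma lsq_cD₂ (h : ‖κ.ρW₂‖ ≤ 1) :
    lsq (cD₂ κ) = 1 + κ.σW₂ ^ 2 - 2 * (κ.ρW₂ * κ.σW₂).re := by
  have := normSq_sqrt_cast (one_sub_norm_sq_nonneg h)
  have h1 : ‖1 - (κ.σW₂ : ℂ) * conj κ.ρW₂‖ ^ 2
      = 1 - 2 * (κ.ρW₂ * κ.σW₂).re + κ.σW₂ ^ 2 * ‖κ.ρW₂‖ ^ 2 := by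
    simp only [← Complex.normSq_eq_norm_sq, Complex.normSq_apply]; simp; ring
  simp only [lsq, cD₂, Fin.sum_univ_succ]
  simp [mul_pow, h1] at this ⊢
  rw [this]; ring

lemma lsq_cS₁ (hP : 0 < G.P₁) (h : ‖κ.ρN₁‖ ≤ 1) :
    lsq (G.cS₁ κ) = ‖G.h₂₁‖ ^ 2 * G.P₁ + κ.σN₁ ^ 2 := by
  have := normSq_sqrt_cast (one_sub_norm_sq_nonneg h)
  have h2 := normSq_sqrt_cast hP.le
  simp only [lsq, cS₁, Fin.sum_univ_succ]
  simp [mul_pow] at this h2 ⊢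
  rw [this, h2]; ring

lemma lsq_cU₂ (hP : 0 < G.P₁) (h : ‖κ.ρW₂‖ ≤ 1) :
    lsq (G.cU₂ κ) = ‖G.h₂₁‖ ^ 2 * G.P₁ + κ.σW₂ ^ 2 := by
  have := normSq_sqrt_cast (one_sub_norm_sq_nonneg h)
  have h2 := normSq_sqrt_cast hP.le
  simp only [lsq, cU₂, Fin.sum_univ_succ]
  simp [mul_pow] at this h2 ⊢
  rw [this, h2]; ring

lemma lsq_cX₁V (hP : 0 < G.P₁) {v : ℝ} (hv : 0 ≤ v) :
    lsq (G.cX₁V v) = ‖G.h₂₁‖ ^ 2 * G.P₁ + v := by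
  have := normSq_sqrt_cast hv
  have h2 := normSq_sqrt_cast hP.le
  simp only [lsq, cX₁V, Fin.sum_univ_succ]
  simp [mul_pow] at this h2 ⊢
  rw [this, h2]

lemma lsq_cY₁ (hP₁ : 0 < G.P₁) (hP₂ : 0 < G.P₂) {t : ℝ} (ht : 0 ≤ t) :
    lsq (G.cY₁ t) = G.P₁ + ‖G.h₁₂‖ ^ 2 * G.P₂ + 1 + t := by
  have := normSq_sqrt_cast ht
  have h1 := normSq_sqrt_cast hP₁.le
  have h2 := normSq_sqrt_cast hP₂.le
  simp only [lsq, cY₁, Fin.sum_univ_succ]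
  simp [mul_pow] at this h1 h2 ⊢
  rw [this, h1, h2]; ring

lemma lsq_cY₂ (hP₁ : 0 < G.P₁) (hP₂ : 0 < G.P₂) :
    lsq G.cY₂ = G.P₂ + ‖G.h₂₁‖ ^ 2 * G.P₁ + 1 := by
  have h1 := normSq_sqrt_cast hP₁.le
  have h2 := normSq_sqrt_cast hP₂.le
  simp only [lsq, cY₂, Fin.sum_univ_succ]
  simp [mul_pow] at h1 h2 ⊢
  rw [h1, h2]; ring

lemma lsq_cY₂' (hP₁ : 0 < G.P₁) (hP₂ : 0 < G.P₂) {t v : ℝ} (ht : 0 ≤ t) (hv : 0 ≤ v) :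
    lsq (G.cY₂' t v) = ‖G.h₁₂‖ ^ 2 * (G.P₂ + ‖G.h₂₁‖ ^ 2 * G.P₁ + 1) + t * v := by
  have h1 := normSq_sqrt_cast hP₁.le
  have h2 := normSq_sqrt_cast hP₂.le
  have h3 := normSq_sqrt_cast ht
  have h4 := normSq_sqrt_cast hv
  simp only [lsq, cY₂', Fin.sum_univ_succ]
  simp [mul_pow] at h1 h2 h3 h4 ⊢
  rw [h1, h2, h3, h4]; ring

lemma lsq_cX₂ (hP₂ : 0 < G.P₂) : lsq G.cX₂ = G.P₂ := by
  have h2 := normSq_sqrt_cast hP₂.le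
  simp only [lsq, cX₂, Fin.sum_univ_succ]
  simp at h2 ⊢
  rw [h2]

lemma cdot_cY₁_cS₁ (hP₁ : 0 < G.P₁) (t : ℝ) :
    cdot (G.cY₁ t) (G.cS₁ κ) = conj G.h₂₁ * G.P₁ + κ.ρN₁ * κ.σN₁ := by
  have h1 := sqrt_cast_mul_self hP₁.le
  simp only [cdot, cY₁, cS₁, Fin.sum_univ_succ]
  simp
  linear_combination (conj G.h₂₁) * h1

lemma cdot_cY₂_cU₂ (hP₁ : 0 < G.P₁) :
    cdot G.cY₂ (G.cU₂ κ) = ((‖G.h₂₁‖ ^ 2 * G.P₁ : ℝ) : ℂ) + κ.ρW₂ * κ.σW₂ := by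
  have h1 := sqrt_cast_mul_self hP₁.le
  have h2 : G.h₂₁ * conj G.h₂₁ = ((‖G.h₂₁‖ ^ 2 : ℝ) : ℂ) := by
    rw [Complex.mul_conj, Complex.normSq_eq_norm_sq]
  simp only [cdot, cY₂, cU₂, Fin.sum_univ_succ]
  simp at h2 ⊢
  linear_combination (G.h₂₁ * conj G.h₂₁) * h1 + G.P₁ * h2

lemma cdot_cY₂'_cU₂ (hP₁ : 0 < G.P₁) (t v : ℝ) :
    cdot (G.cY₂' t v) (G.cU₂ κ) =
      G.h₁₂ * (((‖G.h₂₁‖ ^ 2 * G.P₁ : ℝ) : ℂ) + κ.ρW₂ * κ.σW₂) := by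
  rw [← cdot_cY₂_cU₂ G hP₁]
  simp only [cdot, cY₂', cY₂, cU₂, Fin.sum_univ_succ]
  simp
  ring

lemma cdot_cY₂_cX₂ (hP₂ : 0 < G.P₂) : cdot G.cY₂ G.cX₂ = G.P₂ := by
  have h1 := sqrt_cast_mul_self hP₂.le
  simp only [cdot, cY₂, cX₂, Fin.sum_univ_succ]
  simpa using h1

lemma varVN₁_eq (hσ : 0 < κ.σN₁) (h : ‖κ.ρN₁‖ ≤ 1) : varVN₁ κ = 1 - ‖κ.ρN₁‖ ^ 2 := by
  have h0 : 0 < lsq (cN₁ κ) := by rw [lsq_cN₁ h]; positivity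
  have h1 : cdot cZ₁ (cN₁ κ) = κ.σN₁ * κ.ρN₁ := by simp [cdot, cZ₁, cN₁, Fin.sum_univ_succ]
  have h2 : lsq cZ₁ = 1 := by simp [lsq, cZ₁, Fin.sum_univ_succ]
  rw [varVN₁, Z₁_eq, N₁_eq, cCondVar_lin _ _ h0, lsq_resid _ _ h0, h1, h2, lsq_cN₁ h]
  simp only [norm_mul, mul_pow, Complex.norm_real, Real.norm_eq_abs, sq_abs]
  field_simp

lemma varZ₂subW₂_eq (h : ‖κ.ρW₂‖ ≤ 1) :
    varZ₂subW₂ κ = 1 + κ.σW₂ ^ 2 - 2 * (κ.ρW₂ * κ.σW₂).re := by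
  rw [varZ₂subW₂, D₂_eq, cVar_lin, lsq_cD₂ h]

/-- The pairs (W₂, Z₂ - W₂) and (W₂, Z₂) differ by a shear and a sign, so their covariance
determinants agree and equal σ²(1 - |ρ|²). Dividing by the variance of Z₂ - W₂ gives the conditional
variance. -/
lemma varVW₂_eq (h : ‖κ.ρW₂‖ ≤ 1) (hpos : 0 < varZ₂subW₂ κ) :
    varVW₂ κ = κ.σW₂ ^ 2 * (1 - ‖κ.ρW₂‖ ^ 2) / varZ₂subW₂ κ := by
  have h0 : 0 < lsq (cD₂ κ) := by rwa [lsq_cD₂ h, ← varZ₂subW₂_eq h]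
  have hs := one_sub_norm_sq_nonneg h
  have hs1 := sqrt_cast_mul_self hs
  have hn := normSq_sqrt_cast hs
  have h1 : cdot (cW₂ κ) (cD₂ κ) = κ.σW₂ * conj κ.ρW₂ - (κ.σW₂ : ℂ) ^ 2 := by
    have h3 : conj κ.ρW₂ * κ.ρW₂ = ((‖κ.ρW₂‖ ^ 2 : ℝ) : ℂ) := by
      rw [mul_comm, Complex.mul_conj, Complex.normSq_eq_norm_sq]
    simp only [cdot, cW₂, cD₂, Fin.sum_univ_succ]
    simp at hs1 h3 ⊢
    linear_combination -(κ.σW₂ : ℂ) ^ 2 * h3 - (κ.σW₂ : ℂ) ^ 2 * hs1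
  have h2 : lsq (cW₂ κ) = κ.σW₂ ^ 2 := by
    simp only [lsq, cW₂, Fin.sum_univ_succ]
    simp [mul_pow] at hn ⊢
    rw [hn]; ring
  rw [varVW₂, D₂_eq, W₂_eq, cCondVar_lin _ _ h0, lsq_resid _ _ h0, h1, h2]
  have h4 : lsq (cD₂ κ) = varZ₂subW₂ κ := by rw [lsq_cD₂ h, varZ₂subW₂_eq h]
  rw [h4, eq_div_iff hpos.ne', sub_mul, div_mul_cancel₀ _ hpos.ne', varZ₂subW₂_eq h]
  simp only [← Complex.normSq_eq_norm_sq, Complex.normSq_apply]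
  simp [pow_two]
  ring

lemma varZ₁subN₁_eq (h : ‖κ.ρN₁‖ ≤ 1) :
    G.varZ₁subN₁ κ =
      1 + ‖G.h₂₁⁻¹‖ ^ 2 * κ.σN₁ ^ 2 - 2 * (conj G.h₂₁⁻¹ * κ.ρN₁ * κ.σN₁).re := by
  have key : ∀ g : ℂ, cVar (iidCN 9) (fun ω => Z₁ ω - g * N₁ κ ω) =
      1 + ‖g‖ ^ 2 * κ.σN₁ ^ 2 - 2 * (conj g * κ.ρN₁ * κ.σN₁).re := by
    intro g
    have hn := normSq_sqrt_cast (one_sub_norm_sq_nonneg h)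
    let c : Fin 9 → ℂ := ![0, 0, 1 - g * (κ.σN₁ * conj κ.ρN₁),
      -(g * (κ.σN₁ * (√(1 - ‖κ.ρN₁‖ ^ 2) : ℝ))), 0, 0, 0, 0, 0]
    have h1 : (fun ω => Z₁ ω - g * N₁ κ ω) = lin c := by
      ext ω; simp [Z₁, N₁, lin, c, Fin.sum_univ_succ]; ring
    have h2 : ‖1 - g * (κ.σN₁ * conj κ.ρN₁)‖ ^ 2
        = 1 - 2 * (conj g * κ.ρN₁ * κ.σN₁).re + ‖g‖ ^ 2 * (κ.σN₁ ^ 2 * ‖κ.ρN₁‖ ^ 2) := by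
      simp only [← Complex.normSq_eq_norm_sq, Complex.normSq_apply]; simp; ring
    rw [h1, cVar_lin]
    simp only [lsq, c, Fin.sum_univ_succ]
    simp [mul_pow, h2] at hn ⊢
    rw [hn]; ring
  exact key _

end GIC

lemma logb_entropy_sub {a b : ℝ} (ha : 0 < a) (hb : 0 < b) :
    Real.logb 2 (Real.pi * Real.exp 1 * a) - Real.logb 2 (Real.pi * Real.exp 1 * b) =
      Real.logb 2 (a / b) := by
  rw [Real.logb_mul (by positivity) ha.ne', Real.logb_mul (by positivity) hb.ne',
    Real.logb_div ha.ne' hb.ne']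
  ring

namespace GIC

variable (G : GIC) {κ : GenieParams}

lemma R₀_eq_R₀Log (hP₁ : 0 < G.P₁) (hP₂ : 0 < G.P₂) (hκ : κ.InRange) (had : G.Admissible κ) :
    G.R₀ κ = G.R₀Log κ := by
  obtain ⟨⟨hσN, -⟩, -, ⟨hσW, -⟩, hκ'⟩ := id hκ
  obtain ⟨-, -, -, ⟨-, -⟩, hρN, -, -, hρW⟩ := id hκ
  obtain ⟨-, -, -, hh, hVN, hσ, hβ⟩ := id had
  have hβ' := varZ₂subW₂_eq (κ := κ) hρW
  have hVW : 0 ≤ varVW₂ κ := by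
    rw [varVW₂_eq hρW hβ]
    have := one_sub_norm_sq_nonneg hρW
    positivity
  have hh' : 0 < ‖G.h₂₁‖ := norm_pos_iff.2 hh
  have e1 := G.lsq_cS₁ hP₁ hρN
  have e2 := G.lsq_cX₁V hP₁ hVW
  have e3 := G.lsq_cU₂ hP₁ hρW
  have e4 := G.lsq_cY₁ hP₁ hP₂ le_rfl
  have e5 := lsq_cN₁ (κ := κ) hρN
  have e6 := G.lsq_cY₂ hP₁ hP₂
  have e7 := lsq_cD₂ (κ := κ) hρW
  have e8 : lsq (resid G.cY₂ G.cX₂) = ‖G.h₂₁‖ ^ 2 * G.P₁ + 1 := by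
    have : 0 < lsq G.cX₂ := by rw [G.lsq_cX₂ hP₂]; exact hP₂
    rw [lsq_resid _ _ this, e6, G.cdot_cY₂_cX₂ hP₂, G.lsq_cX₂ hP₂, Complex.norm_real,
      Real.norm_eq_abs, sq_abs]
    field_simp
    ring
  have p1 : 0 < lsq (G.cS₁ κ) := by rw [e1]; positivity
  have p2 : 0 < lsq (G.cX₁V (varVW₂ κ)) := by rw [e2]; positivity
  have p3 : 0 < lsq (G.cU₂ κ) := by rw [e3]; positivity
  have p4 : 0 < lsq (G.cY₁ 0) := by rw [e4]; positivity
  have p5 : 0 < lsq (cN₁ κ) := by rw [e5]; positivity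
  have p6 : 0 < lsq G.cY₂ := by rw [e6]; positivity
  have p7 : 0 < lsq (cD₂ κ) := by rw [e7, ← hβ']; exact hβ
  have p8 : 0 < lsq (resid G.cY₂ G.cX₂) := by rw [e8]; positivity
  have p9 : 0 < lsq G.cX₂ := by rw [G.lsq_cX₂ hP₂]; exact hP₂
  rw [R₀, S₁G_eq, X₁V_eq, U₂G_eq, Y₂G_eq, X₂G_eq, Y₁G_eq, N₁_eq, D₂_eq, entropyOf_lin _ p1,
    entropyOf_lin _ p2, entropyOf_lin _ p3, entropyOf_lin _ p4, entropyOf_lin _ p5,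
    entropyOf_lin _ p6, entropyOf_lin _ p7, condEntropyOf_lin _ _ p9 p8]
  have s1 := logb_entropy_sub p1 p2
  have s2 := logb_entropy_sub p3 p8
  have s3 := logb_entropy_sub p4 p5
  have s4 := logb_entropy_sub p6 p7
  rw [e1, e2] at s1
  rw [e3, e8] at s2
  rw [e4, e5, add_zero] at s3
  rw [e6, e7] at s4
  rw [R₀Log, ← s1, ← s2, ← s3, ← s4, e1, e2, e3, e4, e5, e6, e7, e8, add_zero]
  ring

/-- The variance of `Y₁G + Z̃₁` given `S₁G`, in closed form. -/
lemma regression_var₁ {P D X v1 σ : ℝ} {h ρ : ℂ} (hh : h ≠ 0) (hD : D = ‖h‖ ^ 2 * P + σ ^ 2)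
    (hD0 : 0 < D)
    (hv1 : v1 = 1 + ‖h⁻¹‖ ^ 2 * σ ^ 2 - 2 * (conj h⁻¹ * ρ * σ).re) :
    P + X + 1 + (1 - v1) - ‖conj h * P + ρ * σ‖ ^ 2 / D =
      X + 1 - ‖ρ * σ - h⁻¹ * (σ : ℂ) ^ 2‖ ^ 2 / D := by
  have hn : ‖h‖ ^ 2 ≠ 0 := by simpa using hh
  have e1 : ‖conj h * P + ρ * σ‖ ^ 2
      = ‖h‖ ^ 2 * P ^ 2 + ‖ρ‖ ^ 2 * σ ^ 2 + 2 * P * σ * (h * ρ).re := by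
    simp only [← Complex.normSq_eq_norm_sq, Complex.normSq_apply]; simp; ring
  have e0 : ∀ g : ℂ, ‖ρ * σ - g * (σ : ℂ) ^ 2‖ ^ 2
      = ‖ρ‖ ^ 2 * σ ^ 2 + ‖g‖ ^ 2 * σ ^ 4 - 2 * σ ^ 3 * (conj g * ρ).re := by
    intro g
    simp only [← Complex.normSq_eq_norm_sq, Complex.normSq_apply]; simp [pow_two]; ring
  have e3 : (conj h⁻¹ * ρ).re = (h * ρ).re / ‖h‖ ^ 2 := by
    rw [Complex.inv_def]
    simp only [map_mul, Complex.conj_conj, Complex.conj_ofReal, Complex.normSq_eq_norm_sq]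
    rw [mul_right_comm, Complex.re_mul_ofReal]
    rfl
  have e4 : (conj h⁻¹ * ρ * σ).re = (h * ρ).re / ‖h‖ ^ 2 * σ := by
    rw [Complex.re_mul_ofReal, e3]
  rw [e1, e0, e3, hv1, e4, norm_inv, inv_pow]
  have hh' : ‖h‖ ≠ 0 := norm_ne_zero_iff.2 hh
  generalize (h * ρ).re = r
  generalize ‖h‖ = m at *
  have hP : P = (D - σ ^ 2) / m ^ 2 := by rw [hD]; field_simp; ring
  rw [hP]
  field_simp
  ring

/-- The conditional variance of h₁₂Y₂G + Ṽ given U₂G, with g = h₁₂ and a = |h₂₁|²P₁; the summand Y -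
‖g‖²β is the variance of Ṽ. Since h₁₂Y₂G - h₁₂U₂G does not contain X₁G, the result has no separate
a-term. -/
lemma regression_var₂ {P D Y β σ : ℝ} {g ρ : ℂ} {a : ℝ} (hD : D = a + σ ^ 2)
    (hD0 : 0 < D) (hβ : β = 1 + σ ^ 2 - 2 * (ρ * σ).re) :
    ‖g‖ ^ 2 * (P + a + 1) + (Y - ‖g‖ ^ 2 * β) - ‖g * (((a : ℝ) : ℂ) + ρ * σ)‖ ^ 2 / D =
      ‖g‖ ^ 2 * P + Y - ‖g * ρ * σ - g * (σ : ℂ) ^ 2‖ ^ 2 / D := by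
  have e1 : ‖g * ρ * σ - g * (σ : ℂ) ^ 2‖ ^ 2 = ‖g‖ ^ 2 * ‖ρ * σ - (σ : ℂ) ^ 2‖ ^ 2 := by
    rw [← mul_pow, ← norm_mul]; congr 2; ring
  have e2 : ‖ρ * σ - (σ : ℂ) ^ 2‖ ^ 2 = ‖ρ‖ ^ 2 * σ ^ 2 - 2 * σ ^ 2 * (ρ * σ).re + σ ^ 4 := by
    simp only [← Complex.normSq_eq_norm_sq, Complex.normSq_apply]; simp [pow_two]; ring
  have e3 : ‖((a : ℝ) : ℂ) + ρ * σ‖ ^ 2 = a ^ 2 + 2 * a * (ρ * σ).re + ‖ρ‖ ^ 2 * σ ^ 2 := by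
    simp only [← Complex.normSq_eq_norm_sq, Complex.normSq_apply]; simp [pow_two]; ring
  rw [e1, e2, norm_mul, mul_pow, e3, hβ]
  rw [hD] at hD0 ⊢
  field_simp
  ring

lemma entropyBound_eq_logBound (hP₁ : 0 < G.P₁) (hP₂ : 0 < G.P₂) (hκ : κ.InRange)
    (had : G.Admissible κ) : G.entropyBound κ = G.logBound κ := by
  obtain ⟨⟨hσN, -⟩, -, ⟨hσW, -⟩, hκ'⟩ := id hκ
  obtain ⟨-, -, -, ⟨-, -⟩, hρN, -, -, hρW⟩ := id hκ
  obtain ⟨-, hint, hZ, hh, hVN, hσ, hβ⟩ := id had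
  have hh' : 0 < ‖G.h₂₁‖ := norm_pos_iff.2 hh
  have hVNeq := varVN₁_eq hσ hρN
  have hs : ((√(1 - ‖κ.ρN₁‖ ^ 2) : ℝ) : ℂ) ≠ 0 := sqrt_cast_ne_zero (by rw [← hVNeq]; exact hVN)
  have hσ' : (κ.σN₁ : ℂ) ≠ 0 := by exact_mod_cast hσ.ne'
  have hq1 : ((√G.P₁ : ℝ) : ℂ) ≠ 0 := sqrt_cast_ne_zero hP₁
  have hq2 : ((√G.P₂ : ℝ) : ℂ) ≠ 0 := sqrt_cast_ne_zero hP₂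
  set t := 1 - (varVN₁ κ)⁻¹ * ‖G.h₁₂‖ ^ 2 * varZ₂subW₂ κ with ht
  have htv : t * varVN₁ κ = varVN₁ κ - ‖G.h₁₂‖ ^ 2 * varZ₂subW₂ κ := by
    rw [ht]; field_simp
  have ht0 : 0 ≤ t := by
    by_contra hneg
    have := mul_neg_of_neg_of_pos (not_le.1 hneg) hVN
    linarith
  have hz0 : 0 ≤ 1 - G.varZ₁subN₁ κ := by linarith
  have e1 := G.lsq_cS₁ hP₁ hρN
  have e3 := G.lsq_cU₂ hP₁ hρW
  have p1 : 0 < lsq (G.cS₁ κ) := by rw [e1]; positivity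
  have p3 : 0 < lsq (G.cU₂ κ) := by rw [e3]; positivity
  -- Coordinate 3 is zero in the first vector and nonzero in the second, so a proportionality factor
  -- would vanish; coordinate 0 contradicts this.
  have q1 : ∀ x : ℝ, 0 < lsq (resid (G.cY₁ x) (G.cS₁ κ)) := by
    intro x
    refine lsq_resid_pos _ _ fun c hc => ?_
    have h0 := hc 0
    have h3 := hc 3
    simp [cY₁, cS₁] at h0 h3
    rcases h3 with h3 | h3 | h3
    · simp [h3, hP₁.le, Real.sqrt_eq_zero, hP₁.ne'] at h0
    · exact hσ.ne' h3
    · exact hs (by exact_mod_cast h3)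
  have q2 : 0 < lsq (resid G.cY₂ (G.cU₂ κ)) := by
    refine lsq_resid_pos _ _ fun c hc => ?_
    have h1 := hc 1
    simp [cY₂, cU₂] at h1
    exact hq2 (by exact_mod_cast h1)
  -- Proportionality forces h₁₂ = 0 through coordinate 1. Then t = 1, and coordinate 7 is
  -- √σ²_{V_{N₁}}, which is nonzero.
  have q3 : 0 < lsq (resid (G.cY₂' t (varVN₁ κ)) (G.cU₂ κ)) := by
    refine lsq_resid_pos _ _ fun c hc => ?_
    have h1 := hc 1
    have h7 := hc 7
    simp [cY₂', cU₂] at h1 h7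
    rcases h1 with h1 | h1
    · rw [ht, h1] at h7
      simp at h7
      exact sqrt_cast_ne_zero hVN (by exact_mod_cast h7)
    · exact hq2 (by exact_mod_cast h1)
  rw [entropyBound, G.R₀_eq_R₀Log hP₁ hP₂ hκ had, Y₁G_add_eq, Y₂G_add_eq, Y₁G_eq, Y₂G_eq, S₁G_eq,
    U₂G_eq, ← ht, condEntropyOf_lin _ _ p1 (q1 0), condEntropyOf_lin _ _ p1 (q1 _),
    condEntropyOf_lin _ _ p3 q2, condEntropyOf_lin _ _ p3 q3]
  have s1 := logb_entropy_sub (q1 0) (q1 (1 - G.varZ₁subN₁ κ))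
  have s2 := logb_entropy_sub q2 q3
  have r1 := regression_var₁ (X := ‖G.h₁₂‖ ^ 2 * G.P₂) hh e1 p1 (G.varZ₁subN₁_eq hρN)
  have r2 := regression_var₂ (P := G.P₂) (Y := varVN₁ κ) (g := G.h₁₂) e3 p3
    (varZ₂subW₂_eq hρW)
  rw [← htv] at r2
  rw [lsq_resid _ _ p1, lsq_resid _ _ p1, cdot_cY₁_cS₁ G hP₁, cdot_cY₁_cS₁ G hP₁,
    G.lsq_cY₁ hP₁ hP₂ le_rfl, G.lsq_cY₁ hP₁ hP₂ hz0, r1, e1, add_zero] at s1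
  rw [lsq_resid _ _ p3, lsq_resid _ _ p3, cdot_cY₂_cU₂ G hP₁, cdot_cY₂'_cU₂ G hP₁,
    G.lsq_cY₂ hP₁ hP₂, G.lsq_cY₂' hP₁ hP₂ ht0 hVN.le, r2, e3] at s2
  rw [logBound, ← s1, ← s2, lsq_resid _ _ p1, lsq_resid _ _ p1, lsq_resid _ _ p3, lsq_resid _ _ p3,
    cdot_cY₁_cS₁ G hP₁, cdot_cY₁_cS₁ G hP₁, cdot_cY₂_cU₂ G hP₁, cdot_cY₂'_cU₂ G hP₁,
    G.lsq_cY₁ hP₁ hP₂ le_rfl, G.lsq_cY₁ hP₁ hP₂ hz0, G.lsq_cY₂ hP₁ hP₂,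
    G.lsq_cY₂' hP₁ hP₂ ht0 hVN.le, r1, r2, e1, e3, add_zero]
  ring

end GIC

/-! ### Information inequalities -/

section Information

variable {Ω : Type*} [MeasurableSpace Ω] {μ : Measure Ω} [IsProbabilityMeasure μ]

/-- Gibbs' inequality: the mean of `log φ` is at most `0` if that of `φ` is at most `1`. -/
lemma integral_log_nonpos {φ : Ω → ℝ} (hφ : Measurable φ) (hpos : ∀ ω, 0 < φ ω)
    (h1 : ∫⁻ ω, ENNReal.ofReal (φ ω) ∂μ ≤ 1) (hlog : Integrable (fun ω => Real.log (φ ω)) μ) :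
    ∫ ω, Real.log (φ ω) ∂μ ≤ 0 := by
  have hint : Integrable φ μ := by
    refine ⟨hφ.aestronglyMeasurable, ?_⟩
    rw [hasFiniteIntegral_iff_ofReal (ae_of_all _ fun ω => (hpos ω).le)]
    exact h1.trans_lt ENNReal.one_lt_top
  have h2 : ∫ ω, φ ω ∂μ ≤ 1 := by
    rw [integral_eq_lintegral_of_nonneg_ae (ae_of_all _ fun ω => (hpos ω).le)
      hφ.aestronglyMeasurable]
    exact ENNReal.toReal_le_of_le_ofReal zero_le_one (by simpa using h1)
  have h3 : ∫ ω, Real.log (φ ω) ∂μ ≤ ∫ ω, (φ ω - 1) ∂μ :=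
    integral_mono hlog (hint.sub (integrable_const _)) fun ω => Real.log_le_sub_one_of_pos (hpos ω)
  rw [integral_sub hint (integrable_const _)] at h3
  simp at h3
  linarith

variable {Z : Type*} [MeasurableSpace Z] {ν : Measure Z}

/-- Fano's inequality: a decoder that finds `m` from `z` bounds the mean log-likelihood ratio of
the conditional densities `k` and any density `q`. -/
lemma fano [SFinite ν] {M : ℕ} {κ : Measure (Fin M)} [IsProbabilityMeasure κ]
    (hκ : ∀ i, κ {i} = (M : ENNReal)⁻¹) (hM : 0 < M)
    {m : Ω → Fin M} {z : Ω → Z} (hm : Measurable m) (hz : Measurable z)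
    {k : Fin M → Z → ℝ} (hk : Measurable fun p : Fin M × Z => k p.1 p.2)
    (hkpos : ∀ i z, 0 < k i z)
    (hlaw : ∀ F : Fin M × Z → ENNReal, Measurable F →
      ∫⁻ ω, F (m ω, z ω) ∂μ = ∫⁻ i, ∫⁻ y, F (i, y) * ENNReal.ofReal (k i y) ∂ν ∂κ)
    {q : Z → ℝ} (hq : Measurable q) (hqpos : ∀ z, 0 < q z)
    (hq1 : ∫⁻ y, ENNReal.ofReal (q y) ∂ν ≤ 1)
    {dec : Z → Fin M} (hdec : Measurable dec)
    (hki : Integrable (fun ω => Real.log (k (m ω) (z ω))) μ)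
    (hqi : Integrable (fun ω => Real.log (q (z ω))) μ) :
    Real.log M * μ.real {ω | dec (z ω) = m ω} - Real.log 2 ≤
      ∫ ω, Real.log (k (m ω) (z ω)) ∂μ - ∫ ω, Real.log (q (z ω)) ∂μ := by
  classical
  have hM' : (0 : ℝ) < M := by exact_mod_cast hM
  -- Gibbs' inequality is applied to q·e/(2k). The weight e puts log M on the event of correct
  -- decoding, and the factor 1/2, which makes the mean at most 1, costs the log 2 of Fano's
  -- inequality.
  let e : Fin M × Z → ℝ := fun p => if dec p.2 = p.1 then (M : ℝ) else 1
  have hset : MeasurableSet {p : Fin M × Z | dec p.2 = p.1} :=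
    measurableSet_eq_fun (hdec.comp measurable_snd) measurable_fst
  have he : Measurable e := Measurable.ite hset measurable_const measurable_const
  have hepos : ∀ p, 0 < e p := fun p => by simp only [e]; split_ifs <;> linarith
  let φ : Fin M × Z → ℝ := fun p => q p.2 * e p / 2 / k p.1 p.2
  have hφ : Measurable φ := by fun_prop
  have hφpos : ∀ p, 0 < φ p := fun p =>
    div_pos (half_pos (mul_pos (hqpos _) (hepos _))) (hkpos _ _)
  have hsω : MeasurableSet {ω | dec (z ω) = m ω} := measurableSet_eq_fun (hdec.comp hz) hm
  have hlogφ : ∀ ω, Real.log (φ (m ω, z ω)) = Real.log (q (z ω)) - Real.log (k (m ω) (z ω))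
      + ({ω | dec (z ω) = m ω}.indicator (fun _ => Real.log M) ω - Real.log 2) := by
    intro ω
    simp only [φ]
    rw [Real.log_div (half_pos (mul_pos (hqpos _) (hepos _))).ne' (hkpos _ _).ne',
      Real.log_div (mul_pos (hqpos _) (hepos _)).ne' (by norm_num),
      Real.log_mul (hqpos _).ne' (hepos _).ne']
    have : Real.log (e (m ω, z ω)) = {ω | dec (z ω) = m ω}.indicator (fun _ => Real.log M) ω := by
      simp only [e, Set.indicator_apply, Set.mem_ofPred_eq]
      split_ifs <;> simp
    rw [this]; ring
  have hind : Integrable ({ω | dec (z ω) = m ω}.indicator (fun _ => Real.log (M : ℝ))) μ :=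
    (integrable_const _).indicator hsω
  have hi1 : Integrable (fun ω => Real.log (q (z ω)) - Real.log (k (m ω) (z ω))) μ := hqi.sub hki
  have hi2 : Integrable (fun ω => {ω | dec (z ω) = m ω}.indicator (fun _ => Real.log (M : ℝ)) ω
      - Real.log 2) μ := hind.sub (integrable_const _)
  have hmz : Measurable fun ω => (m ω, z ω) := hm.prodMk hz
  have h1 : ∫⁻ ω, ENNReal.ofReal (φ (m ω, z ω)) ∂μ ≤ 1 := by
    rw [hlaw (fun p => ENNReal.ofReal (φ p)) (by fun_prop)]
    have h2 : ∀ i y, ENNReal.ofReal (φ (i, y)) * ENNReal.ofReal (k i y)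
        = ENNReal.ofReal (q y) * ENNReal.ofReal (e (i, y) / 2) := by
      intro i y
      rw [← ENNReal.ofReal_mul (hφpos _).le, ← ENNReal.ofReal_mul (hqpos _).le]
      congr 1
      simp only [φ]
      rw [div_mul_cancel₀ _ (hkpos _ _).ne']; ring
    simp_rw [h2]
    rw [lintegral_lintegral_swap (by fun_prop)]
    calc ∫⁻ y, ∫⁻ i, ENNReal.ofReal (q y) * ENNReal.ofReal (e (i, y) / 2) ∂κ ∂ν
        ≤ ∫⁻ y, ENNReal.ofReal (q y) ∂ν := by
          refine lintegral_mono fun y => ?_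
          rw [lintegral_const_mul _ (by fun_prop)]
          refine mul_le_of_le_one_right' ?_
          -- For fixed y only the message `dec y` has weight M/2 and all others have 1/2, so the
          -- uniform average is at most 1/2 + 1/2.
          have h3 : ∀ i, ENNReal.ofReal (e (i, y) / 2) ≤
              ENNReal.ofReal (1 / 2) + ({dec y} : Set (Fin M)).indicator
                (fun _ => ENNReal.ofReal (M / 2)) i := by
            intro i
            by_cases h : dec y = i
            · simp only [e, h, if_true, Set.indicator_apply, Set.mem_singleton_iff]
              exact le_add_self
            · simp only [e, h, if_false]
              exact le_self_add
          refine (lintegral_mono h3).trans ?_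
          rw [lintegral_add_left measurable_const, lintegral_const, measure_univ, mul_one,
            lintegral_indicator_const (MeasurableSet.singleton _), hκ]
          have h4 : ENNReal.ofReal ((M : ℝ) / 2) * (M : ENNReal)⁻¹ = ENNReal.ofReal (1 / 2) := by
            rw [← ENNReal.ofReal_natCast, ← ENNReal.ofReal_inv_of_pos hM',
              ← ENNReal.ofReal_mul (by positivity)]
            congr 1; field_simp
          rw [h4, ← ENNReal.ofReal_add (by norm_num) (by norm_num)]
          norm_num
      _ ≤ 1 := hq1
  have hlogi : Integrable (fun ω => Real.log (φ (m ω, z ω))) μ := by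
    simp_rw [hlogφ]; exact hi1.add hi2
  have h5 := integral_log_nonpos (hφ.comp hmz) (fun ω => hφpos _) h1 hlogi
  simp only [Function.comp_apply] at h5
  simp_rw [hlogφ] at h5
  rw [integral_add hi1 hi2, integral_sub hqi hki, integral_sub hind (integrable_const _),
    integral_indicator_const _ hsω] at h5
  simp at h5
  linarith

lemma lintegral_iidCN_three {n : ℕ} (u₁ u₂ u₃ : ℂ) {v : ℝ}
    (hv : ‖u₁‖ ^ 2 + ‖u₂‖ ^ 2 + ‖u₃‖ ^ 2 = v) {F : CVec n → ENNReal} (hF : Measurable F) :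
    ∫⁻ w, F (u₁ • w.1 + u₂ • w.2.1 + u₃ • w.2.2) ∂((iidCN n).prod ((iidCN n).prod (iidCN n))) =
      ∫⁻ w, F ((√v : ℝ) • w) ∂iidCN n := by
  have h := map_sum_smul_iidCN (n := n) u₁ u₂ u₃
  rw [hv] at h
  have h2 := lintegral_map (μ := iidCN n) (f := F) (g := fun w => (√v : ℝ) • w) hF (by fun_prop)
  rw [← h2, ← h, lintegral_map hF (by fun_prop)]

lemma lintegral_iidCN_two {n : ℕ} (u₁ u₂ : ℂ) {v : ℝ} (hv : ‖u₁‖ ^ 2 + ‖u₂‖ ^ 2 = v)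
    {F : CVec n → ENNReal} (hF : Measurable F) :
    ∫⁻ w₁, ∫⁻ w₂, F (u₁ • w₁ + u₂ • w₂) ∂iidCN n ∂iidCN n = ∫⁻ w, F ((√v : ℝ) • w) ∂iidCN n := by
  rw [← lintegral_iidCN_three u₁ u₂ 0 (by simpa using hv) hF, lintegral_prod _ (by fun_prop)]
  refine lintegral_congr fun w₁ => ?_
  rw [lintegral_prod _ (by fun_prop)]
  simp

/-- The worst additive noise is Gaussian: if `(T, S)` are coordinates on `Z` and `W` is standard
Gaussian and independent of `z`, then the joint density `p` of `z` cannot be much flatter than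
the densities `f` of `h T + √v W + c(S)` and `r` of `S`. -/
lemma worst_noise {n : ℕ} {Sg : Type*} [MeasurableSpace Sg] {σ : Measure Sg} [SFinite σ]
    {z : Ω → Z} {w : Ω → CVec n} (hz : Measurable z) (hw : Measurable w)
    {p : Z → ℝ} (hp : Measurable p) (hppos : ∀ z, 0 < p z)
    (hlaw : ∀ F : Z × CVec n → ENNReal, Measurable F →
      ∫⁻ ω, F (z ω, w ω) ∂μ = ∫⁻ y, (∫⁻ x, F (y, x) ∂iidCN n) * ENNReal.ofReal (p y) ∂ν)
    {T : Z → CVec n} {S : Z → Sg}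
    (hTS : MeasurePreserving (fun y => (T y, S y)) ν (volume.prod σ))
    {f : CVec n → ℝ} (hf : Measurable f) (hfpos : ∀ y, 0 < f y)
    (hf1 : ∫⁻ y, ENNReal.ofReal (f y) ≤ 1)
    {r : Sg → ℝ} (hr : Measurable r) (hrpos : ∀ s, 0 < r s)
    (hr1 : ∫⁻ s, ENNReal.ofReal (r s) ∂σ ≤ 1)
    {c : Sg → CVec n} (hc : Measurable c) {h : ℂ} {v α : ℝ} (hv : 0 ≤ v) (hα : 0 < α)
    (hα' : 0 < ‖h‖ ^ 2 * α + v)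
    (if' : Integrable
      (fun ω => Real.log (f (h • T (z ω) + (√v : ℝ) • w ω + c (S (z ω))))) μ)
    (ir : Integrable (fun ω => Real.log (r (S (z ω)))) μ)
    (ip : Integrable (fun ω => Real.log (p (z ω))) μ)
    (iT : Integrable (fun ω => nsq (T (z ω))) μ)
    (iT' : Integrable (fun ω => nsq (h • T (z ω) + (√v : ℝ) • w ω)) μ)
    (hT : ∫ ω, nsq (T (z ω)) ∂μ ≤ n * α)
    (hT' : ∫ ω, nsq (h • T (z ω) + (√v : ℝ) • w ω) ∂μ =
      ‖h‖ ^ 2 * ∫ ω, nsq (T (z ω)) ∂μ + n * v) :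
    ∫ ω, Real.log (f (h • T (z ω) + (√v : ℝ) • w ω + c (S (z ω)))) ∂μ
      + ∫ ω, Real.log (r (S (z ω))) ∂μ - ∫ ω, Real.log (p (z ω)) ∂μ ≤
      n * Real.log (α / (‖h‖ ^ 2 * α + v)) := by
  set α' := ‖h‖ ^ 2 * α + v with hα'def
  have hTm : Measurable T := measurable_fst.comp hTS.measurable
  have hSm : Measurable S := measurable_snd.comp hTS.measurable
  let N : Z × CVec n → CVec n := fun q => h • T q.1 + (√v : ℝ) • q.2
  have hN : Measurable N := by fun_prop
  -- The quotient f(N + c)·gDens α(T)·r(S)/gDens α'(N), with N = hT + √v w. Dividing by the true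
  -- density p and applying Gibbs' inequality compares the actual entropies with those of Gaussians
  -- of variances α and α'.
  let ψ : (CVec n × Sg) × CVec n → ℝ := fun q =>
    f (h • q.1.1 + (√v : ℝ) • q.2 + c q.1.2) * gDens α q.1.1 * r q.1.2 /
      gDens α' (h • q.1.1 + (√v : ℝ) • q.2)
  have hψ : Measurable ψ := by fun_prop
  have hψpos : ∀ q, 0 < ψ q := fun q => div_pos (mul_pos (mul_pos (hfpos _) (gDens_pos hα _))
    (hrpos _)) (gDens_pos hα' _)
  let φ : Z × CVec n → ℝ := fun q => ψ ((T q.1, S q.1), q.2) / p q.1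
  have hφ : Measurable φ := by fun_prop
  have hφpos : ∀ q, 0 < φ q := fun q => div_pos (hψpos _) (hppos _)
  have hzw : Measurable fun ω => (z ω, w ω) := hz.prodMk hw
  have h1 : ∫⁻ ω, ENNReal.ofReal (φ (z ω, w ω)) ∂μ ≤ 1 := by
    rw [hlaw (fun q => ENNReal.ofReal (φ q)) (by fun_prop)]
    have h2 : ∀ y, (∫⁻ x, ENNReal.ofReal (φ (y, x)) ∂iidCN n) * ENNReal.ofReal (p y)
        = (fun q : CVec n × Sg => ∫⁻ x, ENNReal.ofReal (ψ (q, x)) ∂iidCN n) (T y, S y) := by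
      intro y
      rw [← lintegral_mul_const _ (by fun_prop)]
      refine lintegral_congr fun x => ?_
      rw [← ENNReal.ofReal_mul (hφpos _).le]
      simp only [φ]
      rw [div_mul_cancel₀ _ (hppos _).ne']
    have hmeas : Measurable fun q : CVec n × Sg => ∫⁻ x, ENNReal.ofReal (ψ (q, x)) ∂iidCN n :=
      Measurable.lintegral_prod_right (by fun_prop)
    simp_rw [h2]
    rw [← lintegral_map hmeas hTS.measurable, hTS.map_eq, lintegral_prod_symm _ hmeas.aemeasurable]
    calc _ ≤ ∫⁻ s, ENNReal.ofReal (r s) ∂σ := by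
          refine lintegral_mono fun s => ?_
          let H : CVec n → ENNReal := fun y =>
            ENNReal.ofReal (f (y + c s)) * (ENNReal.ofReal (gDens α' y))⁻¹
          have hH : Measurable H := by fun_prop
          have h3 : ∀ t x, ENNReal.ofReal (ψ ((t, s), x)) = ENNReal.ofReal (r s) *
              (H (h • t + (√v : ℝ) • x) * ENNReal.ofReal (gDens α (t - 0))) := by
            intro t x
            simp only [ψ, H]
            rw [ENNReal.ofReal_div_of_pos (gDens_pos hα' _), ENNReal.ofReal_mul
              (mul_pos (hfpos _) (gDens_pos hα _)).le, ENNReal.ofReal_mul (hfpos _).le, sub_zero,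
              ENNReal.div_eq_inv_mul]
            ring
          simp_rw [h3]
          have h4 : ∀ t : CVec n, ∫⁻ x, ENNReal.ofReal (r s) *
              (H (h • t + (√v : ℝ) • x) * ENNReal.ofReal (gDens α (t - 0))) ∂iidCN n =
              ENNReal.ofReal (r s) * ((∫⁻ x, H (h • t + (√v : ℝ) • x) ∂iidCN n) *
                ENNReal.ofReal (gDens α (t - 0))) := by
            intro t
            rw [lintegral_const_mul _ (by fun_prop), lintegral_mul_const _ (by fun_prop)]
          have hm2 : Measurable fun t : CVec n => ∫⁻ x, H (h • t + (√v : ℝ) • x) ∂iidCN n :=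
            Measurable.lintegral_prod_right'
              (f := fun q : CVec n × CVec n => H (h • q.1 + (√v : ℝ) • q.2)) (by fun_prop)
          simp_rw [h4]
          -- Once p is cancelled, the factor gDens α turns T into a Gaussian of variance α. Then hT
          -- + √v w is Gaussian of variance α', its density cancels the denominator of ψ, and only
          -- the integral of f remains.
          rw [lintegral_const_mul _ (by fun_prop), ← lintegral_iidCN_affine hα 0 hm2]
          refine mul_le_of_le_one_right' ?_
          have h5 : ∀ w₁ w₂ : CVec n, h • (0 + (√α : ℝ) • w₁) + (√v : ℝ) • w₂
              = (h * (√α : ℝ)) • w₁ + ((√v : ℝ) : ℂ) • w₂ := by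
            intro w₁ w₂
            ext j; simp; ring
          simp_rw [h5]
          have h6 : ‖h * ((√α : ℝ) : ℂ)‖ ^ 2 + ‖((√v : ℝ) : ℂ)‖ ^ 2 = α' := by
            rw [norm_mul, mul_pow, normSq_sqrt_cast hα.le, normSq_sqrt_cast hv]
          rw [lintegral_iidCN_two _ _ h6 hH]
          have h7 := lintegral_iidCN_affine hα' 0 hH
          simp only [zero_add] at h7
          rw [h7]
          have h8 : ∀ y : CVec n, H y * ENNReal.ofReal (gDens α' (y - 0))
              = ENNReal.ofReal (f (y + c s)) := by
            intro y
            simp only [H, sub_zero]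
            rw [mul_assoc, ENNReal.inv_mul_cancel (by simpa using gDens_pos hα' y)
              ENNReal.ofReal_ne_top, mul_one]
          simp_rw [h8]
          rw [lintegral_add_right_eq_self (fun y => ENNReal.ofReal (f y)) (c s)]
          exact hf1
      _ ≤ 1 := hr1
  have hlogφ : ∀ ω, Real.log (φ (z ω, w ω)) =
      (Real.log (f (h • T (z ω) + (√v : ℝ) • w ω + c (S (z ω)))) + Real.log (r (S (z ω)))
        - Real.log (p (z ω)))
      + ((α'⁻¹ * nsq (h • T (z ω) + (√v : ℝ) • w ω) - α⁻¹ * nsq (T (z ω)))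
        - n * Real.log (α / α')) := by
    intro ω
    have a1 : Real.log (φ (z ω, w ω)) = Real.log (ψ ((T (z ω), S (z ω)), w ω))
        - Real.log (p (z ω)) := Real.log_div (hψpos _).ne' (hppos _).ne'
    rw [a1]
    simp only [ψ]
    rw [Real.log_div (mul_pos (mul_pos (hfpos _)
      (gDens_pos hα _)) (hrpos _)).ne' (gDens_pos hα' _).ne', Real.log_mul (mul_pos (hfpos _)
      (gDens_pos hα _)).ne' (hrpos _).ne', Real.log_mul (hfpos _).ne' (gDens_pos hα _).ne',
      log_gDens hα, log_gDens hα', Real.log_mul Real.pi_ne_zero hα.ne',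
      Real.log_mul Real.pi_ne_zero hα'.ne', Real.log_div hα.ne' hα'.ne']
    ring
  have i0 := if'.add ir
  have i1 := i0.sub ip
  have i2 := (iT'.const_mul α'⁻¹).sub (iT.const_mul α⁻¹)
  have i3 := i2.sub (integrable_const (μ := μ) (n * Real.log (α / α')))
  have hlogi : Integrable (fun ω => Real.log (φ (z ω, w ω))) μ := by
    simp_rw [hlogφ]; exact i1.add i3
  have h5 := integral_log_nonpos (hφ.comp hzw) (fun ω => hφpos _) h1 hlogi
  simp only [Function.comp_apply] at h5
  simp_rw [hlogφ] at h5
  have h6 := integral_add i1 i3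
  have h7 := integral_sub i0 ip
  have h8 := integral_add if' ir
  have h9 := integral_sub i2 (integrable_const (μ := μ) (n * Real.log (α / α')))
  have h10 := integral_sub (iT'.const_mul α'⁻¹) (iT.const_mul α⁻¹)
  simp only [Pi.add_apply, Pi.sub_apply] at h6 h7 h8 h9 h10
  rw [h6, h7, h8, h9, h10, integral_const_mul, integral_const_mul, hT', integral_const] at h5
  simp only [probReal_univ, one_smul] at h5
  set s := ∫ ω, nsq (T (z ω)) ∂μ
  -- The quadratic terms left by the two Gaussian densities combine to v(s - nα)/(αα'). Only here is
  -- the power bound on T used, and an inequality suffices.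
  have h11 : α⁻¹ * s - α'⁻¹ * (‖h‖ ^ 2 * s + n * v) ≤ 0 := by
    have : α⁻¹ * s - α'⁻¹ * (‖h‖ ^ 2 * s + n * v) = v * (s - n * α) / (α * α') := by
      have hv' : v = α' - ‖h‖ ^ 2 * α := by rw [hα'def]; ring
      rw [hv']
      generalize ‖h‖ ^ 2 = m
      field_simp
      ring
    rw [this]
    exact div_nonpos_of_nonpos_of_nonneg (mul_nonpos_of_nonneg_of_nonpos hv (by linarith))
      (by positivity)
  linarith

end Information

/-! ### Gaussian mixtures -/

/-- `k` lies between a multiple of `exp (-C t)` and a constant, uniformly in the index. -/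
def GaussBounds {I Z : Type*} (t : Z → ℝ) (k : I → Z → ℝ) : Prop :=
  ∃ c C K : ℝ, 0 < c ∧ 0 ≤ C ∧ ∀ i y, c * Real.exp (-(C * t y)) ≤ k i y ∧ k i y ≤ K

lemma GaussBounds.pos {I Z : Type*} {t : Z → ℝ} {k : I → Z → ℝ} (h : GaussBounds t k) (i : I)
    (y : Z) : 0 < k i y := by
  obtain ⟨c, C, K, hc, -, h⟩ := h
  exact lt_of_lt_of_le (by positivity) (h i y).1

/-- With t a squared norm this gives at most quadratic growth of the log-densities, so finite second
moments make them integrable. -/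
lemma GaussBounds.abs_log_le {I Z : Type*} {t : Z → ℝ} (ht : ∀ y, 0 ≤ t y) {k : I → Z → ℝ}
    (h : GaussBounds t k) : ∃ C : ℝ, ∀ i y, |Real.log (k i y)| ≤ C * (1 + t y) := by
  obtain ⟨c, C, K, hc, hC, h⟩ := h
  refine ⟨C + |Real.log c| + |Real.log K|, fun i y => ?_⟩
  have h0 : 0 < c * Real.exp (-(C * t y)) := by positivity
  have h1 := Real.log_le_log h0 (h i y).1
  have h2 := Real.log_le_log (h0.trans_le (h i y).1) (h i y).2
  rw [Real.log_mul hc.ne' (Real.exp_pos _).ne', Real.log_exp] at h1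
  have h3 := ht y
  have a1 := neg_abs_le (Real.log c)
  have a2 := le_abs_self (Real.log K)
  have a3 := abs_nonneg (Real.log c)
  have a4 := abs_nonneg (Real.log K)
  rw [abs_le]
  constructor <;> nlinarith

lemma GaussBounds.measurable_bounded_integrable {I Z : Type*} [MeasurableSpace I] {κ : Measure I}
    [IsProbabilityMeasure κ] {t : Z → ℝ} {k : I → Z → ℝ} (h : GaussBounds t k)
    (hm : ∀ y, Measurable fun i => k i y) (y : Z) : Integrable (fun i => k i y) κ := by
  have hpos := h.pos
  obtain ⟨c, C, K, hc, hC, h⟩ := h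
  refine Integrable.of_bound (hm y).aestronglyMeasurable K (ae_of_all _ fun i => ?_)
  rw [Real.norm_eq_abs, abs_of_pos (hpos i y)]
  exact (h i y).2

lemma GaussBounds.integral {I Z : Type*} [MeasurableSpace I] {κ : Measure I}
    [IsProbabilityMeasure κ] {t : Z → ℝ} {k : I → Z → ℝ} (h : GaussBounds t k)
    (hm : ∀ y, Measurable fun i => k i y) :
    GaussBounds t fun (_ : Unit) y => ∫ i, k i y ∂κ := by
  have hi := h.measurable_bounded_integrable (κ := κ) hm
  obtain ⟨c, C, K, hc, hC, h⟩ := h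
  refine ⟨c, C, K, hc, hC, fun _ y => ⟨?_, ?_⟩⟩
  · have := integral_mono (μ := κ) (integrable_const _) (hi y) fun i => (h i y).1
    simpa using this
  · have := integral_mono (μ := κ) (hi y) (integrable_const _) fun i => (h i y).2
    simpa using this

lemma GaussBounds.mul {I Z : Type*} {t : Z → ℝ} {k l : I → Z → ℝ}
    (hk : GaussBounds t k) (hl : GaussBounds t l) : GaussBounds t fun i y => k i y * l i y := by
  have hkp := hk.pos
  have hlp := hl.pos
  obtain ⟨c, C, K, hc, hC, h⟩ := hk
  obtain ⟨c', C', K', hc', hC', h'⟩ := hl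
  refine ⟨c * c', C + C', |K| * |K'|, by positivity, by positivity, fun i y => ⟨?_, ?_⟩⟩
  · calc _ = c * Real.exp (-(C * t y)) * (c' * Real.exp (-(C' * t y))) := by
          rw [show -((C + C') * t y) = -(C * t y) + -(C' * t y) by ring, Real.exp_add]; ring
      _ ≤ _ := mul_le_mul (h i y).1 (h' i y).1 (by positivity) (hkp i y).le
  · exact mul_le_mul ((h i y).2.trans (le_abs_self _)) ((h' i y).2.trans (le_abs_self _))
      (hlp i y).le (abs_nonneg _)

/-- Meant for translations by codewords: these are uniformly bounded, so the squared norm grows at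
most affinely. -/
lemma GaussBounds.comp {I J Z Z' : Type*} {t : Z → ℝ} {t' : Z' → ℝ} {k : I → Z → ℝ}
    (hk : GaussBounds t k) (φ : J → I) {g : J → Z' → Z} {D : ℝ} (hD : 0 ≤ D)
    (hg : ∀ j y, t (g j y) ≤ D * (1 + t' y)) : GaussBounds t' fun j y => k (φ j) (g j y) := by
  obtain ⟨c, C, K, hc, hC, h⟩ := hk
  refine ⟨c * Real.exp (-(C * D)), C * D, K, by positivity, by positivity, fun i y => ⟨?_, (h _ _).2⟩⟩
  refine le_trans ?_ (h _ _).1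
  rw [mul_assoc, ← Real.exp_add]
  refine mul_le_mul_of_nonneg_left (Real.exp_le_exp.2 ?_) hc.le
  have := mul_le_mul_of_nonneg_left (hg i y) hC
  nlinarith

lemma gaussBounds_gDens {n : ℕ} {v : ℝ} (hv : 0 < v) :
    GaussBounds nsq fun (_ : Unit) (y : CVec n) => gDens v y := by
  refine ⟨((Real.pi * v) ^ n)⁻¹, v⁻¹, ((Real.pi * v) ^ n)⁻¹, by positivity, by positivity,
    fun _ y => ⟨le_of_eq ?_, gDens_le hv y⟩⟩
  unfold gDens
  congr 2
  field_simp

/-! ### Codebooks and the mixture densities of noisy codewords. -/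

variable {I I' : Type*} [MeasurableSpace I] [MeasurableSpace I'] {n : ℕ}

/-- The codewords `x` are bounded and, under `κ`, centred. -/
structure IsCodebook (κ : Measure I) (x : I → CVec n) : Prop where
  meas : Measurable x
  bdd : ∃ C : ℝ, 0 ≤ C ∧ ∀ i, nsq (x i) ≤ C
  mean : ∀ j, ∫ i, x i j ∂κ = 0

lemma IsCodebook.smul {κ : Measure I} {x : I → CVec n} (h : IsCodebook κ x) (a : ℂ) :
    IsCodebook κ (a • x) where
  meas := h.meas.const_smul a
  bdd := by
    obtain ⟨C, hC, h⟩ := h.bdd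
    refine ⟨‖a‖ ^ 2 * C, by positivity, fun i => ?_⟩
    rw [Pi.smul_apply, nsq_smul_complex]
    exact mul_le_mul_of_nonneg_left (h i) (by positivity)
  mean := fun j => by
    simp only [Pi.smul_apply, smul_eq_mul]
    rw [integral_const_mul, h.mean, mul_zero]

/-- The density of `x i + √v w`, with `i` of law `κ` and `w` standard Gaussian. -/
def mixDens (κ : Measure I) (x : I → CVec n) (v : ℝ) (y : CVec n) : ℝ :=
  ∫ i, gDens v (y - x i) ∂κ

/-- The law of `x i + √v w`, with `i` of law `κ` and `w` standard Gaussian. -/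
def mixLaw (κ : Measure I) (x : I → CVec n) (v : ℝ) : Measure (CVec n) :=
  (κ.prod (iidCN n)).map fun q => x q.1 + (√v : ℝ) • q.2

/-- `E log p(Y)` for `Y = x i + √v w` with density `p`. -/
def negEnt (κ : Measure I) (x : I → CVec n) (v : ℝ) : ℝ :=
  ∫ y, Real.log (mixDens κ x v y) ∂mixLaw κ x v

variable {κ : Measure I} [IsProbabilityMeasure κ] {κ' : Measure I'} [IsProbabilityMeasure κ']

lemma nsq_sub_le (y z : CVec n) : nsq (y - z) ≤ 2 * nsq y + 2 * nsq z := by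
  rw [sub_eq_add_neg, ← nsq_neg z]; exact nsq_add_le _ _

lemma measurable_gDens_sub {x : I → CVec n} (hx : Measurable x) (v : ℝ) :
    Measurable fun q : CVec n × I => gDens v (q.1 - x q.2) :=
  (measurable_gDens v).comp (measurable_fst.sub (hx.comp measurable_snd))

lemma measurable_gDens_sub_right {x : I → CVec n} (hx : Measurable x) (v : ℝ) (y : CVec n) :
    Measurable fun i => gDens v (y - x i) :=
  (measurable_gDens v).comp (hx.const_sub y)

lemma gaussBounds_gDens_sub {x : I → CVec n} (h : IsCodebook κ x) {v : ℝ} (hv : 0 < v) :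
    GaussBounds nsq fun i (y : CVec n) => gDens v (y - x i) := by
  obtain ⟨C, hC, hx⟩ := h.bdd
  refine (gaussBounds_gDens hv).comp (fun _ => ()) (g := fun i y => y - x i) (D := 2 + 2 * C)
    (by positivity) fun i y => ?_
  have h1 := nsq_sub_le y (x i)
  have h2 := hx i
  have h3 := nsq_nonneg y
  nlinarith

lemma gaussBounds_mixDens {x : I → CVec n} (h : IsCodebook κ x) {v : ℝ} (hv : 0 < v) :
    GaussBounds nsq fun (_ : Unit) y => mixDens κ x v y :=
  (gaussBounds_gDens_sub h hv).integral (measurable_gDens_sub_right h.meas v)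

lemma mixDens_pos {x : I → CVec n} (h : IsCodebook κ x) {v : ℝ} (hv : 0 < v) (y : CVec n) :
    0 < mixDens κ x v y := (gaussBounds_mixDens h hv).pos () y

lemma measurable_mixDens {x : I → CVec n} (h : IsCodebook κ x) (v : ℝ) :
    Measurable (mixDens κ x v) :=
  (measurable_gDens_sub h.meas v).stronglyMeasurable.integral_prod_right'.measurable

lemma GaussBounds.ofReal_integral {Z : Type*} {t : Z → ℝ} {k : I → Z → ℝ} (h : GaussBounds t k)
    (hm : ∀ y, Measurable fun i => k i y) (y : Z) :
    ENNReal.ofReal (∫ i, k i y ∂κ) = ∫⁻ i, ENNReal.ofReal (k i y) ∂κ :=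
  ofReal_integral_eq_lintegral_ofReal (h.measurable_bounded_integrable hm y)
    (ae_of_all _ fun i => (h.pos i y).le)

/-- Tonelli exchanges the average over codewords with the integral over outputs. The offset q will
be the contribution of the other user's codeword. -/
lemma lintegral_mixture {x : I → CVec n} (h : IsCodebook κ x) {v : ℝ} (hv : 0 < v) (q : CVec n)
    {F : CVec n → ENNReal} (hF : Measurable F) :
    ∫⁻ i, ∫⁻ w, F (q + x i + (√v : ℝ) • w) ∂iidCN n ∂κ =
      ∫⁻ y, F y * ENNReal.ofReal (mixDens κ x v (y - q)) := by
  have hm := measurable_gDens_sub h.meas v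
  have hx := h.meas
  simp_rw [lintegral_iidCN_affine hv _ hF]
  rw [lintegral_lintegral_swap (by fun_prop)]
  refine lintegral_congr fun y => ?_
  have h1 := (gaussBounds_gDens_sub h hv).ofReal_integral (κ := κ)
    (measurable_gDens_sub_right hx v) (y - q)
  have h2 : ∀ i, gDens v (y - (q + x i)) = gDens v (y - q - x i) := fun i => by
    rw [sub_add_eq_sub_sub]
  simp_rw [h2]
  have h3 := measurable_gDens_sub_right hx v (y - q)
  rw [lintegral_const_mul _ h3.ennreal_ofReal, mixDens, h1]

lemma lintegral_mixDens {x : I → CVec n} (h : IsCodebook κ x) {v : ℝ} (hv : 0 < v) :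
    ∫⁻ y, ENNReal.ofReal (mixDens κ x v y) = 1 := by
  have := lintegral_mixture h hv 0 (F := fun _ => 1) measurable_const
  simpa using this.symm

/-! ### The probability space of two messages and three noises -/

/-- Two independent messages and three independent standard Gaussian noise vectors. -/
def chanMeas (κ : Measure I) (κ' : Measure I') (n : ℕ) : Measure (I × I' × CVec n × CVec n × CVec n) :=
  κ.prod (κ'.prod ((iidCN n).prod ((iidCN n).prod (iidCN n))))

instance instIsProbabilityMeasureNoise (n : ℕ) :
    IsProbabilityMeasure ((iidCN n).prod ((iidCN n).prod (iidCN n))) :=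
  Measure.prod.instIsProbabilityMeasure _ _

instance instSFiniteNoise (n : ℕ) :
    SFinite ((iidCN n).prod ((iidCN n).prod (iidCN n))) :=
  @instSFiniteOfSigmaFinite _ _ _ (IsFiniteMeasure.toSigmaFinite _)

instance instIsProbabilityMeasureChanMeas : IsProbabilityMeasure (chanMeas κ κ' n) := by
  unfold chanMeas; infer_instance

/-- The linear form `p x + p' x' + u₁ w₁ + u₂ w₂ + u₃ w₃`. -/
def lf (x : I → CVec n) (x' : I' → CVec n) (p p' u₁ u₂ u₃ : ℂ)
    (ω : I × I' × CVec n × CVec n × CVec n) : CVec n :=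
  p • x ω.1 + p' • x' ω.2.1 + (u₁ • ω.2.2.1 + u₂ • ω.2.2.2.1 + u₃ • ω.2.2.2.2)

variable {x : I → CVec n} {x' : I' → CVec n}

lemma measurable_lf (hx : Measurable x) (hx' : Measurable x') (p p' u₁ u₂ u₃ : ℂ) :
    Measurable (lf x x' p p' u₁ u₂ u₃) := by unfold lf; fun_prop

lemma lintegral_lf (hx : Measurable x) (hx' : Measurable x') (p p' u₁ u₂ u₃ : ℂ) {v : ℝ}
    (hv : ‖u₁‖ ^ 2 + ‖u₂‖ ^ 2 + ‖u₃‖ ^ 2 = v)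
    {F : I × I' × CVec n → ENNReal} (hF : Measurable F) :
    ∫⁻ ω, F (ω.1, ω.2.1, lf x x' p p' u₁ u₂ u₃ ω) ∂chanMeas κ κ' n =
      ∫⁻ i, ∫⁻ i', ∫⁻ w, F (i, i', p • x i + p' • x' i' + (√v : ℝ) • w) ∂iidCN n ∂κ' ∂κ := by
  have hm := measurable_lf hx hx' p p' u₁ u₂ u₃
  rw [chanMeas, lintegral_prod _ (by fun_prop)]
  refine lintegral_congr fun i => ?_
  rw [lintegral_prod _ (by fun_prop)]
  refine lintegral_congr fun i' => ?_
  exact lintegral_iidCN_three u₁ u₂ u₃ hv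
    (F := fun y => F (i, i', p • x i + p' • x' i' + y)) (by fun_prop)

lemma map_lf_left (hx : Measurable x) (hx' : Measurable x') (p u₁ u₂ u₃ : ℂ) {v : ℝ}
    (hv : ‖u₁‖ ^ 2 + ‖u₂‖ ^ 2 + ‖u₃‖ ^ 2 = v) :
    (chanMeas κ κ' n).map (lf x x' p 0 u₁ u₂ u₃) = mixLaw κ (p • x) v := by
  refine Measure.ext_of_lintegral _ fun F hF => ?_
  have hpx : Measurable (p • x) := hx.const_smul p
  rw [mixLaw, lintegral_map hF (measurable_lf hx hx' _ _ _ _ _), lintegral_map hF (by fun_prop),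
    lintegral_lf hx hx' p 0 u₁ u₂ u₃ hv (F := fun q => F q.2.2) (by fun_prop),
    lintegral_prod _ (by fun_prop)]
  simp

lemma map_lf_right (hx : Measurable x) (hx' : Measurable x') (p' u₁ u₂ u₃ : ℂ) {v : ℝ}
    (hv : ‖u₁‖ ^ 2 + ‖u₂‖ ^ 2 + ‖u₃‖ ^ 2 = v) :
    (chanMeas κ κ' n).map (lf x x' 0 p' u₁ u₂ u₃) = mixLaw κ' (p' • x') v := by
  refine Measure.ext_of_lintegral _ fun F hF => ?_
  have hpx : Measurable (p' • x') := hx'.const_smul p'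
  rw [mixLaw, lintegral_map hF (measurable_lf hx hx' _ _ _ _ _), lintegral_map hF (by fun_prop),
    lintegral_lf hx hx' 0 p' u₁ u₂ u₃ hv (F := fun q => F q.2.2) (by fun_prop),
    lintegral_prod _ (by fun_prop)]
  simp

lemma integral_log_mixDens_lf_left (hx : IsCodebook κ x) (hx' : Measurable x') (p u₁ u₂ u₃ : ℂ)
    {v : ℝ} (hv : ‖u₁‖ ^ 2 + ‖u₂‖ ^ 2 + ‖u₃‖ ^ 2 = v) :
    ∫ ω, Real.log (mixDens κ (p • x) v (lf x x' p 0 u₁ u₂ u₃ ω)) ∂chanMeas κ κ' n =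
      negEnt κ (p • x) v := by
  rw [negEnt, ← map_lf_left (κ' := κ') hx.meas hx' p u₁ u₂ u₃ hv,
    integral_map (measurable_lf hx.meas hx' _ _ _ _ _).aemeasurable
      (measurable_mixDens (hx.smul p) v).log.aestronglyMeasurable]

lemma integral_log_mixDens_lf_right (hx : Measurable x) (hx' : IsCodebook κ' x')
    (p' u₁ u₂ u₃ : ℂ) {v : ℝ} (hv : ‖u₁‖ ^ 2 + ‖u₂‖ ^ 2 + ‖u₃‖ ^ 2 = v) :
    ∫ ω, Real.log (mixDens κ' (p' • x') v (lf x x' 0 p' u₁ u₂ u₃ ω)) ∂chanMeas κ κ' n =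
      negEnt κ' (p' • x') v := by
  rw [negEnt, ← map_lf_right (κ := κ) hx hx'.meas p' u₁ u₂ u₃ hv,
    integral_map (measurable_lf hx hx'.meas _ _ _ _ _).aemeasurable
      (measurable_mixDens (hx'.smul p') v).log.aestronglyMeasurable]

lemma integrable_nsq_lf (hx : IsCodebook κ x) (hx' : IsCodebook κ' x') (p p' u₁ u₂ u₃ : ℂ) :
    Integrable (fun ω => nsq (lf x x' p p' u₁ u₂ u₃ ω)) (chanMeas κ κ' n) := by
  have hm := measurable_lf hx.meas hx'.meas p p' u₁ u₂ u₃
  obtain ⟨C, hC, hb⟩ := hx.bdd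
  obtain ⟨C', hC', hb'⟩ := hx'.bdd
  have hn : ∀ u₁ u₂ u₃ : ℂ, Integrable (fun w : CVec n × CVec n × CVec n =>
      ‖u₁‖ ^ 2 * nsq w.1 + (‖u₂‖ ^ 2 * nsq w.2.1 + ‖u₃‖ ^ 2 * nsq w.2.2))
      ((iidCN n).prod ((iidCN n).prod (iidCN n))) := fun u₁ u₂ u₃ =>
    ((integrable_nsq (n := n)).comp_fst ((iidCN n).prod (iidCN n)) |>.const_mul _).add
      ((((integrable_nsq (n := n)).comp_fst (iidCN n) |>.const_mul _).add
        ((integrable_nsq (n := n)).comp_snd (iidCN n) |>.const_mul _)).comp_snd (iidCN n))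
  have hi := ((hn u₁ u₂ u₃).comp_snd κ').comp_snd κ
  refine ((integrable_const (μ := chanMeas κ κ' n) (4 * (‖p‖ ^ 2 * C + ‖p'‖ ^ 2 * C'))).add
    (hi.const_mul 8)).mono' (measurable_nsq.comp hm).aestronglyMeasurable (ae_of_all _ fun ω => ?_)
  rw [Real.norm_eq_abs, abs_of_nonneg (nsq_nonneg _)]
  have e1 := nsq_add_le (p • x ω.1 + p' • x' ω.2.1)
    (u₁ • ω.2.2.1 + u₂ • ω.2.2.2.1 + u₃ • ω.2.2.2.2)
  have e2 := nsq_add_le (p • x ω.1) (p' • x' ω.2.1)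
  have e3 := nsq_add_le (u₁ • ω.2.2.1 + u₂ • ω.2.2.2.1) (u₃ • ω.2.2.2.2)
  have e4 := nsq_add_le (u₁ • ω.2.2.1) (u₂ • ω.2.2.2.1)
  simp only [nsq_smul_complex] at e1 e2 e3 e4
  have e5 := mul_le_mul_of_nonneg_left (hb ω.1) (by positivity : 0 ≤ ‖p‖ ^ 2)
  have e6 := mul_le_mul_of_nonneg_left (hb' ω.2.1) (by positivity : 0 ≤ ‖p'‖ ^ 2)
  have e7 := mul_nonneg (by positivity : 0 ≤ ‖u₃‖ ^ 2) (nsq_nonneg ω.2.2.2.2)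
  simp only [Pi.add_apply]
  unfold lf
  linarith

/-- The cross term is linear in the codeword and vanishes because the codebook is centred. -/
lemma integral_nsq_add (h : IsCodebook κ x) (q : CVec n) (p : ℂ) :
    ∫ i, nsq (q + p • x i) ∂κ = nsq q + ‖p‖ ^ 2 * ∫ i, nsq (x i) ∂κ := by
  obtain ⟨C, hC, hb⟩ := h.bdd
  have hx := h.meas
  have hj : ∀ i j, ‖x i j‖ ^ 2 ≤ C := fun i j =>
    (Finset.single_le_sum (f := fun j => ‖x i j‖ ^ 2) (fun _ _ => by positivity)
      (Finset.mem_univ j)).trans (hb i)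
  have hxi : ∀ j, Integrable (fun i => x i j) κ := fun j =>
    Integrable.of_bound (by fun_prop) (C + 1) (ae_of_all _ fun i => by
      nlinarith [hj i j, sq_nonneg (‖x i j‖ - 1), norm_nonneg (x i j)])
  have hni : Integrable (fun i => nsq (x i)) κ :=
    Integrable.of_bound (measurable_nsq.comp hx).aestronglyMeasurable C (ae_of_all _ fun i => by
      rw [Real.norm_eq_abs, abs_of_nonneg (nsq_nonneg _)]; exact hb i)
  have hci : Integrable (fun i => ∑ j, conj (q j) * p * x i j) κ :=
    integrable_finsetSum _ fun j _ => (hxi j).const_mul _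
  have h1 : ∀ i, nsq (q + p • x i) = nsq q + (2 * (∑ j, conj (q j) * p * x i j).re
      + ‖p‖ ^ 2 * nsq (x i)) := by
    intro i
    simp only [nsq, Complex.re_sum, Finset.mul_sum, ← Finset.sum_add_distrib]
    refine Finset.sum_congr rfl fun j _ => ?_
    simp only [← Complex.normSq_eq_norm_sq, Complex.normSq_apply]
    simp; ring
  have i1 : Integrable (fun i => 2 * (∑ j, conj (q j) * p * x i j).re) κ := hci.re.const_mul 2
  have i2 : Integrable (fun i => 2 * (∑ j, conj (q j) * p * x i j).re + ‖p‖ ^ 2 * nsq (x i)) κ :=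
    i1.add (hni.const_mul _)
  simp_rw [h1]
  rw [integral_add (integrable_const _) i2, integral_add i1 (hni.const_mul _), integral_const_mul,
    integral_const_mul]
  have h3 : ∫ i, (∑ j, conj (q j) * p * x i j).re ∂κ = 0 := by
    have h4 := Complex.reCLM.integral_comp_comm hci
    simp only [Complex.reCLM_apply] at h4
    rw [h4, integral_finsetSum _ fun j _ => (hxi j).const_mul _]
    simp [integral_const_mul, h.mean]
  rw [h3]; simp

lemma integral_nsq_lf (hx : IsCodebook κ x) (hx' : IsCodebook κ' x') (p p' u₁ u₂ u₃ : ℂ) :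
    ∫ ω, nsq (lf x x' p p' u₁ u₂ u₃ ω) ∂chanMeas κ κ' n =
      ‖p‖ ^ 2 * ∫ i, nsq (x i) ∂κ + ‖p'‖ ^ 2 * ∫ i, nsq (x' i) ∂κ'
        + n * (‖u₁‖ ^ 2 + ‖u₂‖ ^ 2 + ‖u₃‖ ^ 2) := by
  have hi := integrable_nsq_lf hx hx' p p' u₁ u₂ u₃
  rw [chanMeas] at hi ⊢
  rw [integral_prod _ hi]
  have hi2 := hi.prod_right_ae
  set v := ‖u₁‖ ^ 2 + ‖u₂‖ ^ 2 + ‖u₃‖ ^ 2 with hv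
  have h1 : ∀ q : CVec n, ∫ w, nsq (q + (u₁ • w.1 + u₂ • w.2.1 + u₃ • w.2.2))
      ∂((iidCN n).prod ((iidCN n).prod (iidCN n))) = nsq q + n * v := by
    intro q
    have h2 := integral_nsq_affine q ((√v : ℝ) : ℂ)
    rw [normSq_sqrt_cast (by positivity)] at h2
    rw [← h2]
    have h3 : ∀ w : CVec n, q + ((√v : ℝ) : ℂ) • w = q + (√v : ℝ) • w := fun w => by
      ext j; simp
    simp_rw [h3]
    have hqm : Measurable fun y : CVec n => nsq (q + y) :=
      measurable_nsq.comp (measurable_id.const_add q)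
    rw [← integral_map (φ := fun w : CVec n => (√v : ℝ) • w) (f := fun y => nsq (q + y))
      (by fun_prop) hqm.aestronglyMeasurable, ← map_sum_smul_iidCN,
      integral_map (by fun_prop) hqm.aestronglyMeasurable]
  have h5 : ∀ᵐ i ∂κ, ∫ y, nsq (lf x x' p p' u₁ u₂ u₃ (i, y))
      ∂(κ'.prod ((iidCN n).prod ((iidCN n).prod (iidCN n)))) =
      nsq (p • x i) + ‖p'‖ ^ 2 * ∫ i, nsq (x' i) ∂κ' + n * v := by
    filter_upwards [hi2] with i h
    rw [integral_prod _ h]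
    simp only [lf]
    simp_rw [h1]
    obtain ⟨C, hC, hb⟩ := hx'.bdd
    have hx'm := hx'.meas
    have hii : Integrable (fun i' => nsq (p • x i + p' • x' i')) κ' :=
      Integrable.of_bound
        (measurable_nsq.comp ((hx'm.const_smul p').const_add _)).aestronglyMeasurable
        (2 * nsq (p • x i) + 2 * (‖p'‖ ^ 2 * C))
        (ae_of_all _ fun i' => by
          rw [Real.norm_eq_abs, abs_of_nonneg (nsq_nonneg _)]
          refine (nsq_add_le _ _).trans ?_
          rw [nsq_smul_complex p']
          have := mul_le_mul_of_nonneg_left (hb i') (by positivity : 0 ≤ ‖p'‖ ^ 2)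
          linarith)
    rw [integral_add hii (integrable_const _), integral_nsq_add hx']
    simp
  rw [integral_congr_ae h5]
  obtain ⟨C, hC, hb⟩ := hx.bdd
  have hxm := hx.meas
  have hii : Integrable (fun i => nsq (p • x i)) κ :=
    Integrable.of_bound (measurable_nsq.comp (hxm.const_smul p)).aestronglyMeasurable
      (‖p‖ ^ 2 * C) (ae_of_all _ fun i => by
      rw [Real.norm_eq_abs, abs_of_nonneg (nsq_nonneg _), nsq_smul_complex]
      exact mul_le_mul_of_nonneg_left (hb i) (by positivity))
  simp_rw [add_assoc]
  rw [integral_add hii (integrable_const _)]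
  simp_rw [nsq_smul_complex]
  rw [integral_const_mul]
  simp

lemma integrable_of_growth {Z : Type*} [MeasurableSpace Z] {t : Z → ℝ} {g : Z → ℝ}
    {Ω : Type*} [MeasurableSpace Ω] {μ : Measure Ω} [IsFiniteMeasure μ]
    (hg : Measurable g) {C : ℝ} (hC : ∀ y, |g y| ≤ C * (1 + t y)) {z : Ω → Z} (hz : Measurable z)
    (ht : Integrable (fun ω => t (z ω)) μ) : Integrable (fun ω => g (z ω)) μ :=
  (((integrable_const 1).add ht).const_mul C).mono' (hg.comp hz).aestronglyMeasurable
    (ae_of_all _ fun _ => hC _)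

lemma integrable_log_mixDens_lf {J : Type*} [MeasurableSpace J] {η : Measure J}
    [IsProbabilityMeasure η] {y : J → CVec n} (hy : IsCodebook η y)
    (hx : IsCodebook κ x) (hx' : IsCodebook κ' x') {v : ℝ} (hv : 0 < v) (p p' u₁ u₂ u₃ : ℂ) :
    Integrable (fun ω => Real.log (mixDens η y v (lf x x' p p' u₁ u₂ u₃ ω)))
      (chanMeas κ κ' n) := by
  obtain ⟨C, hC⟩ := (gaussBounds_mixDens hy hv).abs_log_le nsq_nonneg
  exact integrable_of_growth (measurable_mixDens hy v).log (hC ())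
    (measurable_lf hx.meas hx'.meas _ _ _ _ _) (integrable_nsq_lf hx hx' _ _ _ _ _)

/-! ### The joint density of an output pair seen by one receiver. -/

section Channel

variable {I I' : Type*} [MeasurableSpace I] [MeasurableSpace I'] {n : ℕ}
  {κ : Measure I} [IsProbabilityMeasure κ] {κ' : Measure I'} [IsProbabilityMeasure κ']
  {x : I → CVec n} {x' : I' → CVec n}

lemma lf_comb (t₁ t₂ p p' u₁ u₂ u₃ q q' r₁ r₂ r₃ : ℂ) (ω : I × I' × CVec n × CVec n × CVec n) :
    t₁ • lf x x' p p' u₁ u₂ u₃ ω + t₂ • lf x x' q q' r₁ r₂ r₃ ω =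
      lf x x' (t₁ * p + t₂ * q) (t₁ * p' + t₂ * q') (t₁ * u₁ + t₂ * r₁) (t₁ * u₂ + t₂ * r₂)
        (t₁ * u₃ + t₂ * r₃) ω := by
  ext j; simp [lf]; ring

/-- The joint density of `a x i + b x' + √τ w₁` and `a' x i + √σ w₂` given `i`. -/
def pairDens (κ' : Measure I') (x : I → CVec n) (x' : I' → CVec n) (a b a' : ℂ) (τ σ : ℝ) (i : I)
    (y : CVec n × CVec n) : ℝ :=
  mixDens κ' (b • x') τ (y.1 - a • x i) * gDens σ (y.2 - a' • x i)

/-- The joint density of `a x + b x' + √τ w₁` and `a' x + √σ w₂`. -/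
def pairMix (κ : Measure I) (κ' : Measure I') (x : I → CVec n) (x' : I' → CVec n) (a b a' : ℂ)
    (τ σ : ℝ) (y : CVec n × CVec n) : ℝ :=
  ∫ i, pairDens κ' x x' a b a' τ σ i y ∂κ

/-- `E log p(A, B)` for the joint density `p` of `A = a x + b x' + √τ w₁` and
`B = a' x + √σ w₂`. -/
def pairNegEnt (κ : Measure I) (κ' : Measure I') (x : I → CVec n) (x' : I' → CVec n) (a b a' : ℂ)
    (τ σ : ℝ) : ℝ :=
  ∫ ω, Real.log (pairMix κ κ' x x' a b a' τ σ
    (lf x x' a b (√τ : ℝ) 0 0 ω, lf x x' a' 0 0 (√σ : ℝ) 0 ω)) ∂chanMeas κ κ' n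

lemma measurable_pairDens (hx : IsCodebook κ x) (hx' : IsCodebook κ' x') (a b a' : ℂ) (τ σ : ℝ) :
    Measurable fun q : I × CVec n × CVec n => pairDens κ' x x' a b a' τ σ q.1 q.2 := by
  have h1 := measurable_mixDens (hx'.smul b) τ
  have h2 := hx.meas
  unfold pairDens
  exact (h1.comp ((measurable_fst.comp measurable_snd).sub
    ((h2.comp measurable_fst).const_smul a))).mul
    ((measurable_gDens σ).comp ((measurable_snd.comp measurable_snd).sub
    ((h2.comp measurable_fst).const_smul a')))

lemma gaussBounds_pairDens (hx : IsCodebook κ x) (hx' : IsCodebook κ' x') (a b a' : ℂ) {τ σ : ℝ}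
    (hτ : 0 < τ) (hσ : 0 < σ) :
    GaussBounds (fun y : CVec n × CVec n => nsq y.1 + nsq y.2)
      (pairDens κ' x x' a b a' τ σ) := by
  obtain ⟨C, hC, hb⟩ := (hx.smul a).bdd
  obtain ⟨C', hC', hb'⟩ := (hx.smul a').bdd
  have h1 : GaussBounds (fun y : CVec n × CVec n => nsq y.1 + nsq y.2)
      (fun i y => mixDens κ' (b • x') τ (y.1 - a • x i)) := by
    have h0 := gaussBounds_mixDens (hx'.smul b) hτ
    have hD : 0 ≤ 2 + 2 * C := by positivity
    have hg : ∀ i (y : CVec n × CVec n), nsq (y.1 - a • x i) ≤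
        (2 + 2 * C) * (1 + (nsq y.1 + nsq y.2)) := by
      intro i y
      have h1 := nsq_sub_le y.1 (a • x i)
      have h2 := hb i
      simp only [Pi.smul_apply] at h2
      have h3 := nsq_nonneg y.1
      have h4 := nsq_nonneg y.2
      nlinarith
    exact h0.comp (t' := fun y : CVec n × CVec n => nsq y.1 + nsq y.2) (fun _ : I => ()) hD hg
  have h2 : GaussBounds (fun y : CVec n × CVec n => nsq y.1 + nsq y.2)
      (fun i y => gDens σ (y.2 - a' • x i)) := by
    have h0 := gaussBounds_gDens (n := n) hσ
    have hD : 0 ≤ 2 + 2 * C' := by positivity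
    have hg : ∀ i (y : CVec n × CVec n), nsq (y.2 - a' • x i) ≤
        (2 + 2 * C') * (1 + (nsq y.1 + nsq y.2)) := by
      intro i y
      have h1 := nsq_sub_le y.2 (a' • x i)
      have h2 := hb' i
      simp only [Pi.smul_apply] at h2
      have h3 := nsq_nonneg y.1
      have h4 := nsq_nonneg y.2
      nlinarith
    exact h0.comp (t' := fun y : CVec n × CVec n => nsq y.1 + nsq y.2) (fun _ : I => ()) hD hg
  exact h1.mul h2

/-- Given the message i, the first output depends only on x' and w₁ and the second only on w₂, so
their density is a product. The third noise w₃ is kept free, to serve as the additional noise in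
`worst_noise`. -/
lemma lintegral_pair (hx : IsCodebook κ x) (hx' : IsCodebook κ' x') (a b a' : ℂ) {τ σ : ℝ}
    (hτ : 0 < τ) (hσ : 0 < σ)
    {F : I × (CVec n × CVec n) × CVec n → ENNReal} (hF : Measurable F) :
    ∫⁻ ω, F (ω.1, (lf x x' a b (√τ : ℝ) 0 0 ω, lf x x' a' 0 0 (√σ : ℝ) 0 ω), ω.2.2.2.2)
        ∂chanMeas κ κ' n =
      ∫⁻ i, ∫⁻ y : CVec n × CVec n, (∫⁻ w, F (i, y, w) ∂iidCN n) *
        ENNReal.ofReal (pairDens κ' x x' a b a' τ σ i y) ∂volume ∂κ := by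
  have hxm := hx.meas
  have hxm' := hx'.meas
  have m1 := measurable_lf hxm hxm' a b (√τ : ℝ) 0 0
  have m2 := measurable_lf hxm hxm' a' 0 0 (√σ : ℝ) 0
  rw [chanMeas, lintegral_prod _ (by fun_prop)]
  refine lintegral_congr fun i => ?_
  let G : CVec n × CVec n → ENNReal := fun y => ∫⁻ w, F (i, y, w) ∂iidCN n
  have hG : Measurable G :=
    Measurable.lintegral_prod_right' (f := fun q : (CVec n × CVec n) × CVec n => F (i, q.1, q.2))
      (by fun_prop)
  let H : CVec n → ENNReal := fun y₁ =>
    ∫⁻ y₂, G (y₁, y₂) * ENNReal.ofReal (gDens σ (y₂ - a' • x i))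
  have hgm : Measurable fun y : CVec n => gDens σ (y - a' • x i) :=
    (measurable_gDens σ).comp (measurable_id.sub_const _)
  have hH : Measurable H :=
    Measurable.lintegral_prod_right'
      (f := fun q : CVec n × CVec n => G q * ENNReal.ofReal (gDens σ (q.2 - a' • x i)))
      (hG.mul (hgm.comp measurable_snd).ennreal_ofReal)
  have e1 : ∀ i', ∫⁻ w, F (i, (lf x x' a b (√τ : ℝ) 0 0 (i, i', w),
      lf x x' a' 0 0 (√σ : ℝ) 0 (i, i', w)), w.2.2)
      ∂((iidCN n).prod ((iidCN n).prod (iidCN n))) =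
      ∫⁻ w₁, H (a • x i + (b • x') i' + (√τ : ℝ) • w₁) ∂iidCN n := by
    intro i'
    rw [lintegral_prod _ (by fun_prop)]
    refine lintegral_congr fun w₁ => ?_
    rw [lintegral_prod _ (by fun_prop)]
    have e2 : ∀ w₂ w₃ : CVec n, lf x x' a b (√τ : ℝ) 0 0 (i, i', w₁, w₂, w₃) =
        a • x i + (b • x') i' + (√τ : ℝ) • w₁ := by
      intro w₂ w₃; ext j; simp [lf]
    have e3 : ∀ w₂ w₃ : CVec n, lf x x' a' 0 0 (√σ : ℝ) 0 (i, i', w₁, w₂, w₃) =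
        a' • x i + (√σ : ℝ) • w₂ := by
      intro w₂ w₃; ext j; simp [lf]
    simp_rw [e2, e3]
    exact lintegral_iidCN_affine hσ (a' • x i)
      (F := fun y₂ => G (a • x i + (b • x') i' + (√τ : ℝ) • w₁, y₂)) (by fun_prop)
  rw [lintegral_prod _ (by fun_prop)]
  simp_rw [e1]
  have hpm : Measurable fun y : CVec n × CVec n =>
      (∫⁻ w, F (i, y, w) ∂iidCN n) * ENNReal.ofReal (pairDens κ' x x' a b a' τ σ i y) :=
    hG.mul ((measurable_pairDens hx hx' a b a' τ σ).comp measurable_prodMk_left).ennreal_ofReal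
  rw [lintegral_mixture (hx'.smul b) hτ (a • x i) hH, Measure.volume_eq_prod,
    lintegral_prod _ hpm.aemeasurable]
  refine lintegral_congr fun y₁ => ?_
  simp only [H]
  have hGy : Measurable fun y₂ => G (y₁, y₂) * ENNReal.ofReal (gDens σ (y₂ - a' • x i)) :=
    (hG.comp measurable_prodMk_left).mul hgm.ennreal_ofReal
  rw [← lintegral_mul_const _ hGy]
  refine lintegral_congr fun y₂ => ?_
  rw [pairDens, ENNReal.ofReal_mul (mixDens_pos (hx'.smul b) hτ _).le]
  simp only [G]
  ring

lemma measurable_pairMix (hx : IsCodebook κ x) (hx' : IsCodebook κ' x') (a b a' : ℂ) (τ σ : ℝ) :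
    Measurable (pairMix κ κ' x x' a b a' τ σ) := by
  have h := (measurable_pairDens hx hx' a b a' τ σ).comp (measurable_swap (α := CVec n × CVec n))
  exact h.stronglyMeasurable.integral_prod_right'.measurable

lemma measurable_pairDens_right (hx : IsCodebook κ x) (hx' : IsCodebook κ' x') (a b a' : ℂ)
    (τ σ : ℝ) (y : CVec n × CVec n) : Measurable fun i => pairDens κ' x x' a b a' τ σ i y := by
  have h2 := hx.meas
  have h1 : Measurable fun i => mixDens κ' (b • x') τ (y.1 - a • x i) :=
    (measurable_mixDens (hx'.smul b) τ).comp ((h2.const_smul a).const_sub y.1)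
  have h3 : Measurable fun i => gDens σ (y.2 - a' • x i) :=
    (measurable_gDens σ).comp ((h2.const_smul a').const_sub y.2)
  exact h1.mul h3

lemma gaussBounds_pairMix (hx : IsCodebook κ x) (hx' : IsCodebook κ' x') (a b a' : ℂ) {τ σ : ℝ}
    (hτ : 0 < τ) (hσ : 0 < σ) :
    GaussBounds (fun y : CVec n × CVec n => nsq y.1 + nsq y.2)
      (fun (_ : Unit) => pairMix κ κ' x x' a b a' τ σ) :=
  (gaussBounds_pairDens hx hx' a b a' hτ hσ).integral
    (measurable_pairDens_right hx hx' a b a' τ σ)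

lemma lintegral_pairMix (hx : IsCodebook κ x) (hx' : IsCodebook κ' x') (a b a' : ℂ) {τ σ : ℝ}
    (hτ : 0 < τ) (hσ : 0 < σ)
    {F : (CVec n × CVec n) × CVec n → ENNReal} (hF : Measurable F) :
    ∫⁻ ω, F ((lf x x' a b (√τ : ℝ) 0 0 ω, lf x x' a' 0 0 (√σ : ℝ) 0 ω), ω.2.2.2.2)
        ∂chanMeas κ κ' n =
      ∫⁻ y, (∫⁻ w, F (y, w) ∂iidCN n) *
        ENNReal.ofReal (pairMix κ κ' x x' a b a' τ σ y) := by
  have hm := measurable_pairDens hx hx' a b a' τ σ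
  have hG : Measurable fun y => ∫⁻ w, F (y, w) ∂iidCN n := Measurable.lintegral_prod_right' hF
  rw [lintegral_pair hx hx' a b a' hτ hσ (F := fun q => F q.2) (by fun_prop),
    lintegral_lintegral_swap ((hG.comp measurable_snd).mul hm.ennreal_ofReal).aemeasurable]
  refine lintegral_congr fun y => ?_
  dsimp only
  rw [lintegral_const_mul _ (measurable_pairDens_right hx hx' a b a' τ σ y).ennreal_ofReal, pairMix,
    (gaussBounds_pairDens hx hx' a b a' hτ hσ).ofReal_integral
      (measurable_pairDens_right hx hx' a b a' τ σ)]

lemma integrable_log_pairMix (hx : IsCodebook κ x) (hx' : IsCodebook κ' x') (a b a' : ℂ)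
    {τ σ : ℝ} (hτ : 0 < τ) (hσ : 0 < σ) :
    Integrable (fun ω => Real.log (pairMix κ κ' x x' a b a' τ σ
      (lf x x' a b (√τ : ℝ) 0 0 ω, lf x x' a' 0 0 (√σ : ℝ) 0 ω))) (chanMeas κ κ' n) := by
  obtain ⟨C, hC⟩ := (gaussBounds_pairMix hx hx' a b a' hτ hσ).abs_log_le
    fun y => add_nonneg (nsq_nonneg _) (nsq_nonneg _)
  exact integrable_of_growth (measurable_pairMix hx hx' a b a' τ σ).log (hC ())
    ((measurable_lf hx.meas hx'.meas _ _ _ _ _).prodMk (measurable_lf hx.meas hx'.meas _ _ _ _ _))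
    ((integrable_nsq_lf hx hx' _ _ _ _ _).add (integrable_nsq_lf hx hx' _ _ _ _ _))

/-! ### Fano's inequality for the channel -/

/-- The probability that `dec` finds the message `i` from `x i + b x' + w`. -/
def correctProb (κ : Measure I) (κ' : Measure I') (x : I → CVec n) (x' : I' → CVec n) (b : ℂ)
    (dec : CVec n → I) : ℝ :=
  (κ.prod (κ'.prod (iidCN n))).real {q | dec (x q.1 + b • x' q.2.1 + q.2.2) = q.1}

lemma chanMeas_real_dec [MeasurableEq I] (hx : Measurable x)
    (hx' : Measurable x') {b u₁ u₂ u₃ : ℂ} (hu : ‖u₁‖ ^ 2 + ‖u₂‖ ^ 2 + ‖u₃‖ ^ 2 = 1)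
    {dec : CVec n → I} (hdec : Measurable dec) :
    (chanMeas κ κ' n).real {ω | dec (lf x x' 1 b u₁ u₂ u₃ ω) = ω.1} =
      correctProb κ κ' x x' b dec := by
  classical
  have hm := measurable_lf hx hx' 1 b u₁ u₂ u₃
  let F : I × I' × CVec n → ENNReal := {q | dec q.2.2 = q.1}.indicator 1
  have hF : Measurable F :=
    measurable_one.indicator (measurableSet_eq_fun
      (hdec.comp (measurable_snd.comp measurable_snd)) measurable_fst)
  have h := lintegral_lf (κ := κ) (κ' := κ') hx hx' 1 b u₁ u₂ u₃ hu hF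
  have hsω : MeasurableSet {ω : I × I' × CVec n × CVec n × CVec n |
      dec (lf x x' 1 b u₁ u₂ u₃ ω) = ω.1} :=
    measurableSet_eq_fun (hdec.comp hm) measurable_fst
  have e1 : ∫⁻ ω, F (ω.1, ω.2.1, lf x x' 1 b u₁ u₂ u₃ ω) ∂chanMeas κ κ' n =
      chanMeas κ κ' n {ω | dec (lf x x' 1 b u₁ u₂ u₃ ω) = ω.1} := by
    rw [← lintegral_indicator_one hsω]
    rfl
  have hs : MeasurableSet {q : I × I' × CVec n | dec (x q.1 + b • x' q.2.1 + q.2.2) = q.1} :=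
    measurableSet_eq_fun (by fun_prop) measurable_fst
  have e2 : ∫⁻ i, ∫⁻ i', ∫⁻ w, F (i, i', (1 : ℂ) • x i + b • x' i' + (√1 : ℝ) • w)
      ∂iidCN n ∂κ' ∂κ = (κ.prod (κ'.prod (iidCN n)))
        {q | dec (x q.1 + b • x' q.2.1 + q.2.2) = q.1} := by
    rw [← lintegral_indicator_one hs, lintegral_prod _ (measurable_one.indicator hs).aemeasurable]
    refine lintegral_congr fun i => ?_
    have h3 : Measurable fun q : I' × CVec n =>
        {q : I × I' × CVec n | dec (x q.1 + b • x' q.2.1 + q.2.2) = q.1}.indicator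
          (1 : I × I' × CVec n → ENNReal) (i, q) :=
      (measurable_one.indicator hs).comp measurable_prodMk_left
    rw [lintegral_prod _ h3.aemeasurable]
    refine lintegral_congr fun i' => lintegral_congr fun w => ?_
    rw [one_smul, Real.sqrt_one, one_smul]
    rfl
  rw [correctProb, Measure.real, Measure.real, ← e1, h, e2]

/-- I(X;Y) ≤ h(Y) - h(Y|X) without genie. Taking q Gaussian of variance P + ‖b‖²P' + 1 bounds h(Y)
by power alone; given the message, the density is the mixture over the interferer. -/
lemma fano_single {M M' : ℕ} (hM : 0 < M) {κ : Measure (Fin M)} [IsProbabilityMeasure κ]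
    (hκ : ∀ i, κ {i} = (M : ENNReal)⁻¹) {κ' : Measure (Fin M')} [IsProbabilityMeasure κ']
    {x : Fin M → CVec n} {x' : Fin M' → CVec n}
    (hx : IsCodebook κ x) (hx' : IsCodebook κ' x') (b : ℂ) {dec : CVec n → Fin M}
    (hdec : Measurable dec) {P P' : ℝ} (hP : 0 ≤ P) (hP' : 0 ≤ P')
    (hxP : ∫ i, nsq (x i) ∂κ ≤ n * P) (hxP' : ∫ i, nsq (x' i) ∂κ' ≤ n * P') :
    Real.log M * correctProb κ κ' x x' b dec - Real.log 2 ≤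
      negEnt κ' (b • x') 1 + n * (Real.log (Real.pi * (P + ‖b‖ ^ 2 * P' + 1)) + 1) := by
  set Q := P + ‖b‖ ^ 2 * P' + 1 with hQ
  have hQ0 : 0 < Q := by positivity
  have hm := measurable_lf hx.meas hx'.meas 1 b 1 0 0
  have hu : ‖(1 : ℂ)‖ ^ 2 + ‖(0 : ℂ)‖ ^ 2 + ‖(0 : ℂ)‖ ^ 2 = 1 := by simp
  have hbx := hx'.smul b
  have hmix := measurable_mixDens hbx 1
  have hxm := hx.meas
  have e0 : ∀ ω, lf x x' 1 b 1 0 0 ω - x ω.1 = lf x x' 0 b 1 0 0 ω := by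
    intro ω; ext j; simp [lf]; ring
  have hlogq : ∀ ω, Real.log (gDens Q (lf x x' 1 b 1 0 0 ω)) =
      -(n * Real.log (Real.pi * Q)) - Q⁻¹ * nsq (lf x x' 1 b 1 0 0 ω) := by
    intro ω; rw [log_gDens hQ0]; ring
  have hni := integrable_nsq_lf hx hx' 1 b 1 0 0
  have hf := fano (μ := chanMeas κ κ' n) (ν := (volume : Measure (CVec n))) hκ hM
    (m := fun ω => ω.1) (z := lf x x' 1 b 1 0 0) measurable_fst hm
    (k := fun i y => mixDens κ' (b • x') 1 (y - x i)) (by fun_prop)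
    (fun i y => mixDens_pos hbx one_pos _) (fun F hF => by
      rw [lintegral_lf hx.meas hx'.meas 1 b 1 0 0 hu (F := fun q => F (q.1, q.2.2)) (by fun_prop)]
      refine lintegral_congr fun i => ?_
      rw [← lintegral_mixture hbx one_pos (x i) (F := fun y => F (i, y)) (by fun_prop)]
      simp)
    (q := gDens Q) (measurable_gDens Q) (gDens_pos hQ0)
    (by have := lintegral_gDens hQ0 (0 : CVec n); simp only [sub_zero] at this; rw [this])
    hdec (by
      simp_rw [e0]
      exact integrable_log_mixDens_lf hbx hx hx' one_pos _ _ _ _ _)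
    (by
      simp_rw [hlogq]
      exact (integrable_const _).sub (hni.const_mul _))
  rw [chanMeas_real_dec hx.meas hx'.meas hu hdec] at hf
  simp_rw [e0, hlogq] at hf
  rw [integral_log_mixDens_lf_right hx.meas hx' b 1 0 0 hu,
    integral_sub (integrable_const _) (hni.const_mul _), integral_const_mul,
    integral_nsq_lf hx hx', hu] at hf
  have h1 : Q⁻¹ * (‖(1 : ℂ)‖ ^ 2 * ∫ i, nsq (x i) ∂κ + ‖b‖ ^ 2 * ∫ i, nsq (x' i) ∂κ' + n * 1)
      ≤ n := by
    rw [inv_mul_le_iff₀ hQ0]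
    have := mul_le_mul_of_nonneg_left hxP' (by positivity : 0 ≤ ‖b‖ ^ 2)
    rw [hQ]
    simp only [norm_one, one_pow, one_mul]
    linarith
  simp only [integral_const, probReal_univ, one_smul] at hf
  linarith

/-- The conditions `hac` and `hτσ` say that A + cB is the channel output with unit noise, so the
decoder can be run on the pair. Given the message, A and B are independent: A contributes the
entropy of b x' + √τ w, and B that of pure Gaussian noise, n(log(πσ) + 1). -/
lemma fano_pair {M M' : ℕ} (hM : 0 < M) {κ : Measure (Fin M)} [IsProbabilityMeasure κ]
    (hκ : ∀ i, κ {i} = (M : ENNReal)⁻¹) {κ' : Measure (Fin M')} [IsProbabilityMeasure κ']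
    {x : Fin M → CVec n} {x' : Fin M' → CVec n}
    (hx : IsCodebook κ x) (hx' : IsCodebook κ' x') (a b a' c : ℂ) {τ σ : ℝ} (hτ : 0 < τ)
    (hσ : 0 < σ) (hac : a + c * a' = 1) (hτσ : τ + ‖c‖ ^ 2 * σ = 1) {dec : CVec n → Fin M}
    (hdec : Measurable dec) :
    Real.log M * correctProb κ κ' x x' b dec - Real.log 2 ≤
      negEnt κ' (b • x') τ - n * (Real.log (Real.pi * σ) + 1)
        - pairNegEnt κ κ' x x' a b a' τ σ := by
  have m1 := measurable_lf hx.meas hx'.meas a b (√τ : ℝ) 0 0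
  have m2 := measurable_lf hx.meas hx'.meas a' 0 0 (√σ : ℝ) 0
  have hbx := hx'.smul b
  have hu : ‖((√τ : ℝ) : ℂ)‖ ^ 2 + ‖(0 : ℂ)‖ ^ 2 + ‖(0 : ℂ)‖ ^ 2 = τ := by
    rw [normSq_sqrt_cast hτ.le]; simp
  have hu' : ‖((√τ : ℝ) : ℂ)‖ ^ 2 + ‖c * ((√σ : ℝ) : ℂ)‖ ^ 2 + ‖(0 : ℂ)‖ ^ 2 = 1 := by
    rw [normSq_sqrt_cast hτ.le, norm_mul, mul_pow, normSq_sqrt_cast hσ.le]; simp [hτσ]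
  have e0 : ∀ ω, lf x x' a b (√τ : ℝ) 0 0 ω - a • x ω.1 = lf x x' 0 b (√τ : ℝ) 0 0 ω := by
    intro ω; ext j; simp [lf]; ring
  have e1 : ∀ ω, lf x x' a' 0 0 (√σ : ℝ) 0 ω - a' • x ω.1 = lf x x' 0 0 0 (√σ : ℝ) 0 ω := by
    intro ω; ext j; simp [lf]
  have e2 : ∀ ω, lf x x' a b (√τ : ℝ) 0 0 ω + c • lf x x' a' 0 0 (√σ : ℝ) 0 ω =
      lf x x' 1 b (√τ : ℝ) (c * (√σ : ℝ)) 0 ω := by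
    intro ω
    have := lf_comb (x := x) (x' := x') 1 c a b (√τ : ℝ) 0 0 a' 0 0 (√σ : ℝ) 0 ω
    rw [one_smul] at this
    rw [this]
    simp [hac]
  have hni := integrable_nsq_lf hx hx' 0 0 0 (√σ : ℝ) 0
  have i1 := integrable_log_mixDens_lf hbx hx hx' hτ 0 b (√τ : ℝ) 0 0
  have hlogk : ∀ ω, Real.log (pairDens κ' x x' a b a' τ σ ω.1
      (lf x x' a b (√τ : ℝ) 0 0 ω, lf x x' a' 0 0 (√σ : ℝ) 0 ω)) =
      Real.log (mixDens κ' (b • x') τ (lf x x' 0 b (√τ : ℝ) 0 0 ω)) +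
      (-(n * Real.log (Real.pi * σ)) - σ⁻¹ * nsq (lf x x' 0 0 0 (√σ : ℝ) 0 ω)) := by
    intro ω
    rw [pairDens, e0, e1, Real.log_mul (mixDens_pos hbx hτ _).ne' (gDens_pos hσ _).ne',
      log_gDens hσ]
    ring
  have i2 : Integrable (fun ω => -(n * Real.log (Real.pi * σ)) -
      σ⁻¹ * nsq (lf x x' 0 0 0 (√σ : ℝ) 0 ω)) (chanMeas κ κ' n) :=
    (integrable_const _).sub (hni.const_mul _)
  have hq1 : ∫⁻ y, ENNReal.ofReal (pairMix κ κ' x x' a b a' τ σ y) ≤ 1 := by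
    have := lintegral_pairMix hx hx' a b a' hτ hσ (F := fun _ => 1) measurable_const
    simp only [lintegral_const, measure_univ, mul_one, one_mul] at this
    exact this.symm.le
  have hf := fano (μ := chanMeas κ κ' n) (ν := (volume : Measure (CVec n × CVec n))) hκ hM
    (m := fun ω => ω.1)
    (z := fun ω => (lf x x' a b (√τ : ℝ) 0 0 ω, lf x x' a' 0 0 (√σ : ℝ) 0 ω)) measurable_fst
    (m1.prodMk m2) (k := pairDens κ' x x' a b a' τ σ) (measurable_pairDens hx hx' a b a' τ σ)
    (gaussBounds_pairDens hx hx' a b a' hτ hσ).pos (fun F hF => by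
      have := lintegral_pair hx hx' a b a' hτ hσ (F := fun q => F (q.1, q.2.1)) (by fun_prop)
      simpa using this)
    (q := pairMix κ κ' x x' a b a' τ σ) (measurable_pairMix hx hx' a b a' τ σ)
    ((gaussBounds_pairMix hx hx' a b a' hτ hσ).pos ()) hq1
    (dec := fun y => dec (y.1 + c • y.2)) (by fun_prop)
    (by simp_rw [hlogk]; exact i1.add i2) (integrable_log_pairMix hx hx' a b a' hτ hσ)
  simp_rw [e2, hlogk] at hf
  rw [chanMeas_real_dec hx.meas hx'.meas hu' hdec, integral_add i1 i2,
    integral_log_mixDens_lf_right hx.meas hx' b _ 0 0 hu,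
    integral_sub (integrable_const _) (hni.const_mul _), integral_const_mul,
    integral_nsq_lf hx hx'] at hf
  simp only [integral_const, probReal_univ, one_smul, norm_zero, normSq_sqrt_cast hσ.le] at hf
  have h3 : σ⁻¹ * ((0 : ℝ) ^ 2 * ∫ i, nsq (x i) ∂κ + 0 ^ 2 * ∫ i, nsq (x' i) ∂κ'
      + n * (0 ^ 2 + σ + 0 ^ 2)) = n := by
    field_simp; ring
  rw [h3] at hf
  rw [pairNegEnt]
  linarith

end Channel

/-! ### Worst additive noise for channel outputs. -/

section WorstNoise

variable {I I' : Type*} [MeasurableSpace I] [MeasurableSpace I'] {n : ℕ}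
  {κ : Measure I} [IsProbabilityMeasure κ] {κ' : Measure I'} [IsProbabilityMeasure κ']
  {x : I → CVec n} {x' : I' → CVec n}

/-- Unimodular changes of coordinates let the joint density of (A, B) be used unchanged as a density
in the coordinates (T, S) of `worst_noise`. -/
lemma measurePreserving_shear (e : ℂ) :
    MeasurePreserving (fun y : CVec n × CVec n => (y.1 + e • y.2, y.2)) volume
      (volume.prod volume) := by
  have h : MeasurePreserving (fun y : CVec n × CVec n => (y.1, e • y.1 + y.2))
      (volume.prod volume) (volume.prod volume) :=
    (MeasurePreserving.id volume).skew_product (g := fun y z => e • y + z) (by fun_prop)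
      (ae_of_all _ fun y => map_add_left_eq_self _ _)
  have h2 := (Measure.measurePreserving_swap (μ := (volume : Measure (CVec n)))
    (ν := (volume : Measure (CVec n)))).comp (h.comp (Measure.measurePreserving_swap
    (μ := (volume : Measure (CVec n))) (ν := (volume : Measure (CVec n)))))
  have e1 : (fun y : CVec n × CVec n => (y.1 + e • y.2, y.2)) =
      Prod.swap ∘ (fun y => (y.1, e • y.1 + y.2)) ∘ Prod.swap := by
    funext y; simp [add_comm]
  rw [Measure.volume_eq_prod, e1]
  exact h2

/-- The matrix has determinant e e' - (1 + e e') = -1; it factors as shear, swap, shear. -/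
lemma measurePreserving_swap_shear (e e' : ℂ) :
    MeasurePreserving (fun y : CVec n × CVec n =>
      (e • y.1 + (1 + e * e') • y.2, (1 : ℂ) • y.1 + e' • y.2)) volume (volume.prod volume) := by
  have h := (measurePreserving_shear (n := n) e).comp ((Measure.measurePreserving_swap
    (μ := (volume : Measure (CVec n))) (ν := (volume : Measure (CVec n)))).comp
    (measurePreserving_shear (n := n) e'))
  convert h using 1
  ext y j <;> simp; ring

/-- The worst additive noise inequality for `T = t₁ A + t₂ B`, `S = s₁ A + s₂ B`. -/
lemma worst_noise_pair (hx : IsCodebook κ x) (hx' : IsCodebook κ' x') (a b a' : ℂ) {τ σ : ℝ}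
    (hτ : 0 < τ) (hσ : 0 < σ) {t₁ t₂ s₁ s₂ : ℂ}
    (hTS : MeasurePreserving (fun y : CVec n × CVec n =>
      (t₁ • y.1 + t₂ • y.2, s₁ • y.1 + s₂ • y.2)) volume (volume.prod volume))
    (h c : ℂ) {v α P P' : ℝ} (hv : 0 ≤ v) (hα : 0 < α) (hα' : 0 < ‖h‖ ^ 2 * α + v)
    (hP : ∫ i, nsq (x i) ∂κ ≤ n * P) (hP' : ∫ i, nsq (x' i) ∂κ' ≤ n * P')
    (hT : ‖t₁ * a + t₂ * a'‖ ^ 2 * P + ‖t₁ * b‖ ^ 2 * P' + (‖t₁‖ ^ 2 * τ + ‖t₂‖ ^ 2 * σ) ≤ α)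
    {J J' : Type*} [MeasurableSpace J] [MeasurableSpace J'] {η : Measure J}
    [IsProbabilityMeasure η] {η' : Measure J'} [IsProbabilityMeasure η']
    {y : J → CVec n} {y' : J' → CVec n} (hy : IsCodebook η y) (hy' : IsCodebook η' y')
    {vf vr : ℝ} (hvf : 0 < vf) (hvr : 0 < vr) :
    ∫ ω, Real.log (mixDens η y vf (lf x x' ((h * t₁ + c * s₁) * a + (h * t₂ + c * s₂) * a')
        ((h * t₁ + c * s₁) * b) ((h * t₁ + c * s₁) * (√τ : ℝ)) ((h * t₂ + c * s₂) * (√σ : ℝ))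
        (√v : ℝ) ω)) ∂chanMeas κ κ' n
      + ∫ ω, Real.log (mixDens η' y' vr (lf x x' (s₁ * a + s₂ * a') (s₁ * b) (s₁ * (√τ : ℝ))
        (s₂ * (√σ : ℝ)) 0 ω)) ∂chanMeas κ κ' n
      - pairNegEnt κ κ' x x' a b a' τ σ ≤ n * Real.log (α / (‖h‖ ^ 2 * α + v)) := by
  have m1 := measurable_lf hx.meas hx'.meas a b (√τ : ℝ) 0 0
  have m2 := measurable_lf hx.meas hx'.meas a' 0 0 (√σ : ℝ) 0
  have eT : ∀ t₁ t₂ : ℂ, ∀ ω, t₁ • lf x x' a b (√τ : ℝ) 0 0 ω + t₂ • lf x x' a' 0 0 (√σ : ℝ) 0 ω =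
      lf x x' (t₁ * a + t₂ * a') (t₁ * b) (t₁ * (√τ : ℝ)) (t₂ * (√σ : ℝ)) 0 ω := by
    intro t₁ t₂ ω
    rw [lf_comb]
    simp
  have eN : ∀ t₁ t₂ : ℂ, ∀ ω, h • lf x x' (t₁ * a + t₂ * a') (t₁ * b) (t₁ * (√τ : ℝ))
      (t₂ * (√σ : ℝ)) 0 ω + (√v : ℝ) • ω.2.2.2.2 = lf x x' (h * (t₁ * a + t₂ * a'))
      (h * (t₁ * b)) (h * (t₁ * (√τ : ℝ))) (h * (t₂ * (√σ : ℝ))) (√v : ℝ) ω := by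
    intro t₁ t₂ ω
    ext j; simp [lf]; ring
  have eF : ∀ ω, lf x x' (h * (t₁ * a + t₂ * a'))
      (h * (t₁ * b)) (h * (t₁ * (√τ : ℝ))) (h * (t₂ * (√σ : ℝ))) (√v : ℝ) ω +
      c • lf x x' (s₁ * a + s₂ * a') (s₁ * b) (s₁ * (√τ : ℝ)) (s₂ * (√σ : ℝ)) 0 ω =
      lf x x' ((h * t₁ + c * s₁) * a + (h * t₂ + c * s₂) * a')
        ((h * t₁ + c * s₁) * b) ((h * t₁ + c * s₁) * (√τ : ℝ)) ((h * t₂ + c * s₂) * (√σ : ℝ))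
        (√v : ℝ) ω := by
    intro ω
    ext j; simp [lf]; ring
  have hw := worst_noise (μ := chanMeas κ κ' n) (ν := (volume : Measure (CVec n × CVec n)))
    (σ := (volume : Measure (CVec n)))
    (z := fun ω => (lf x x' a b (√τ : ℝ) 0 0 ω, lf x x' a' 0 0 (√σ : ℝ) 0 ω))
    (w := fun ω => ω.2.2.2.2) (m1.prodMk m2) (by fun_prop)
    (p := pairMix κ κ' x x' a b a' τ σ) (measurable_pairMix hx hx' a b a' τ σ)
    ((gaussBounds_pairMix hx hx' a b a' hτ hσ).pos ())
    (fun F hF => lintegral_pairMix hx hx' a b a' hτ hσ hF)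
    (T := fun y => t₁ • y.1 + t₂ • y.2) (S := fun y => s₁ • y.1 + s₂ • y.2) hTS
    (f := mixDens η y vf) (measurable_mixDens hy vf) (mixDens_pos hy hvf)
    (lintegral_mixDens hy hvf).le
    (r := mixDens η' y' vr) (measurable_mixDens hy' vr) (mixDens_pos hy' hvr)
    (lintegral_mixDens hy' hvr).le
    (c := fun s => c • s) (by fun_prop) (h := h) hv hα hα'
  simp only [eT, eN, eF] at hw
  have hT' : ‖t₁ * ((√τ : ℝ) : ℂ)‖ ^ 2 = ‖t₁‖ ^ 2 * τ := by
    rw [norm_mul, mul_pow, normSq_sqrt_cast hτ.le]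
  have hT'' : ‖t₂ * ((√σ : ℝ) : ℂ)‖ ^ 2 = ‖t₂‖ ^ 2 * σ := by
    rw [norm_mul, mul_pow, normSq_sqrt_cast hσ.le]
  refine hw (integrable_log_mixDens_lf hy hx hx' hvf _ _ _ _ _)
    (integrable_log_mixDens_lf hy' hx hx' hvr _ _ _ _ _)
    (integrable_log_pairMix hx hx' a b a' hτ hσ) (integrable_nsq_lf hx hx' _ _ _ _ _)
    (integrable_nsq_lf hx hx' _ _ _ _ _) ?_ ?_
  -- The second moment of T is increasing in the two powers, so the value at full power bounds it
  -- for every admissible codebook.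
  · rw [integral_nsq_lf hx hx', hT', hT'', norm_zero]
    have h1 := mul_le_mul_of_nonneg_left hP (by positivity : 0 ≤ ‖t₁ * a + t₂ * a'‖ ^ 2)
    have h2 := mul_le_mul_of_nonneg_left hP' (by positivity : 0 ≤ ‖t₁ * b‖ ^ 2)
    have h3 := mul_le_mul_of_nonneg_left hT (Nat.cast_nonneg (α := ℝ) n)
    linarith
  · rw [integral_nsq_lf hx hx', integral_nsq_lf hx hx', normSq_sqrt_cast hv]
    simp only [norm_mul, mul_pow, norm_zero]
    ring

/-- Additional Gaussian noise raises the entropy at least as much as for a Gaussian input of the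
same power. -/
lemma negEnt_sub_le (hx : IsCodebook κ x) {v v' a : ℝ} (hv : 0 < v) (hvv : v ≤ v') (ha : 0 ≤ a)
    (hP : ∫ i, nsq (x i) ∂κ ≤ n * a) :
    negEnt κ x v' - negEnt κ x v ≤ n * Real.log ((a + v) / (a + v')) := by
  -- The zero codebook with one word plays the silent second user; the side information S is trivial
  -- as well, with f the density at the larger noise and r = 1.
  have h0 : IsCodebook (Measure.dirac ()) (0 : Unit → CVec n) :=
    ⟨measurable_const, ⟨0, le_rfl, fun _ => by simp [nsq]⟩, fun j => by simp⟩
  have hxm := hx.meas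
  have m1 := measurable_lf (x' := (0 : Unit → CVec n)) hx.meas measurable_const 1 0 (√v : ℝ) 0 0
  have hv' : 0 < v' := hv.trans_le hvv
  have eN : ∀ ω, (1 : ℂ) • lf x (0 : Unit → CVec n) 1 0 (√v : ℝ) 0 0 ω +
      (√(v' - v) : ℝ) • ω.2.2.2.2 = lf x 0 1 0 (√v : ℝ) 0 (√(v' - v) : ℝ) ω := by
    intro ω
    ext j; simp [lf]; ring
  have e1 : ‖((√v : ℝ) : ℂ)‖ ^ 2 + ‖(0 : ℂ)‖ ^ 2 + ‖(0 : ℂ)‖ ^ 2 = v := by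
    rw [normSq_sqrt_cast hv.le]; simp
  have e2 : ‖((√v : ℝ) : ℂ)‖ ^ 2 + ‖(0 : ℂ)‖ ^ 2 + ‖((√(v' - v) : ℝ) : ℂ)‖ ^ 2 = v' := by
    rw [normSq_sqrt_cast hv.le, normSq_sqrt_cast (by linarith)]; simp
  have hTS : MeasurePreserving (fun y : CVec n => (y, ())) volume
      (volume.prod (Measure.dirac ())) := by
    refine ⟨by fun_prop, ?_⟩
    rw [Measure.prod_dirac]
  have hw := worst_noise (μ := chanMeas κ (Measure.dirac ()) n)
    (ν := (volume : Measure (CVec n))) (σ := Measure.dirac ())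
    (z := lf x (0 : Unit → CVec n) 1 0 (√v : ℝ) 0 0) (w := fun ω => ω.2.2.2.2) m1 (by fun_prop)
    (p := mixDens κ x v) (measurable_mixDens hx v) (mixDens_pos hx hv)
    (fun F hF => by
      have hG : Measurable fun y => ∫⁻ w, F (y, w) ∂iidCN n := Measurable.lintegral_prod_right' hF
      have := lintegral_mixture hx hv 0 hG
      simp only [sub_zero, zero_add] at this
      rw [← this, chanMeas, lintegral_prod _ (by fun_prop)]
      refine lintegral_congr fun i => ?_
      rw [lintegral_prod _ (by fun_prop), lintegral_dirac, lintegral_prod _ (by fun_prop)]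
      refine lintegral_congr fun w₁ => ?_
      rw [lintegral_prod _ (by fun_prop)]
      simp [lf])
    (T := fun y => y) (S := fun _ => ()) hTS
    (f := mixDens κ x v') (measurable_mixDens hx v') (mixDens_pos hx hv')
    (lintegral_mixDens hx hv').le
    (r := fun _ => 1) measurable_const (fun _ => one_pos) (by simp)
    (c := fun _ => 0) measurable_const (h := 1) (v := v' - v) (α := a + v) (by linarith)
    (by positivity) (by simp; linarith)
  simp only [eN, add_zero] at hw
  have key := hw (integrable_log_mixDens_lf hx hx h0 hv' _ _ _ _ _) (by simp)
    (integrable_log_mixDens_lf hx hx h0 hv _ _ _ _ _) (integrable_nsq_lf hx h0 _ _ _ _ _)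
    (integrable_nsq_lf hx h0 _ _ _ _ _)
    (by
      rw [integral_nsq_lf hx h0, e1]
      simp
      linarith)
    (by
      rw [integral_nsq_lf hx h0, integral_nsq_lf hx h0, e1, e2]
      simp
      ring)
  have k1 := integral_log_mixDens_lf_left (κ' := Measure.dirac ()) hx
    (x' := (0 : Unit → CVec n)) measurable_const 1 _ _ _ e1
  have k2 := integral_log_mixDens_lf_left (κ' := Measure.dirac ()) hx
    (x' := (0 : Unit → CVec n)) measurable_const 1 _ _ _ e2
  rw [one_smul] at k1 k2
  rw [k1, k2] at key
  simp only [Real.log_one, integral_zero, add_zero, norm_one, one_pow, one_mul] at key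
  rwa [show a + v + (v' - v) = a + v' by ring] at key

end WorstNoise

/-! ### The two genie-aided bounds -/

/-- The left side is the variance of Y₁ - cS₁ for Gaussian X₁ of power P and no interference, with
Z₁ = V_{N₁} + rN₁. As c is the regression coefficient, this is the conditional variance given S₁. -/
lemma genie_var₁ {P D σ : ℝ} {h ρ c r : ℂ} (hD0 : 0 < D) (hD : D = ‖h‖ ^ 2 * P + σ ^ 2)
    (hr : ρ = r * σ) (hc : c = (conj h * P + ρ * σ) / D) :
    ‖1 - c * h‖ ^ 2 * P + (1 - ‖ρ‖ ^ 2 + ‖r - c‖ ^ 2 * σ ^ 2) =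
      P + 1 - ‖conj h * P + ρ * σ‖ ^ 2 / D := by
  have hDc : (D : ℂ) ≠ 0 := by exact_mod_cast hD0.ne'
  have hn : conj h * P + ρ * σ = c * D := by rw [hc]; field_simp
  have hre := congrArg Complex.re hn
  have him := congrArg Complex.im hn
  have e1 : ‖conj h * P + ρ * σ‖ ^ 2 / D = ‖c‖ ^ 2 * D := by
    rw [hn, norm_mul, mul_pow, Complex.norm_real, Real.norm_eq_abs, sq_abs]
    field_simp
  rw [e1]
  rw [hr] at hre him ⊢
  simp only [← Complex.normSq_eq_norm_sq, Complex.normSq_apply] at hD ⊢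
  simp at hre him ⊢
  linear_combination (-2 * c.re) * hre + (-2 * c.im) * him + (-(c.re ^ 2 + c.im ^ 2)) * hD

/-- Two ways to compute the variance of Z₁ - gN₁ = V_{N₁} + (r - g)N₁. -/
lemma genie_noise₁ {σ : ℝ} {ρ g r : ℂ} (hr : ρ = r * σ) :
    1 - ‖ρ‖ ^ 2 + ‖r - g‖ ^ 2 * σ ^ 2 = 1 + ‖g‖ ^ 2 * σ ^ 2 - 2 * (conj g * ρ * σ).re := by
  rw [hr]
  simp only [← Complex.normSq_eq_norm_sq, Complex.normSq_apply]
  simp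
  ring

/-- The same for Y₂ - cU₂ with X₂ removed. With W₂ = V_{W₂} + c'(Z₂ - W₂), the noise is (1 -
c)V_{W₂} + (1 + (1 - c)c')(Z₂ - W₂), a sum of independent terms of variances τ and β before scaling.
-/
lemma genie_var₂ {D a β τ σ : ℝ} {ρ c c' : ℂ} (hD0 : 0 < D) (hD : D = a + σ ^ 2)
    (hβ : β = 1 + σ ^ 2 - 2 * (ρ * σ).re) (hc' : c' * β = conj ρ * σ - (σ : ℂ) ^ 2)
    (hτ : τ + ‖c'‖ ^ 2 * β = σ ^ 2) (hc : c = (((a : ℝ) : ℂ) + ρ * σ) / D) :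
    ‖1 - c‖ ^ 2 * a + (‖1 - c‖ ^ 2 * τ + ‖1 + (1 - c) * c'‖ ^ 2 * β) =
      a + 1 - ‖((a : ℝ) : ℂ) + ρ * σ‖ ^ 2 / D := by
  have hDc : (D : ℂ) ≠ 0 := by exact_mod_cast hD0.ne'
  have hn : ((a : ℝ) : ℂ) + ρ * σ = c * D := by rw [hc]; field_simp
  have hre := congrArg Complex.re hn
  have him := congrArg Complex.im hn
  have hre' := congrArg Complex.re hc'
  have him' := congrArg Complex.im hc'
  have e1 : ‖((a : ℝ) : ℂ) + ρ * σ‖ ^ 2 / D = ‖c‖ ^ 2 * D := by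
    rw [hn, norm_mul, mul_pow, Complex.norm_real, Real.norm_eq_abs, sq_abs]
    field_simp
  rw [e1]
  have hτ' : τ = σ ^ 2 - ‖c'‖ ^ 2 * β := by linarith
  rw [hτ']
  simp only [← Complex.normSq_eq_norm_sq, Complex.normSq_apply] at hD ⊢
  simp [pow_two] at hre him hre' him' hβ ⊢
  have h1 : ((1 - c.re) * (1 - c.re) + c.im * c.im) * a +
      (((1 - c.re) * (1 - c.re) + c.im * c.im) * (σ * σ
        - (c'.re * c'.re + c'.im * c'.im) * β) +
      ((1 + ((1 - c.re) * c'.re + c.im * c'.im)) * (1 + ((1 - c.re) * c'.re + c.im * c'.im)) +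
        ((1 - c.re) * c'.im - c.im * c'.re) * ((1 - c.re) * c'.im - c.im * c'.re)) * β) =
      ((1 - c.re) * (1 - c.re) + c.im * c.im) * D + β + 2 * ((1 - c.re) * (c'.re * β)
        + c.im * (c'.im * β)) := by
    rw [hD]; ring
  have h2 : ((1 - c.re) * (1 - c.re) + c.im * c.im) * D + β + 2 * ((1 - c.re) * (c'.re * β)
        + c.im * (c'.im * β)) = a + 1 - (c.re * c.re + c.im * c.im) * D := by
    rw [hre', him']
    linear_combination hD + hβ + (-2 * c.re) * (hre) + (-2 * c.im) * him + (-2*c.re) * hD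
  rw [← h2, ← h1]
  ring

section Genie

variable {n M M' : ℕ} {κ : Measure (Fin M)} [IsProbabilityMeasure κ] {κ' : Measure (Fin M')}
  [IsProbabilityMeasure κ'] {x : Fin M → CVec n} {x' : Fin M' → CVec n}

/-- User 1 with the Etkin-type genie signal. -/
lemma etkin_genie_bound (hM : 0 < M) (hκ : ∀ i, κ {i} = (M : ENNReal)⁻¹)
    (hx : IsCodebook κ x) (hx' : IsCodebook κ' x') {P P' : ℝ} (hP0 : 0 < P) (hP0' : 0 < P')
    (hP : ∫ i, nsq (x i) ∂κ ≤ n * P) (hP' : ∫ i, nsq (x' i) ∂κ' ≤ n * P')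
    {dec : CVec n → Fin M} (hdec : Measurable dec) (b : ℂ) {h ρ : ℂ} (hh : h ≠ 0) {σ v α : ℝ}
    (hσ : 0 < σ) (hρ : 0 < 1 - ‖ρ‖ ^ 2) (hv : 0 ≤ v)
    (hv' : 1 + ‖h⁻¹‖ ^ 2 * σ ^ 2 - 2 * (conj h⁻¹ * ρ * σ).re + v = 1)
    (hα : α = P + ‖b‖ ^ 2 * P' + 1 - ‖conj h * P + ρ * σ‖ ^ 2 / (‖h‖ ^ 2 * P + σ ^ 2)) :
    Real.log M * correctProb κ κ' x x' b dec - Real.log 2 ≤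
      negEnt κ' (b • x') (1 - ‖ρ‖ ^ 2) - negEnt κ' (b • x') 1 - negEnt κ (h • x) (σ ^ 2)
        - n * (Real.log (Real.pi * σ ^ 2) + 1) + n * Real.log (α / (α + v)) := by
  have hσc : (σ : ℂ) ≠ 0 := by exact_mod_cast hσ.ne'
  have hσ2 : 0 < σ ^ 2 := by positivity
  -- r is the regression coefficient of Z₁ on N₁, and c below is that of Y₁ on S₁.
  obtain ⟨r, hr⟩ : ∃ r : ℂ, ρ = r * σ := ⟨ρ / σ, by field_simp⟩
  set D := ‖h‖ ^ 2 * P + σ ^ 2 with hD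
  have hD0 : 0 < D := by positivity
  set c := (conj h * P + ρ * σ) / (D : ℂ) with hc
  have hvar := genie_var₁ hD0 hD hr hc
  have hnoise := genie_noise₁ (g := h⁻¹) hr
  have hr2 : ‖r‖ ^ 2 * σ ^ 2 = ‖ρ‖ ^ 2 := by
    rw [hr, norm_mul, mul_pow, Complex.norm_real, Real.norm_eq_abs, sq_abs]
  have hα0 : 0 < α := by
    have : 0 < ‖1 - c * h‖ ^ 2 * P + (1 - ‖ρ‖ ^ 2 + ‖r - c‖ ^ 2 * σ ^ 2) := by positivity
    have h2 : 0 ≤ ‖b‖ ^ 2 * P' := by positivity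
    rw [hα]; linarith
  -- The pair is A = Y₁ - rS₁, whose noise is V_{N₁}, and B = S₁. The noises are independent, and Y₁
  -- = A + rB.
  have hf := fano_pair hM hκ hx hx' (1 - r * h) b h r hρ hσ2 (by ring) (by linarith) hdec
  have hTS : MeasurePreserving (fun y : CVec n × CVec n =>
      ((1 : ℂ) • y.1 + (r - c) • y.2, (0 : ℂ) • y.1 + (1 : ℂ) • y.2)) volume
      (volume.prod volume) := by
    simpa using measurePreserving_shear (n := n) (r - c)
  have e0 : ‖(1 : ℂ) * (1 - r * h) + (r - c) * h‖ = ‖1 - c * h‖ := by congr 1; ring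
  -- Here T = Y₁ - cS₁ and S = S₁. The argument of f is T + Z̃₁ + (c - h⁻¹)S = Y₁ + Z̃₁ - h⁻¹S₁,
  -- which no longer contains X₁ and has noise of total variance 1 by `hv'`.
  have hw := worst_noise_pair hx hx' (1 - r * h) b h hρ hσ2 hTS 1 (c - h⁻¹) hv hα0
    (by simp; linarith) hP hP'
    (by rw [e0]; simp only [one_mul, norm_one, one_pow]; linarith)
    (hx'.smul b) (hx.smul h) one_pos hσ2
  have e1 : ((1 : ℂ) * 1 + (c - h⁻¹) * 0) * (1 - r * h) + (1 * (r - c) + (c - h⁻¹) * 1) * h = 0 := by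
    field_simp; ring
  have e2 : ((1 : ℂ) * 1 + (c - h⁻¹) * 0) = 1 := by ring
  have e3 : ((1 : ℂ) * (r - c) + (c - h⁻¹) * 1) = r - h⁻¹ := by ring
  rw [e1, e2, e3] at hw
  simp only [one_mul, zero_mul, zero_add] at hw
  rw [integral_log_mixDens_lf_right hx.meas hx' b _ _ _ (v := 1) (by
      rw [norm_mul, mul_pow, normSq_sqrt_cast hρ.le, normSq_sqrt_cast hσ2.le, normSq_sqrt_cast hv]
      linarith),
    integral_log_mixDens_lf_left hx hx'.meas h _ _ _ (v := σ ^ 2) (by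
      rw [normSq_sqrt_cast hσ2.le]; simp), norm_one, one_pow, one_mul] at hw
  linarith

/-- User 2 with the change-of-interference genie signal; `x'` are the codewords of user 1. -/
lemma interference_genie_bound (hM : 0 < M) (hκ : ∀ i, κ {i} = (M : ENNReal)⁻¹)
    (hx : IsCodebook κ x) (hx' : IsCodebook κ' x') {P P' : ℝ} (hP0 : 0 < P) (hP0' : 0 < P')
    (hP : ∫ i, nsq (x i) ∂κ ≤ n * P) (hP' : ∫ i, nsq (x' i) ∂κ' ≤ n * P')
    {dec : CVec n → Fin M} (hdec : Measurable dec) (g h : ℂ) {ρ : ℂ} {σ β τ v α : ℝ}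
    (hσ : 0 < σ) (hβ : β = 1 + σ ^ 2 - 2 * (ρ * σ).re) (hβ0 : 0 < β)
    (hτ : τ = σ ^ 2 * (1 - ‖ρ‖ ^ 2) / β) (hτ0 : 0 < τ) (hv : 0 < v) (hgv : ‖g‖ ^ 2 * β ≤ v)
    (hα : α = P + ‖h‖ ^ 2 * P' + 1 - ‖((‖h‖ ^ 2 * P' : ℝ) : ℂ) + ρ * σ‖ ^ 2 /
      (‖h‖ ^ 2 * P' + σ ^ 2)) :
    Real.log M * correctProb κ κ' x x' h dec - Real.log 2 ≤
      negEnt κ' (h • x') τ - negEnt κ' (h • x') (σ ^ 2) - negEnt κ (g • x) v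
        - n * (Real.log (Real.pi * β) + 1)
        + n * Real.log (α / (‖g‖ ^ 2 * α + (v - ‖g‖ ^ 2 * β))) := by
  have hσ2 : 0 < σ ^ 2 := by positivity
  have hβc : (β : ℂ) ≠ 0 := by exact_mod_cast hβ0.ne'
  -- c' is the regression coefficient of W₂ on Z₂ - W₂.
  obtain ⟨c', hc'⟩ : ∃ c' : ℂ, c' * β = conj ρ * σ - (σ : ℂ) ^ 2 :=
    ⟨(conj ρ * σ - (σ : ℂ) ^ 2) / β, by field_simp⟩
  have hτβ : τ * β = σ ^ 2 * (1 - ‖ρ‖ ^ 2) := by rw [hτ]; field_simp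
  have hcn : ‖c'‖ ^ 2 * β ^ 2 = ‖conj ρ * σ - (σ : ℂ) ^ 2‖ ^ 2 := by
    rw [← hc', norm_mul, mul_pow, Complex.norm_real, Real.norm_eq_abs, sq_abs]
  have hcn' : ‖1 + c'‖ ^ 2 * β ^ 2 = ‖1 - ρ * σ‖ ^ 2 := by
    have : (1 + c') * β = 1 - ρ * σ := by
      rw [add_mul, hc', hβ]
      apply Complex.ext <;> simp [pow_two] <;> ring
    rw [← this, norm_mul, mul_pow, Complex.norm_real, Real.norm_eq_abs, sq_abs]
  have hn1 : τ + ‖c'‖ ^ 2 * β = σ ^ 2 := by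
    refine mul_right_cancel₀ hβ0.ne' ?_
    have : ‖conj ρ * σ - (σ : ℂ) ^ 2‖ ^ 2 = σ ^ 2 * (‖ρ‖ ^ 2 + σ ^ 2 - 2 * (ρ * σ).re) := by
      simp only [← Complex.normSq_eq_norm_sq, Complex.normSq_apply]; simp [pow_two]; ring
    rw [add_mul, hτβ, mul_assoc, ← pow_two, hcn, this, hβ]; ring
  have hn2 : τ + ‖1 + c'‖ ^ 2 * β = 1 := by
    refine mul_right_cancel₀ hβ0.ne' ?_
    have : ‖1 - ρ * σ‖ ^ 2 = 1 + σ ^ 2 * ‖ρ‖ ^ 2 - 2 * (ρ * σ).re := by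
      simp only [← Complex.normSq_eq_norm_sq, Complex.normSq_apply]; simp; ring
    rw [add_mul, hτβ, mul_assoc, ← pow_two, hcn', this, hβ]; ring
  set a := ‖h‖ ^ 2 * P' with ha
  have ha0 : 0 ≤ a := by positivity
  have hD0 : 0 < a + σ ^ 2 := by positivity
  obtain ⟨c, hc⟩ : ∃ c : ℂ, c = (((a : ℝ) : ℂ) + ρ * σ) / ((a + σ ^ 2 : ℝ) : ℂ) := ⟨_, rfl⟩
  have hvar := genie_var₂ hD0 rfl hβ hc' hn1 hc
  have hα0 : 0 < α := by
    have : 0 ≤ ‖1 - c‖ ^ 2 * a + (‖1 - c‖ ^ 2 * τ + ‖1 + (1 - c) * c'‖ ^ 2 * β) := by positivity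
    rw [hα]; linarith
  -- If g = 0 nothing of T survives, and positivity comes from v instead.
  have hα0' : 0 < ‖g‖ ^ 2 * α + (v - ‖g‖ ^ 2 * β) := by
    by_cases hg : g = 0
    · simpa [hg] using hv
    · have : 0 < ‖g‖ := norm_pos_iff.2 hg
      have : 0 < ‖g‖ ^ 2 * α := by positivity
      linarith
  -- The pair is B = X₂ + (Z₂ - W₂) = Y₂ - U₂ and A = U₂ - c'B, whose noise is V_{W₂}. The noises
  -- are independent, and Y₂ = A + (1 + c')B.
  have hf := fano_pair hM hκ hx hx' (-c') h 1 (1 + c') hτ0 hβ0 (by ring) hn2 hdec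
  -- Here S = A + c'B = U₂ and T = Y₂ - cU₂. The argument of f is gT - g(1 - c)S + Ṽ = g(Y₂ - U₂) +
  -- Ṽ, so the signal of the other user drops out and the noise variance is ‖g‖²β + (v - ‖g‖²β) = v.
  have hw := worst_noise_pair hx hx' (-c') h 1 hτ0 hβ0 (measurePreserving_swap_shear (1 - c) c')
    g (-(g * (1 - c))) (by linarith) hα0 hα0' hP hP' (by
      have e1 : (1 - c) * -c' + (1 + (1 - c) * c') * 1 = 1 := by ring
      rw [e1, norm_one, one_pow, norm_mul, mul_pow, mul_assoc, ← ha]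
      linarith)
    (hx.smul g) (hx'.smul h) hv hσ2
  have e1 : (g * (1 - c) + -(g * (1 - c)) * 1) = 0 := by ring
  have e2 : (g * (1 + (1 - c) * c') + -(g * (1 - c)) * c') = g := by ring
  have e3 : 1 * -c' + c' * 1 = 0 := by ring
  rw [e1, e2, e3] at hw
  simp only [one_mul, zero_mul, zero_add, mul_one] at hw
  rw [integral_log_mixDens_lf_left hx hx'.meas g _ _ _ (v := v) (by
      rw [norm_mul, mul_pow, normSq_sqrt_cast hβ0.le, normSq_sqrt_cast (by linarith), norm_zero]
      ring),
    integral_log_mixDens_lf_right hx.meas hx' h _ _ _ (v := σ ^ 2) (by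
      rw [norm_mul, mul_pow, normSq_sqrt_cast hτ0.le, normSq_sqrt_cast hβ0.le, norm_zero]
      linarith)] at hw
  linarith

end Genie

/-! ### The sum-rate bound at finite block length. -/

namespace GIC

variable (G : GIC) {κ : GenieParams}

lemma two_log_two_mul_logBound : 2 * Real.log 2 * G.logBound κ =
    Real.log ((G.P₁ + ‖G.h₁₂‖ ^ 2 * G.P₂ + 1
          - ‖conj G.h₂₁ * G.P₁ + κ.ρN₁ * κ.σN₁‖ ^ 2 / (‖G.h₂₁‖ ^ 2 * G.P₁ + κ.σN₁ ^ 2)) /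
        (‖G.h₁₂‖ ^ 2 * G.P₂ + 1
          - ‖κ.ρN₁ * κ.σN₁ - G.h₂₁⁻¹ * (κ.σN₁ : ℂ) ^ 2‖ ^ 2 /
              (‖G.h₂₁‖ ^ 2 * G.P₁ + κ.σN₁ ^ 2)))
    + Real.log ((G.P₂ + ‖G.h₂₁‖ ^ 2 * G.P₁ + 1
          - ‖((‖G.h₂₁‖ ^ 2 * G.P₁ : ℝ) : ℂ) + κ.ρW₂ * κ.σW₂‖ ^ 2 /
              (‖G.h₂₁‖ ^ 2 * G.P₁ + κ.σW₂ ^ 2)) /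
        (‖G.h₁₂‖ ^ 2 * G.P₂ + varVN₁ κ
          - ‖G.h₁₂ * κ.ρW₂ * κ.σW₂ - G.h₁₂ * (κ.σW₂ : ℂ) ^ 2‖ ^ 2 /
              (‖G.h₂₁‖ ^ 2 * G.P₁ + κ.σW₂ ^ 2)))
    + (Real.log ((‖G.h₂₁‖ ^ 2 * G.P₁ + κ.σN₁ ^ 2) / (‖G.h₂₁‖ ^ 2 * G.P₁ + varVW₂ κ))
      + Real.log ((‖G.h₂₁‖ ^ 2 * G.P₁ + κ.σW₂ ^ 2) / (‖G.h₂₁‖ ^ 2 * G.P₁ + 1))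
      + Real.log ((G.P₁ + ‖G.h₁₂‖ ^ 2 * G.P₂ + 1) / κ.σN₁ ^ 2)
      + Real.log ((G.P₂ + ‖G.h₂₁‖ ^ 2 * G.P₁ + 1) /
        (1 + κ.σW₂ ^ 2 - 2 * (κ.ρW₂ * κ.σW₂).re))) := by
  have h2 : Real.log 2 ≠ 0 := (Real.log_pos one_lt_two).ne'
  simp only [logBound, R₀Log, Real.logb]
  field_simp

/-- The sum-rate bound at finite block length. -/
lemma sum_log_le (hP₁ : 0 < G.P₁) (hP₂ : 0 < G.P₂) (hκ : κ.InRange) (had : G.Admissible κ)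
    (hVW : 0 < varVW₂ κ) {n M₁ M₂ : ℕ} (hM₁ : 0 < M₁) (hM₂ : 0 < M₂)
    {μ₁ : Measure (Fin M₁)} [IsProbabilityMeasure μ₁] {μ₂ : Measure (Fin M₂)}
    [IsProbabilityMeasure μ₂] (hμ₁ : ∀ i, μ₁ {i} = (M₁ : ENNReal)⁻¹)
    (hμ₂ : ∀ i, μ₂ {i} = (M₂ : ENNReal)⁻¹) {x₁ : Fin M₁ → CVec n} {x₂ : Fin M₂ → CVec n}
    (hx₁ : IsCodebook μ₁ x₁) (hx₂ : IsCodebook μ₂ x₂)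
    (hxP₁ : ∫ i, nsq (x₁ i) ∂μ₁ ≤ n * G.P₁) (hxP₂ : ∫ i, nsq (x₂ i) ∂μ₂ ≤ n * G.P₂)
    {dec₁ : CVec n → Fin M₁} {dec₂ : CVec n → Fin M₂} (hdec₁ : Measurable dec₁)
    (hdec₂ : Measurable dec₂) :
    Real.log M₁ * correctProb μ₁ μ₂ x₁ x₂ G.h₁₂ dec₁
      + Real.log M₂ * correctProb μ₂ μ₁ x₂ x₁ G.h₂₁ dec₂ ≤
      Real.log 2 * (n * G.logBound κ + 2) := by
  obtain ⟨⟨-, hσN1⟩, -, -, ⟨hσW0, hσW1⟩, hρN, -, -, hρW⟩ := id hκ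
  obtain ⟨hmin, hint, hZ, hh, hVN, hσ, hβ⟩ := id had
  have hh' : 0 < ‖G.h₂₁‖ := norm_pos_iff.2 hh
  have eVN := varVN₁_eq hσ hρN
  have eβ := varZ₂subW₂_eq (κ := κ) hρW
  have eVW := varVW₂_eq hρW hβ
  have eZ := G.varZ₁subN₁_eq hρN
  have hσW : 0 < κ.σW₂ := by
    rcases hσW0.lt_or_eq with h | h
    · exact h
    · rw [eVW, ← h] at hVW; simp at hVW
  have hσN2 : 0 < κ.σN₁ ^ 2 := by positivity
  have hσW2 : 0 < κ.σW₂ ^ 2 := by positivity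
  -- Each user contributes two inequalities. Their sum bounds twice the left side and carries 4 log
  -- 2, which becomes the constant 2 after halving.
  have f1 := fano_single hM₁ hμ₁ hx₁ hx₂ G.h₁₂ hdec₁ hP₁.le hP₂.le hxP₁ hxP₂
  have f2 := fano_single hM₂ hμ₂ hx₂ hx₁ G.h₂₁ hdec₂ hP₂.le hP₁.le hxP₂ hxP₁
  have g1 := etkin_genie_bound hM₁ hμ₁ hx₁ hx₂ hP₁ hP₂ hxP₁ hxP₂ hdec₁ G.h₁₂ hh hσ
    (by rw [← eVN]; exact hVN) (v := 1 - G.varZ₁subN₁ κ) (by linarith) (by rw [eZ]; ring) rfl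
  have g2 := interference_genie_bound hM₂ hμ₂ hx₂ hx₁ hP₂ hP₁ hxP₂ hxP₁ hdec₂ G.h₁₂ G.h₂₁ hσW
    eβ hβ eVW hVW hVN hint rfl
  rw [← eVN] at g1
  set a := ‖G.h₂₁‖ ^ 2 * G.P₁ with ha
  have ha0 : 0 < a := by positivity
  have ax₁ : ∫ i, nsq ((G.h₂₁ • x₁) i) ∂μ₁ ≤ n * a := by
    simp only [Pi.smul_apply, nsq_smul_complex, integral_const_mul]
    have := mul_le_mul_of_nonneg_left hxP₁ (by positivity : 0 ≤ ‖G.h₂₁‖ ^ 2)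
    rw [ha]; linarith
  -- The four entropies of h₂₁X₁ plus noise that survive the cancellation.
  have w1 : negEnt μ₁ (G.h₂₁ • x₁) (varVW₂ κ) - negEnt μ₁ (G.h₂₁ • x₁) (κ.σN₁ ^ 2)
      + negEnt μ₁ (G.h₂₁ • x₁) 1 - negEnt μ₁ (G.h₂₁ • x₁) (κ.σW₂ ^ 2) ≤
      n * (Real.log ((a + κ.σN₁ ^ 2) / (a + varVW₂ κ))
        + Real.log ((a + κ.σW₂ ^ 2) / (a + 1))) := by
    have l : ∀ u v : ℝ, 0 < u → 0 < v → Real.log ((a + u) / (a + v)) =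
        Real.log (a + u) - Real.log (a + v) := fun u v hu hv =>
      Real.log_div (by positivity) (by positivity)
    have hs := hx₁.smul G.h₂₁
    -- The noise variance realising the minimum is paired with σ²_{V_{W₂}}, the other with 1; both
    -- pairings have the same sum of Gaussian bounds.
    rcases min_le_iff.1 hmin with h | h
    · have k1 := negEnt_sub_le hs hσN2 h ha0.le ax₁
      have k2 := negEnt_sub_le hs hσW2 (pow_le_one₀ hσW0 hσW1) ha0.le ax₁
      linarith
    · have k1 := negEnt_sub_le hs hσW2 h ha0.le ax₁
      have k2 := negEnt_sub_le hs hσN2 (pow_le_one₀ hσ.le hσN1) ha0.le ax₁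
      rw [l _ _ hσW2 hVW] at k1
      rw [l _ _ hσN2 one_pos] at k2
      rw [l _ _ hσN2 hVW, l _ _ hσW2 one_pos]
      linarith
  have r1 := regression_var₁ (X := ‖G.h₁₂‖ ^ 2 * G.P₂) hh rfl (by positivity) eZ (P := G.P₁)
  have r2 := regression_var₂ (P := G.P₂) (Y := varVN₁ κ) (g := G.h₁₂) (a := a) rfl
    (by positivity) eβ
  have hb := G.two_log_two_mul_logBound (κ := κ)
  rw [← ha] at r1 hb
  -- The Gaussian conditional variances after adding noise, from the two genie bounds, are the
  -- denominators of the closed form.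
  have d1 : G.P₁ + ‖G.h₁₂‖ ^ 2 * G.P₂ + 1 -
      ‖conj G.h₂₁ * G.P₁ + κ.ρN₁ * κ.σN₁‖ ^ 2 / (a + κ.σN₁ ^ 2) + (1 - G.varZ₁subN₁ κ) =
      ‖G.h₁₂‖ ^ 2 * G.P₂ + 1 - ‖κ.ρN₁ * κ.σN₁ - G.h₂₁⁻¹ * (κ.σN₁ : ℂ) ^ 2‖ ^ 2 /
        (a + κ.σN₁ ^ 2) := by rw [← r1]; ring
  have d2 : ‖G.h₁₂‖ ^ 2 * (G.P₂ + a + 1 - ‖(a : ℂ) + κ.ρW₂ * κ.σW₂‖ ^ 2 / (a + κ.σW₂ ^ 2))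
      + (varVN₁ κ - ‖G.h₁₂‖ ^ 2 * varZ₂subW₂ κ) =
      ‖G.h₁₂‖ ^ 2 * G.P₂ + varVN₁ κ - ‖G.h₁₂ * κ.ρW₂ * κ.σW₂ - G.h₁₂ * (κ.σW₂ : ℂ) ^ 2‖ ^ 2 /
        (a + κ.σW₂ ^ 2) := by
    rw [← r2, norm_mul, mul_pow]; ring
  rw [d1] at g1
  rw [d2] at g2
  have hπ := Real.pi_pos
  have q1 : 0 < G.P₁ + ‖G.h₁₂‖ ^ 2 * G.P₂ + 1 := by positivity
  have q2 : 0 < G.P₂ + a + 1 := by positivity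
  rw [← eβ, Real.log_div q1.ne' hσN2.ne', Real.log_div q2.ne' hβ.ne'] at hb
  rw [Real.log_mul hπ.ne' q1.ne'] at f1
  rw [Real.log_mul hπ.ne' q2.ne'] at f2
  rw [Real.log_mul hπ.ne' hσN2.ne'] at g1
  rw [Real.log_mul hπ.ne' hβ.ne'] at g2
  have hb' := congrArg (fun t => (n : ℝ) * t) hb
  simp only [mul_add, mul_sub] at hb' w1 f1 f2 g1 g2 ⊢
  linarith

end GIC

/-! ### Codes -/

/-- The uniform law on `M` messages. -/
def unif (M : ℕ) : Measure (Fin M) := (M : ENNReal)⁻¹ • Measure.count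

lemma unif_singleton {M : ℕ} (i : Fin M) : unif M {i} = (M : ENNReal)⁻¹ := by
  simp [unif]

lemma isProbabilityMeasure_unif {M : ℕ} (hM : 0 < M) : IsProbabilityMeasure (unif M) := by
  refine ⟨?_⟩
  have h : (M : ENNReal) ≠ 0 := by exact_mod_cast hM.ne'
  simp [unif, ENNReal.inv_mul_cancel h]

lemma integral_unif {M : ℕ} (f : Fin M → ℝ) : ∫ i, f i ∂unif M = (∑ i, f i) / M := by
  rw [unif, integral_smul_measure, integral_count]
  simp [div_eq_inv_mul]

lemma correctProb_unif {M M' n : ℕ} (hM : 0 < M) (hM' : 0 < M') (x : Fin M → CVec n)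
    (x' : Fin M' → CVec n) (b : ℂ) {dec : CVec n → Fin M} (hdec : Measurable dec) :
    correctProb (unif M) (unif M') x x' b dec =
      1 - (∑ i, ∑ i', (iidCN n).real {w | dec (x i + b • x' i' + w) ≠ i}) / (M * M') := by
  have := isProbabilityMeasure_unif hM
  have := isProbabilityMeasure_unif hM'
  have hx : Measurable x := measurable_of_finite x
  have hx' : Measurable x' := measurable_of_finite x'
  have hs : MeasurableSet {q : Fin M × Fin M' × CVec n |
      dec (x q.1 + b • x' q.2.1 + q.2.2) = q.1} :=
    measurableSet_eq_fun (by fun_prop) measurable_fst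
  have hs1 : ∀ i i', MeasurableSet {w : CVec n | dec (x i + b • x' i' + w) ≠ i} := fun i i' =>
    ((measurableSet_singleton i).preimage (hdec.comp (measurable_id.const_add _))).compl
  have hint : Integrable ({q : Fin M × Fin M' × CVec n |
      dec (x q.1 + b • x' q.2.1 + q.2.2) = q.1}.indicator (1 : Fin M × Fin M' × CVec n → ℝ))
      ((unif M).prod ((unif M').prod (iidCN n))) := (integrable_const 1).indicator hs
  have hM0 : (M : ℝ) ≠ 0 := by exact_mod_cast hM.ne'
  have hM0' : (M' : ℝ) ≠ 0 := by exact_mod_cast hM'.ne'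
  have hint' : ∀ i, Integrable (fun q : Fin M' × CVec n => {q : Fin M × Fin M' × CVec n |
      dec (x q.1 + b • x' q.2.1 + q.2.2) = q.1}.indicator (1 : Fin M × Fin M' × CVec n → ℝ) (i, q))
      ((unif M').prod (iidCN n)) := fun i =>
    (integrable_const 1).indicator (s := {q : Fin M' × CVec n | dec (x i + b • x' q.1 + q.2) = i})
      (hs.preimage measurable_prodMk_left)
  rw [correctProb, ← integral_indicator_one hs, integral_prod _ hint, integral_unif]
  have h1 : ∀ i, ∫ q, {q : Fin M × Fin M' × CVec n |
      dec (x q.1 + b • x' q.2.1 + q.2.2) = q.1}.indicator (1 : Fin M × Fin M' × CVec n → ℝ) (i, q)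
      ∂((unif M').prod (iidCN n)) =
      1 - (∑ i', (iidCN n).real {w | dec (x i + b • x' i' + w) ≠ i}) / M' := by
    intro i
    rw [integral_prod _ (hint' i), integral_unif]
    have h2 : ∀ i', ∫ w, {q : Fin M × Fin M' × CVec n |
        dec (x q.1 + b • x' q.2.1 + q.2.2) = q.1}.indicator (1 : Fin M × Fin M' × CVec n → ℝ) (i, i', w) ∂iidCN n =
        1 - (iidCN n).real {w | dec (x i + b • x' i' + w) ≠ i} := by
      intro i'
      rw [← probReal_compl_eq_one_sub (hs1 i i'), ← integral_indicator_one (hs1 i i').compl]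
      refine integral_congr_ae (ae_of_all _ fun w => ?_)
      simp [Set.indicator_apply]
    simp_rw [h2]
    rw [Finset.sum_sub_distrib, sub_div]
    simp [hM0']
  simp_rw [h1]
  rw [Finset.sum_sub_distrib, sub_div, ← Finset.sum_div, div_div]
  simp [hM0, mul_comm]

/-- Subtracting the mean codeword. -/
def centered {M n : ℕ} (x : Fin M → CVec n) (i : Fin M) : CVec n :=
  x i - fun j => ∫ i, x i j ∂unif M

lemma isCodebook_centered {M n : ℕ} (hM : 0 < M) (x : Fin M → CVec n) :
    IsCodebook (unif M) (centered x) := by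
  have := isProbabilityMeasure_unif hM
  refine ⟨measurable_of_finite _, ⟨∑ i, nsq (centered x i),
    Finset.sum_nonneg fun _ _ => nsq_nonneg _, fun i =>
    Finset.single_le_sum (f := fun i => nsq (centered x i)) (fun _ _ => nsq_nonneg _)
      (Finset.mem_univ i)⟩, fun j => ?_⟩
  simp only [centered, Pi.sub_apply]
  rw [integral_sub .of_finite (integrable_const _)]
  simp

/-- The second moment splits into that of the mean and that of the centred part. The power
constraint per codeword is only used in this averaged form. -/
lemma integral_nsq_centered_le {M n : ℕ} (hM : 0 < M) (x : Fin M → CVec n) {P : ℝ}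
    (hP : ∀ i, nsq (x i) ≤ n * P) : ∫ i, nsq (centered x i) ∂unif M ≤ n * P := by
  have := isProbabilityMeasure_unif hM
  have h := integral_nsq_add (isCodebook_centered hM x) (fun j => ∫ i, x i j ∂unif M) 1
  have h1 : ∀ i, (fun j => ∫ i, x i j ∂unif M) + (1 : ℂ) • centered x i = x i := by
    intro i; rw [one_smul, centered, add_sub_cancel]
  simp_rw [h1] at h
  have h2 : ∫ i, nsq (x i) ∂unif M ≤ n * P := by
    have := integral_mono (μ := unif M) .of_finite (integrable_const (n * P)) hP
    simpa using this
  have h3 := nsq_nonneg (fun j => ∫ i, x i j ∂unif M)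
  rw [norm_one, one_pow, one_mul] at h
  linarith

/-! ### From codes to the capacity region. -/

namespace GIC

variable (G : GIC) {κ : GenieParams}

/-- The converse for a code of length `n`. -/
lemma log_card_mul_le (hP₁ : 0 < G.P₁) (hP₂ : 0 < G.P₂) (hκ : κ.InRange)
    (had : G.Admissible κ) (hVW : 0 < varVW₂ κ) {n M₁ M₂ : ℕ} (hM₁ : 0 < M₁) (hM₂ : 0 < M₂)
    (c : Code n M₁ M₂ G.P₁ G.P₂) :
    G.errorProb₁ c ≤ 1 ∧ G.errorProb₂ c ≤ 1 ∧
    Real.log M₁ * (1 - G.errorProb₁ c) + Real.log M₂ * (1 - G.errorProb₂ c) ≤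
      Real.log 2 * (n * G.logBound κ + 2) := by
  have i1 := isProbabilityMeasure_unif hM₁
  have i2 := isProbabilityMeasure_unif hM₂
  set m₁ : CVec n := fun j => ∫ i, c.enc₁ i j ∂unif M₁ with hm₁
  set m₂ : CVec n := fun j => ∫ i, c.enc₂ i j ∂unif M₂ with hm₂
  -- Centring both codebooks shifts the outputs by known vectors; the decoders undo the shift, so
  -- the error probabilities do not change.
  let dec₁ : CVec n → Fin M₁ := fun y => c.dec₁ (y + (m₁ + G.h₁₂ • m₂))
  let dec₂ : CVec n → Fin M₂ := fun y => c.dec₂ (y + (m₂ + G.h₂₁ • m₁))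
  have hd₁ : Measurable dec₁ := c.measurable_dec₁.comp (measurable_id.add_const _)
  have hd₂ : Measurable dec₂ := c.measurable_dec₂.comp (measurable_id.add_const _)
  have e1 : correctProb (unif M₁) (unif M₂) (centered c.enc₁) (centered c.enc₂) G.h₁₂ dec₁ =
      1 - G.errorProb₁ c := by
    rw [correctProb_unif hM₁ hM₂ _ _ _ hd₁, errorProb₁]
    have : ∀ i i' w, centered c.enc₁ i + G.h₁₂ • centered c.enc₂ i' + w + (m₁ + G.h₁₂ • m₂) =
        fun j => c.enc₁ i j + G.h₁₂ * c.enc₂ i' j + w j := by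
      intro i i' w; ext j; simp [centered, hm₁, hm₂]; ring
    simp only [dec₁, this]
  have e2 : correctProb (unif M₂) (unif M₁) (centered c.enc₂) (centered c.enc₁) G.h₂₁ dec₂ =
      1 - G.errorProb₂ c := by
    rw [correctProb_unif hM₂ hM₁ _ _ _ hd₂, errorProb₂]
    have : ∀ i i' w, centered c.enc₂ i + G.h₂₁ • centered c.enc₁ i' + w + (m₂ + G.h₂₁ • m₁) =
        fun j => G.h₂₁ * c.enc₁ i' j + c.enc₂ i j + w j := by
      intro i i' w; ext j; simp [centered, hm₁, hm₂]; ring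
    simp only [dec₂, this]
    rw [Finset.sum_comm, mul_comm (M₁ : ℝ)]
  have key := G.sum_log_le hP₁ hP₂ hκ had hVW hM₁ hM₂ unif_singleton unif_singleton
    (isCodebook_centered hM₁ c.enc₁) (isCodebook_centered hM₂ c.enc₂)
    (integral_nsq_centered_le hM₁ _ c.power₁) (integral_nsq_centered_le hM₂ _ c.power₂) hd₁ hd₂
  have n1 : 0 ≤ correctProb (unif M₁) (unif M₂) (centered c.enc₁) (centered c.enc₂) G.h₁₂ dec₁ :=
    measureReal_nonneg
  have n2 : 0 ≤ correctProb (unif M₂) (unif M₁) (centered c.enc₂) (centered c.enc₁) G.h₂₁ dec₂ :=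
    measureReal_nonneg
  rw [e1] at key n1
  rw [e2] at key n2
  exact ⟨by linarith, by linarith, key⟩

/-- The floor of a number at least 1 is at least half of it: rounding costs at most one bit per
block. -/
lemma log_floor_two_rpow {n : ℕ} {R : ℝ} (hR : 0 ≤ R) :
    0 < ⌊(2 : ℝ) ^ (n * R)⌋₊ ∧ (n * R - 1) * Real.log 2 ≤ Real.log (⌊(2 : ℝ) ^ (n * R)⌋₊ : ℝ) := by
  have h1 : (1 : ℝ) ≤ (2 : ℝ) ^ (n * R) := Real.one_le_rpow one_le_two (by positivity)
  have h2 : 0 < ⌊(2 : ℝ) ^ (n * R)⌋₊ := Nat.floor_pos.2 h1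
  refine ⟨h2, ?_⟩
  have h3 := Nat.lt_floor_add_one ((2 : ℝ) ^ (n * R))
  have h4 : (1 : ℝ) ≤ ⌊(2 : ℝ) ^ (n * R)⌋₊ := by exact_mod_cast h2
  have h5 : (2 : ℝ) ^ (n * R - 1) ≤ ⌊(2 : ℝ) ^ (n * R)⌋₊ := by
    rw [Real.rpow_sub_one two_ne_zero]
    linarith
  rw [← Real.log_rpow two_pos]
  exact Real.log_le_log (by positivity) h5

/-- The finite-length converse is divided by n log 2. Rounding costs 1/n per user and Fano 2/n;
these and the error probabilities vanish in the limit. -/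
lemma add_le_logBound_of_achievable (hP₁ : 0 < G.P₁) (hP₂ : 0 < G.P₂) (hκ : κ.InRange)
    (had : G.Admissible κ) (hVW : 0 < varVW₂ κ) {R : ℝ × ℝ} (hR : G.Achievable R) :
    R.1 + R.2 ≤ G.logBound κ := by
  obtain ⟨hR1, hR2, c, hc1, hc2⟩ := hR
  have hlog2 := Real.log_pos one_lt_two
  have hn : ∀ n : ℕ, 0 < n → (R.1 - 1 / n) * (1 - G.errorProb₁ (c n))
      + (R.2 - 1 / n) * (1 - G.errorProb₂ (c n)) ≤ G.logBound κ + 2 * (1 / n) := by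
    intro n hn0
    have hn' : (0 : ℝ) < n := by exact_mod_cast hn0
    obtain ⟨p1, l1⟩ := log_floor_two_rpow (n := n) hR1
    obtain ⟨p2, l2⟩ := log_floor_two_rpow (n := n) hR2
    obtain ⟨q1, q2, key⟩ := G.log_card_mul_le hP₁ hP₂ hκ had hVW p1 p2 (c n)
    have m1 := mul_le_mul_of_nonneg_right l1 (sub_nonneg.2 q1)
    have m2 := mul_le_mul_of_nonneg_right l2 (sub_nonneg.2 q2)
    have h3 : Real.log 2 * (n * ((R.1 - 1 / n) * (1 - G.errorProb₁ (c n))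
        + (R.2 - 1 / n) * (1 - G.errorProb₂ (c n)))) ≤
        Real.log 2 * (n * (G.logBound κ + 2 * (1 / n))) := by
      have e1 : Real.log 2 * (n * ((R.1 - 1 / n) * (1 - G.errorProb₁ (c n))
          + (R.2 - 1 / n) * (1 - G.errorProb₂ (c n)))) =
          (n * R.1 - 1) * Real.log 2 * (1 - G.errorProb₁ (c n))
            + (n * R.2 - 1) * Real.log 2 * (1 - G.errorProb₂ (c n)) := by
        field_simp
      have e2 : (n : ℝ) * (G.logBound κ + 2 * (1 / n)) = n * G.logBound κ + 2 := by field_simp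
      rw [e1, e2]
      linarith
    exact le_of_mul_le_mul_left (le_of_mul_le_mul_left h3 hlog2) hn'
  have t0 := tendsto_one_div_atTop_nhds_zero_nat (𝕜 := ℝ)
  have t1 : Tendsto (fun n : ℕ => (R.1 - 1 / n) * (1 - G.errorProb₁ (c n))
      + (R.2 - 1 / n) * (1 - G.errorProb₂ (c n))) atTop (𝓝 (R.1 + R.2)) := by
    have := ((tendsto_const_nhds (x := R.1)).sub t0).mul
      ((tendsto_const_nhds (x := (1 : ℝ))).sub hc1) |>.add
      (((tendsto_const_nhds (x := R.2)).sub t0).mul ((tendsto_const_nhds (x := (1 : ℝ))).sub hc2))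
    simpa using this
  have t2 : Tendsto (fun n : ℕ => G.logBound κ + 2 * (1 / (n : ℝ))) atTop
      (𝓝 (G.logBound κ)) := by
    simpa using (tendsto_const_nhds (x := G.logBound κ)).add (t0.const_mul 2)
  exact le_of_tendsto_of_tendsto t1 t2
    ((eventually_gt_atTop 0).mono fun n h => hn n h)

/-- Without change-of-interference noise the bound is a limit of bounds with such noise. -/
lemma exists_tendsto_logBound (hP₁ : 0 < G.P₁) (hP₂ : 0 < G.P₂) (hκ : κ.InRange)
    (had : G.Admissible κ) (hVW : varVW₂ κ ≤ 0) :
    ∃ κ' : ℕ → GenieParams, (∀ k, (κ' k).InRange ∧ G.Admissible (κ' k) ∧ 0 < varVW₂ (κ' k)) ∧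
      Tendsto (fun k => G.logBound (κ' k)) atTop (𝓝 (G.logBound κ)) := by
  obtain ⟨h1, h2, h3, h4, h5, h6, h7, h8⟩ := id hκ
  obtain ⟨hmin, hint, hZ, hh, hVN, hσ, hβ⟩ := id had
  have hh' : 0 < ‖G.h₂₁‖ := norm_pos_iff.2 hh
  -- Since σ_{N₁} > 0, the hypothesis on the minimum leaves σ_{W₂} = 0 as the only degenerate case.
  have hW0 : κ.σW₂ = 0 := by
    have := hmin.trans hVW
    rcases min_le_iff.1 this with h | h
    · have : 0 < κ.σN₁ ^ 2 := by positivity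
      linarith
    · exact pow_eq_zero_iff two_ne_zero |>.1 (le_antisymm h (sq_nonneg _))
  have hVW0 : varVW₂ κ = 0 := by rw [varVW₂_eq h8 hβ, hW0]; simp
  have hβ1 : varZ₂subW₂ κ = 1 := by rw [varZ₂subW₂_eq h8, hW0]; simp
  -- With σ = ρ = ε the noise W₂ is uncorrelated with Z₂ - W₂: E[Z₂W₂*] = ε² = E|W₂|². Hence
  -- σ²_{V_{W₂}} = σ²_{W₂} = ε² and the condition on the minimum is automatic, while σ²_{Z₂-W₂} = 1
  -- - ε² only decreases, so the condition involving h₁₂ persists.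
  let K : ℝ → GenieParams := fun ε => { κ with σW₂ := ε, ρW₂ := (ε : ℂ) }
  have kρ : ∀ ε : ℝ, 0 < ε → ε < 1 → ‖(K ε).ρW₂‖ ≤ 1 := by
    intro ε h0 h1
    simp only [K, Complex.norm_real, Real.norm_eq_abs, abs_of_pos h0]
    exact h1.le
  have kβ : ∀ ε : ℝ, 0 < ε → ε < 1 → varZ₂subW₂ (K ε) = 1 - ε ^ 2 := by
    intro ε h0 h1
    rw [varZ₂subW₂_eq (kρ ε h0 h1)]
    simp only [K, ← Complex.ofReal_mul, Complex.ofReal_re]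
    ring
  have kVW : ∀ ε : ℝ, 0 < ε → ε < 1 → varVW₂ (K ε) = ε ^ 2 := by
    intro ε h0 h1
    have hp : 0 < 1 - ε ^ 2 := by nlinarith
    rw [varVW₂_eq (kρ ε h0 h1) (by rw [kβ ε h0 h1]; exact hp), kβ ε h0 h1]
    simp only [K, Complex.norm_real, Real.norm_eq_abs, sq_abs]
    field_simp
  have kVN : ∀ ε, varVN₁ (K ε) = varVN₁ κ := fun ε => rfl
  have kZ : ∀ ε, G.varZ₁subN₁ (K ε) = G.varZ₁subN₁ κ := fun ε => rfl
  let Φ : ℝ → ℝ := fun ε => 1 / 2 * (Real.logb 2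
      ((G.P₁ + ‖G.h₁₂‖ ^ 2 * G.P₂ + 1
          - ‖conj G.h₂₁ * G.P₁ + κ.ρN₁ * κ.σN₁‖ ^ 2 / (‖G.h₂₁‖ ^ 2 * G.P₁ + κ.σN₁ ^ 2)) /
        (‖G.h₁₂‖ ^ 2 * G.P₂ + 1
          - ‖κ.ρN₁ * κ.σN₁ - G.h₂₁⁻¹ * (κ.σN₁ : ℂ) ^ 2‖ ^ 2 /
              (‖G.h₂₁‖ ^ 2 * G.P₁ + κ.σN₁ ^ 2)))
    + Real.logb 2
      ((G.P₂ + ‖G.h₂₁‖ ^ 2 * G.P₁ + 1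
          - ‖((‖G.h₂₁‖ ^ 2 * G.P₁ : ℝ) : ℂ) + (ε : ℂ) * (ε : ℂ)‖ ^ 2 /
              (‖G.h₂₁‖ ^ 2 * G.P₁ + ε ^ 2)) /
        (‖G.h₁₂‖ ^ 2 * G.P₂ + varVN₁ κ
          - ‖G.h₁₂ * (ε : ℂ) * (ε : ℂ) - G.h₁₂ * (ε : ℂ) ^ 2‖ ^ 2 /
              (‖G.h₂₁‖ ^ 2 * G.P₁ + ε ^ 2)))
    + (Real.logb 2 ((‖G.h₂₁‖ ^ 2 * G.P₁ + κ.σN₁ ^ 2) / (‖G.h₂₁‖ ^ 2 * G.P₁ + ε ^ 2))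
    + Real.logb 2 ((‖G.h₂₁‖ ^ 2 * G.P₁ + ε ^ 2) / (‖G.h₂₁‖ ^ 2 * G.P₁ + 1))
    + Real.logb 2 ((G.P₁ + ‖G.h₁₂‖ ^ 2 * G.P₂ + 1) / κ.σN₁ ^ 2)
    + Real.logb 2 ((G.P₂ + ‖G.h₂₁‖ ^ 2 * G.P₁ + 1) /
        (1 + ε ^ 2 - 2 * ((ε : ℂ) * (ε : ℂ)).re))))
  have hΦ : ∀ ε : ℝ, 0 < ε → ε < 1 → G.logBound (K ε) = Φ ε := by
    intro ε h0 h1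
    simp only [logBound, R₀Log, kVW ε h0 h1, kVN]
    rfl
  have hΦ0 : G.logBound κ = Φ 0 := by
    simp [logBound, R₀Log, hVW0, hW0, Φ]
  set a := ‖G.h₂₁‖ ^ 2 * G.P₁ with ha
  have ha0 : 0 < a := by positivity
  have hσN2 : 0 < κ.σN₁ ^ 2 := by positivity
  have hcont : ContinuousAt Φ 0 := by
    have c1 : ContinuousAt (fun ε : ℝ => (G.P₂ + a + 1
          - ‖((a : ℝ) : ℂ) + (ε : ℂ) * (ε : ℂ)‖ ^ 2 / (a + ε ^ 2)) /
        (‖G.h₁₂‖ ^ 2 * G.P₂ + varVN₁ κ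
          - ‖G.h₁₂ * (ε : ℂ) * (ε : ℂ) - G.h₁₂ * (ε : ℂ) ^ 2‖ ^ 2 / (a + ε ^ 2))) 0 := by
      have p : 0 < ‖G.h₁₂‖ ^ 2 * G.P₂ + varVN₁ κ := by positivity
      refine ContinuousAt.div (ContinuousAt.sub (by fun_prop) (ContinuousAt.div (by fun_prop)
        (by fun_prop) (by simpa using ha0.ne'))) (ContinuousAt.sub (by fun_prop)
        (ContinuousAt.div (by fun_prop) (by fun_prop) (by simpa using ha0.ne'))) ?_
      simpa using p.ne'
    have c2 : ContinuousAt (fun ε : ℝ => (a + κ.σN₁ ^ 2) / (a + ε ^ 2)) 0 :=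
      ContinuousAt.div (by fun_prop) (by fun_prop) (by simpa using ha0.ne')
    have c3 : ContinuousAt (fun ε : ℝ => (a + ε ^ 2) / (a + 1)) 0 := by fun_prop
    have c4 : ContinuousAt (fun ε : ℝ => (G.P₂ + a + 1) /
        (1 + ε ^ 2 - 2 * ((ε : ℂ) * (ε : ℂ)).re)) 0 := by
      refine ContinuousAt.div (by fun_prop) ?_ (by simp)
      exact (by fun_prop : Continuous fun ε : ℝ =>
        1 + ε ^ 2 - 2 * ((ε : ℂ) * (ε : ℂ)).re).continuousAt
    have l : ∀ {f : ℝ → ℝ}, ContinuousAt f 0 → f 0 ≠ 0 →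
        ContinuousAt (fun ε => Real.logb 2 (f ε)) 0 := fun {f} hf h0 =>
      (hf.log h0).div_const _
    refine continuousAt_const.mul ((continuousAt_const.add (l c1 ?_)).add
      ((((l c2 ?_).add (l c3 ?_)).add continuousAt_const).add (l c4 ?_)))
    · have p : 0 < ‖G.h₁₂‖ ^ 2 * G.P₂ + varVN₁ κ := by positivity
      have e : G.P₂ + a + 1 - a ^ 2 / a = G.P₂ + 1 := by field_simp; ring
      have : (G.P₂ + a + 1 - a ^ 2 / a) / (‖G.h₁₂‖ ^ 2 * G.P₂ + varVN₁ κ) ≠ 0 := by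
        rw [e]; positivity
      simpa using this
    · simp; constructor <;> positivity
    · simp; constructor <;> positivity
    · simp; positivity
  let ε : ℕ → ℝ := fun k => 1 / ((k : ℝ) + 2)
  have hε0 : ∀ k, 0 < ε k := fun k => by positivity
  have hε1 : ∀ k, ε k < 1 := fun k => by
    rw [div_lt_one (by positivity)]
    have : (0 : ℝ) ≤ k := Nat.cast_nonneg k
    linarith
  have hεt : Tendsto ε atTop (𝓝 0) :=
    tendsto_const_nhds.div_atTop (tendsto_natCast_atTop_atTop.atTop_add tendsto_const_nhds)
  refine ⟨fun k => K (ε k), fun k => ⟨⟨h1, h2, h3, ⟨(hε0 k).le, (hε1 k).le⟩, h5, h6, h7,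
    kρ _ (hε0 k) (hε1 k)⟩, ⟨?_, ?_, hZ, hh, hVN, hσ, ?_⟩, ?_⟩, ?_⟩
  · rw [kVW _ (hε0 k) (hε1 k)]; exact min_le_right _ _
  · rw [kβ _ (hε0 k) (hε1 k), kVN]
    rw [hβ1, mul_one] at hint
    refine le_trans ?_ hint
    exact mul_le_of_le_one_right (by positivity) (by nlinarith [hε0 k])
  · rw [kβ _ (hε0 k) (hε1 k)]; nlinarith [hε0 k, hε1 k]
  · rw [kVW _ (hε0 k) (hε1 k)]; have := hε0 k; positivity
  · rw [hΦ0]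
    refine (hcont.tendsto.comp hεt).congr fun k => (hΦ _ (hε0 k) (hε1 k)).symm

/-- The bound cuts out a closed half-plane, so it passes from achievable pairs to their closure;
degenerate parameters are reached as limits. -/
lemma add_le_logBound (hP₁ : 0 < G.P₁) (hP₂ : 0 < G.P₂) (hκ : κ.InRange)
    (had : G.Admissible κ) {R : ℝ × ℝ} (hR : R ∈ G.capacityRegion) :
    R.1 + R.2 ≤ G.logBound κ := by
  have hclosed : IsClosed {R : ℝ × ℝ | R.1 + R.2 ≤ G.logBound κ} :=
    isClosed_le (by fun_prop) continuous_const
  refine closure_minimal (fun R hR => ?_) hclosed hR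
  rcases lt_or_ge 0 (varVW₂ κ) with h | h
  · exact G.add_le_logBound_of_achievable hP₁ hP₂ hκ had h hR
  · obtain ⟨κ', hκ', ht⟩ := G.exists_tendsto_logBound hP₁ hP₂ hκ had h
    exact ge_of_tendsto' ht fun k => G.add_le_logBound_of_achievable hP₁ hP₂ (hκ' k).1
      (hκ' k).2.1 (hκ' k).2.2 hR

lemma entropy_bound_of_admissible (hP₁ : 0 < G.P₁) (hP₂ : 0 < G.P₂) (hκ : κ.InRange)
    (had : G.Admissible κ) :
    (∀ R ∈ G.capacityRegion, R.1 + R.2 ≤ G.entropyBound κ) ∧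
      G.entropyBound κ = G.logBound κ ∧ G.R₀ κ = G.R₀Log κ := by
  have h := G.entropyBound_eq_logBound hP₁ hP₂ hκ had
  exact ⟨fun R hR => h ▸ G.add_le_logBound hP₁ hP₂ hκ had hR, h,
    G.R₀_eq_R₀Log hP₁ hP₂ hκ had⟩

/-! ### Interchanging the users -/

/-- The code with the users interchanged. -/
def _root_.Code.swap {n M₁ M₂ : ℕ} {P₁ P₂ : ℝ} (c : Code n M₁ M₂ P₁ P₂) : Code n M₂ M₁ P₂ P₁ :=
  ⟨c.enc₂, c.enc₁, c.power₂, c.power₁, c.dec₂, c.dec₁, c.measurable_dec₂, c.measurable_dec₁⟩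

lemma errorProb₁_swap {n M₁ M₂ : ℕ} (c : Code n M₁ M₂ G.P₁ G.P₂) :
    G.swap.errorProb₁ c.swap = G.errorProb₂ c := by
  simp only [errorProb₁, errorProb₂]
  rw [Finset.sum_comm, mul_comm (M₁ : ℝ)]
  simp only [add_comm (G.h₂₁ * _)]
  rfl

lemma errorProb₂_swap {n M₁ M₂ : ℕ} (c : Code n M₁ M₂ G.P₁ G.P₂) :
    G.swap.errorProb₂ c.swap = G.errorProb₁ c := by
  simp only [errorProb₁, errorProb₂]
  rw [Finset.sum_comm, mul_comm (M₁ : ℝ)]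
  simp only [add_comm _ (G.h₁₂ * _)]
  rfl

lemma achievable_swap {R : ℝ × ℝ} (hR : G.Achievable R) : G.swap.Achievable R.swap := by
  obtain ⟨h1, h2, c, hc1, hc2⟩ := hR
  exact ⟨h2, h1, fun n => (c n).swap, hc2.congr fun n => (G.errorProb₁_swap (c n)).symm,
    hc1.congr fun n => (G.errorProb₂_swap (c n)).symm⟩

lemma swap_mem_capacityRegion {R : ℝ × ℝ} (hR : R ∈ G.capacityRegion) :
    R.swap ∈ G.swap.capacityRegion :=
  map_mem_closure continuous_swap hR fun _ h => G.achievable_swap h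

end GIC

lemma GenieParams.InRange.swap {κ : GenieParams} (h : κ.InRange) : κ.swap.InRange := by
  obtain ⟨h1, h2, h3, h4, h5, h6, h7, h8⟩ := h
  exact ⟨h2, h1, h4, h3, h6, h5, h8, h7⟩

theorem mainTheorem5 (G : GIC) (hP₁ : 0 < G.P₁) (hP₂ : 0 < G.P₂) (hweak : G.WeakInterference)
    (κ : GenieParams) (hκ : κ.InRange) :
    (G.Admissible κ →
      (∀ R ∈ G.capacityRegion, R.1 + R.2 ≤ G.entropyBound κ) ∧
      G.entropyBound κ = G.logBound κ ∧ G.R₀ κ = G.R₀Log κ) ∧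
    (G.swap.Admissible κ.swap →
      (∀ R ∈ G.capacityRegion, R.1 + R.2 ≤ G.swap.entropyBound κ.swap) ∧
      G.swap.entropyBound κ.swap = G.swap.logBound κ.swap ∧
      G.swap.R₀ κ.swap = G.swap.R₀Log κ.swap) := by
  refine ⟨G.entropy_bound_of_admissible hP₁ hP₂ hκ, fun had => ?_⟩
  obtain ⟨h1, h2⟩ := G.swap.entropy_bound_of_admissible hP₂ hP₁ hκ.swap had
  refine ⟨fun R hR => ?_, h2⟩
  have := h1 R.swap (G.swap_mem_capacityRegion hR)
  rw [add_comm]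
  exact this

end
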